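/- Let $M$ be a compact (Hausdorff) complex manifold of complex dimension $n\ge 2$ with a Kähler metric $h$, written $h=\sum_{\alpha,\beta} h_{\alpha\bar\beta}\,dz^\alpha\otimes d\bar z^\beta$ in local holomorphic coordinates, and let $$R_{\alpha\bar\beta\gamma\bar\delta}=-\frac{\partial^2 h_{\gamma\bar\delta}}{\partial z^\alpha\partial\bar z^\beta}+\sum_{\sigma,\tau}h^{\bar\tau\sigma}\frac{\partial h_{\gamma\bar\tau}}{\partial z^\alpha}\frac{\partial h_{\sigma\bar\delta}}{\partial\bar z^\beta}$$ be its curvature tensor, where $(h^{\bar\tau\sigma})$ is the inverse matrix of $(h_{\sigma\bar\delta})$. Assume that $(M,h)$ has positive orthogonal bisectional curvature: at every point, $$R(X,\bar X,Y,\bar Y)=\sum R_{\alpha\bar\beta\gamma\bar\delta}X^\alpha\overline{X^\beta}Y^\gamma\overline{Y^\delta}>0$$ for all nonzero tangent vectors $X,Y$ of type $(1,0)$ with $\langle X,Y\rangle=\sum h_{\alpha\bar\beta}X^\alpha\overline{Y^\beta}=0$. For a smooth map $f:\mathbb P^1\to M$ define the energy $$E(f)=\int_{\mathbb P^1}\sum_{\alpha,\beta}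 h_{\alpha\bar\beta}\left(\frac{\partial f^\alpha}{\partial w}\overline{\frac{\partial f^\beta}{\partial w}}+\frac{\partial f^\alpha}{\partial\bar w}\overline{\frac{\partial f^\beta}{\partial\bar w}}\right)\sqrt{-1}\,dw\wedge d\bar w ,$$ where $w$ is a local holomorphic coordinate of $\mathbb P^1$. Call a smooth map $f:\mathbb P^1\to M$ energy minimizing if $E(f)\le E(g)$ for every smooth map $g:\mathbb P^1\to M$ homotopic to $f$. Then every energy minimizing map $f:\mathbb P^1\to M$ is holomorphic or conjugate holomorphic. -/

import Mathlib

open Filter Topology Manifold MeasureTheory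
open scoped ContDiff ComplexConjugate

noncomputable section

namespace RiemannSphere

/-- The complex projective line `ℙ¹`, realised as the Riemann sphere `ℂ ∪ {∞}`. -/
abbrev P1 : Type := OnePoint ℂ

/-- The inversion `w ↦ 1 / w` of the Riemann sphere, exchanging `0` and `∞`. -/
def invFun (p : P1) : P1 :=
  p.elim ((0 : ℂ) : P1) (fun w => if w = 0 then OnePoint.infty else ((w⁻¹ : ℂ) : P1))

@[simp] theorem invFun_infty : invFun OnePoint.infty = ((0 : ℂ) : P1) := rfl

@[simp] theorem invFun_zero : invFun ((0 : ℂ) : P1) = OnePoint.infty := by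
  simp [invFun]

theorem invFun_coe {w : ℂ} (hw : w ≠ 0) : invFun (w : P1) = ((w⁻¹ : ℂ) : P1) := by
  simp [invFun, hw]

theorem invFun_involutive : Function.Involutive invFun := by
  intro p
  induction p using OnePoint.rec with
  | infty => simp
  | coe w =>
    by_cases hw : w = 0
    · subst hw; simp
    · rw [invFun_coe hw, invFun_coe (inv_ne_zero hw), inv_inv]

theorem continuous_invFun : Continuous invFun := by
  rw [continuous_iff_continuousAt]
  intro p
  induction p using OnePoint.rec with
  | infty =>
    rw [OnePoint.continuousAt_infty', Filter.coclosedCompact_eq_cocompact,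
      ← Metric.cobounded_eq_cocompact, invFun_infty]
    have h : Tendsto (fun w : ℂ => ((w⁻¹ : ℂ) : P1)) (Bornology.cobounded ℂ)
        (𝓝 ((0 : ℂ) : P1)) :=
      (OnePoint.continuous_coe.tendsto (0 : ℂ)).comp tendsto_inv₀_cobounded
    refine h.congr' ?_
    filter_upwards [Bornology.eventually_ne_cobounded (0 : ℂ)] with w hw
    exact (invFun_coe hw).symm
  | coe w =>
    rw [OnePoint.continuousAt_coe]
    by_cases hw : w = 0
    · subst hw
      rw [continuousAt_iff_punctured_nhds]
      have h : Tendsto (fun w : ℂ => ((w⁻¹ : ℂ) : P1)) (𝓝[≠] 0)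
          (𝓝 (OnePoint.infty : P1)) := by
        refine OnePoint.tendsto_coe_infty.comp ?_
        rw [Filter.coclosedCompact_eq_cocompact, ← Metric.cobounded_eq_cocompact]
        exact tendsto_inv₀_nhdsNE_zero
      simp only [Function.comp, invFun_zero]
      refine h.congr' ?_
      filter_upwards [self_mem_nhdsWithin] with w hw
      exact (invFun_coe hw).symm
    · have h : ContinuousAt (fun w : ℂ => ((w⁻¹ : ℂ) : P1)) w :=
        (OnePoint.continuous_coe.continuousAt).comp (continuousAt_inv₀ hw)
      refine h.congr ?_
      filter_upwards [isOpen_ne.mem_nhds hw] with w hw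
      exact (invFun_coe hw).symm

/-- The inversion as a homeomorphism. -/
def inv : P1 ≃ₜ P1 where
  toFun := invFun
  invFun := invFun
  left_inv := invFun_involutive
  right_inv := invFun_involutive
  continuous_toFun := continuous_invFun
  continuous_invFun := continuous_invFun

/-- The affine chart `w` on `ℙ¹ ∖ {∞}`. -/
def chartZero : OpenPartialHomeomorph P1 ℂ :=
  (OnePoint.isOpenEmbedding_coe.toOpenPartialHomeomorph ((↑) : ℂ → P1)).symm

/-- The chart `1 / w` on `ℙ¹ ∖ {0}`, taking the value `0` at `∞`. -/
def chartInfty : OpenPartialHomeomorph P1 ℂ :=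
  inv.toOpenPartialHomeomorph.trans chartZero

@[simp] theorem chartZero_source : chartZero.source = Set.range ((↑) : ℂ → P1) := by
  simp [chartZero]

@[simp] theorem chartZero_target : chartZero.target = Set.univ := by
  simp [chartZero]

@[simp] theorem chartZero_symm_apply (w : ℂ) : chartZero.symm w = (w : P1) := rfl

@[simp] theorem chartZero_coe (w : ℂ) : chartZero (w : P1) = w :=
  chartZero.right_inv (x := w) (by simp)

theorem chartInfty_symm_apply (w : ℂ) : chartInfty.symm w = invFun (w : P1) := rfl

theorem chartInfty_apply (p : P1) : chartInfty p = chartZero (invFun p) := rfl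

theorem mem_chartInfty_source (p : P1) :
    p ∈ chartInfty.source ↔ invFun p ∈ Set.range ((↑) : ℂ → P1) := by
  simp only [chartInfty, OpenPartialHomeomorph.trans_source, chartZero_source]
  simp [inv, Set.mem_preimage]
  rfl

/-- The complex structure of `ℙ¹`, given by the two charts `w` and `1 / w`. -/
instance : ChartedSpace ℂ P1 where
  atlas := {chartZero, chartInfty}
  chartAt p := p.elim chartInfty (fun _ => chartZero)
  mem_chart_source p := by
    induction p using OnePoint.rec with
    | infty => exact (mem_chartInfty_source _).2 ⟨0, rfl⟩
    | coe w => simp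
  chart_mem_atlas p := by
    induction p using OnePoint.rec with
    | infty => simp
    | coe w => simp

theorem contDiffOn_inv_ne : ContDiffOn ℂ ω (fun w : ℂ => w⁻¹) {0}ᶜ := fun _ hw =>
  (contDiffAt_inv ℂ hw).contDiffWithinAt

/-- The transition functions of `ℙ¹` are holomorphic. -/
instance : IsManifold 𝓘(ℂ, ℂ) ω P1 := by
  refine isManifold_of_contDiffOn _ _ _ ?_
  have key : ∀ w : ℂ, w ≠ 0 → chartZero (invFun (w : P1)) = w⁻¹ := fun w hw => by
    rw [invFun_coe hw, chartZero_coe]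
  rintro e e' (rfl | rfl) (rfl | rfl)
  · refine contDiffOn_id.congr ?_
    intro w _
    simp
  · refine (contDiffOn_inv_ne.mono ?_).congr ?_
    all_goals
      intro w hw
      have hw0 : w ≠ 0 := by
        rintro rfl
        simp [mem_chartInfty_source] at hw
    · exact hw0
    · exact key w hw0
  · refine (contDiffOn_inv_ne.mono ?_).congr ?_
    all_goals
      intro w hw
      have hw0 : w ≠ 0 := by
        rintro rfl
        simp [chartInfty_symm_apply] at hw
    · exact hw0
    · exact key w hw0
  · refine contDiffOn_id.congr ?_
    intro w _
    simp [chartInfty_symm_apply, chartInfty_apply, invFun_involutive (w : P1)]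

end RiemannSphere

namespace KahlerGeometry

open RiemannSphere

/-- The model space `ℂⁿ` of `n`-dimensional complex manifolds. -/
abbrev Cn (n : ℕ) : Type := EuclideanSpace ℂ (Fin n)

/-- The coordinate vector `∂/∂z^α` of `ℂⁿ`. -/
def coordVec {n : ℕ} (α : Fin n) : Cn n := EuclideanSpace.single α (1 : ℂ)

/-- The Wirtinger derivative `∂F/∂z^α = (∂F/∂x^α - i ∂F/∂y^α) / 2` at `z`. -/
def dz {n : ℕ} (α : Fin n) (F : Cn n → ℂ) (z : Cn n) : ℂ :=
  (1 / 2) * (fderiv ℝ F z (coordVec α) - Complex.I * fderiv ℝ F z (Complex.I • coordVec α))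

/-- The Wirtinger derivative `∂F/∂z̄^α = (∂F/∂x^α + i ∂F/∂y^α) / 2` at `z`. -/
def dzbar {n : ℕ} (α : Fin n) (F : Cn n → ℂ) (z : Cn n) : ℂ :=
  (1 / 2) * (fderiv ℝ F z (coordVec α) + Complex.I * fderiv ℝ F z (Complex.I • coordVec α))

section Metric

variable {n : ℕ} {M : Type*} [TopologicalSpace M] [ChartedSpace (Cn n) M]

/-- The coefficients `h_{αβ̄}(z) = h(∂/∂z^α, ∂/∂z^β)` of a family of sesquilinear forms on the
tangent spaces, in the chart `e`; `∂/∂z^α` at the point `e⁻¹(z)` is the image of the coordinate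
vector under the differential of `e⁻¹`. -/
def metricCoeff
    (h : ∀ x : M, TangentSpace 𝓘(ℂ, Cn n) x →ₗ[ℂ] TangentSpace 𝓘(ℂ, Cn n) x →ₗ⋆[ℂ] ℂ)
    (e : OpenPartialHomeomorph M (Cn n)) (α β : Fin n) (z : Cn n) : ℂ :=
  h (e.symm z)
    (mfderiv 𝓘(ℂ, Cn n) 𝓘(ℂ, Cn n) e.symm z (coordVec α))
    (mfderiv 𝓘(ℂ, Cn n) 𝓘(ℂ, Cn n) e.symm z (coordVec β))

variable (n M) in
/-- A Kähler metric on an `n`-dimensional complex manifold `M`: a smooth Hermitian metric on the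
holomorphic tangent bundle (linear in the first and conjugate linear in the second variable) whose
fundamental form `i h_{αβ̄} dz^α ∧ dz̄^β` is closed, that is
`∂h_{αβ̄}/∂z^γ = ∂h_{γβ̄}/∂z^α` in holomorphic coordinates. The complex tangent space of `M` at
`x` is identified with `T^{1,0}_x M` in the usual way. -/
structure KahlerMetric where
  /-- the Hermitian form on each tangent space -/
  form : ∀ x : M, TangentSpace 𝓘(ℂ, Cn n) x →ₗ[ℂ] TangentSpace 𝓘(ℂ, Cn n) x →ₗ⋆[ℂ] ℂ
  conj_symm : ∀ (x : M) (v w : TangentSpace 𝓘(ℂ, Cn n) x), conj (form x v w) = form x w v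
  pos : ∀ (x : M) (v : TangentSpace 𝓘(ℂ, Cn n) x), v ≠ 0 → 0 < (form x v v).re
  smooth : ∀ e ∈ IsManifold.maximalAtlas 𝓘(ℂ, Cn n) ω M, ∀ α β : Fin n,
    ContDiffOn ℝ ∞ (metricCoeff form e α β) e.target
  closed : ∀ e ∈ IsManifold.maximalAtlas 𝓘(ℂ, Cn n) ω M, ∀ z ∈ e.target, ∀ α β γ : Fin n,
    dz γ (metricCoeff form e α β) z = dz α (metricCoeff form e γ β) z

/-- The Hermitian matrix `(h_{αβ̄})` of the metric in the chart `e`. -/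
def KahlerMetric.coeff (h : KahlerMetric n M) (e : OpenPartialHomeomorph M (Cn n)) (z : Cn n) :
    Matrix (Fin n) (Fin n) ℂ :=
  Matrix.of fun α β => metricCoeff h.form e α β z

/-- The curvature coefficients
`R_{αβ̄γδ̄} = - ∂²h_{γδ̄}/∂z^α∂z̄^β + h^{τ̄σ} ∂h_{γτ̄}/∂z^α ∂h_{σδ̄}/∂z̄^β`
in the chart `e`, where `(h^{τ̄σ})` is the inverse matrix of `(h_{σδ̄})`. -/
def KahlerMetric.curvCoeff (h : KahlerMetric n M) (e : OpenPartialHomeomorph M (Cn n))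
    (α β γ δ : Fin n) (z : Cn n) : ℂ :=
  - dz α (fun u => dzbar β (fun v => h.coeff e v γ δ) u) z
    + ∑ σ, ∑ τ, (h.coeff e z)⁻¹ τ σ * dz α (fun v => h.coeff e v γ τ) z
        * dzbar β (fun v => h.coeff e v σ δ) z

/-- The bisectional curvature `R(X, X̄, Y, Ȳ) = R_{αβ̄γδ̄} X^α X̄^β Y^γ Ȳ^δ` at the point with
coordinate `z` in the chart `e`, where `X = X^α ∂/∂z^α` and `Y = Y^α ∂/∂z^α`. -/
def KahlerMetric.bisectional (h : KahlerMetric n M) (e : OpenPartialHomeomorph M (Cn n))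
    (z : Cn n) (X Y : Fin n → ℂ) : ℂ :=
  ∑ α, ∑ β, ∑ γ, ∑ δ, h.curvCoeff e α β γ δ z * X α * conj (X β) * Y γ * conj (Y δ)

/-- Positive orthogonal bisectional curvature: `R(X, X̄, Y, Ȳ) > 0` for all nonzero `(1,0)`-vectors
`X`, `Y` at a common point with `⟨X, Y⟩ = 0`, expressed in holomorphic coordinates. The number
`R(X, X̄, Y, Ȳ)` is real and does not depend on the coordinates. -/
def KahlerMetric.PosOrthBisectional (h : KahlerMetric n M) : Prop :=
  ∀ e ∈ IsManifold.maximalAtlas 𝓘(ℂ, Cn n) ω M, ∀ z ∈ e.target, ∀ X Y : Fin n → ℂ,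
    X ≠ 0 → Y ≠ 0 → ∑ α, ∑ β, h.coeff e z α β * X α * conj (Y β) = 0 →
      0 < (h.bisectional e z X Y).re

end Metric

section Maps

variable {n : ℕ} {M : Type*} [TopologicalSpace M] [ChartedSpace (Cn n) M]

/-- The real differential, at the point `w` of the affine chart `ℂ` of `ℙ¹`, of a map
`f : ℙ¹ → M`. -/
def affineDeriv (f : P1 → M) (w : ℂ) (v : ℂ) : TangentSpace 𝓘(ℂ, Cn n) (f (w : P1)) :=
  mfderiv 𝓘(ℝ, ℂ) 𝓘(ℝ, Cn n) (fun u : ℂ => f (u : P1)) w v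

/-- The vector `f^α_w ∂/∂z^α`, that is, the `(1,0)`-part of `f_*(∂/∂w)`. -/
def delW (f : P1 → M) (w : ℂ) : TangentSpace 𝓘(ℂ, Cn n) (f (w : P1)) :=
  (1 / 2 : ℂ) • (affineDeriv f w 1 - Complex.I • affineDeriv f w Complex.I)

/-- The vector `f^α_w̄ ∂/∂z^α`, that is, the `(1,0)`-part of `f_*(∂/∂w̄)`. -/
def delWbar (f : P1 → M) (w : ℂ) : TangentSpace 𝓘(ℂ, Cn n) (f (w : P1)) :=
  (1 / 2 : ℂ) • (affineDeriv f w 1 + Complex.I • affineDeriv f w Complex.I)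

/-- The energy
`E(f) = ∫_{ℙ¹} h_{αβ̄} (f^α_w conj(f^β_w) + f^α_w̄ conj(f^β_w̄)) i dw ∧ dw̄` of a map `f : ℙ¹ → M`,
computed in the affine coordinate `w`, where `i dw ∧ dw̄` is twice Lebesgue measure; the point `∞`
which this coordinate leaves out has measure zero. -/
def energy (h : KahlerMetric n M) (f : P1 → M) : ℝ :=
  ∫ w : ℂ, 2 * ((h.form (f (w : P1)) (delW f w) (delW f w)).re
    + (h.form (f (w : P1)) (delWbar f w) (delWbar f w)).re)

/-- A smooth map `f : ℙ¹ → M` is energy minimizing if it has the least energy among all smooth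
maps homotopic to it. -/
def IsEnergyMinimizing (h : KahlerMetric n M)
    (f : C^∞⟮𝓘(ℝ, ℂ), P1; 𝓘(ℝ, Cn n), M⟯) : Prop :=
  ∀ g : C^∞⟮𝓘(ℝ, ℂ), P1; 𝓘(ℝ, Cn n), M⟯,
    ContinuousMap.Homotopic (f : C(P1, M)) (g : C(P1, M)) → energy h f ≤ energy h g

/-- A holomorphic map `ℙ¹ → M`. -/
def IsHolomorphic (n : ℕ) {M : Type*} [TopologicalSpace M] [ChartedSpace (Cn n) M] (f : P1 → M) : Prop :=
  MDifferentiable 𝓘(ℂ, ℂ) 𝓘(ℂ, Cn n) f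

/-- The real differential of `f : ℙ¹ → M` at `p`, between the complex tangent spaces. -/
def realDeriv (n : ℕ) {M : Type*} [TopologicalSpace M] [ChartedSpace (Cn n) M] (f : P1 → M) (p : P1) (v : TangentSpace 𝓘(ℂ, ℂ) p) :
    TangentSpace 𝓘(ℂ, Cn n) (f p) :=
  mfderiv 𝓘(ℝ, ℂ) 𝓘(ℝ, Cn n) f p v

/-- A conjugate holomorphic map `ℙ¹ → M`: a real differentiable map whose differential is
conjugate linear at every point. -/
def IsConjHolomorphic (n : ℕ) {M : Type*} [TopologicalSpace M] [ChartedSpace (Cn n) M] (f : P1 → M) : Prop :=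
  MDifferentiable 𝓘(ℝ, ℂ) 𝓘(ℝ, Cn n) f ∧
    ∀ (p : P1) (v : TangentSpace 𝓘(ℂ, ℂ) p),
      realDeriv n f p (Complex.I • v) = -(Complex.I • realDeriv n f p v)

end Maps

end KahlerGeometry

end

set_option linter.unusedSectionVars false

/-! Write `f_w`, `f_w̄` for the (1,0)-parts of the images of `∂/∂w`, `∂/∂w̄`. The energy is twice
the integral of `|f_w|² + |f_w̄|²`, while the integral of `|f_w|² - |f_w̄|²` is, up to a constant
factor, the integral of the pulled-back Kähler form. Since that form is closed, the difference does
not change along a deformation supported in a compact part of the affine plane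
(`IsVariation.setIntegral_famW_sub_famBar`). Hence an energy minimizing map also minimizes the
integral of `|f_w̄|²` along such deformations; this is `BarMinimizing`, and nearly everything
afterwards uses only this property.

First variation: `f` is harmonic, `D_w f_w̄ = 0`. Therefore the coefficient `⟨f_w, f_w̄⟩` of the
Hopf differential is an entire function. Being the coefficient of a quadratic differential on the
sphere it decays like `|w|⁻⁴` at infinity, so it vanishes by Liouville: `f_w` and `f_w̄` are
orthogonal everywhere, which is exactly the situation in which the curvature hypothesis speaks.

Second variation: take a family holomorphic in a complex parameter `t` with initial velocity `φ
f_w`, where `φ` is a cut-off function. Harmonicity makes all mixed terms cancel and leaves the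
pointwise identity (`LocalKahler.wirt_wirtBar_second`) `∂_t ∂_t̄ |f_w̄|² = |φ_w̄|² |f_w|² - |φ|²
R(f_w, f̄_w, f_w̄, f̄_w̄)`. At a minimum the integral of the left side is nonnegative. The field
`∂/∂w` is holomorphic on the sphere, so one would like `φ = 1`; taking instead `φ = 1` on a disc of
radius `R` with `|φ_w̄| ≤ C/R`, the first term is at most `(C/R)²` times a finite energy and
disappears as `R → ∞`. The curvature term is nonnegative by orthogonality and positive where both
derivatives are nonzero, so at every point `f_w = 0` or `f_w̄ = 0` (`BarMinimizing.eq_zero_or`).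

Unique continuation: if `f_w̄` is nonzero somewhere, then `f_w` vanishes on an open set. The
harmonic map equation is a linear system `∂_w̄ f_w = A f_w` with smooth coefficients, and for such
systems a zero on an open set spreads over the whole plane (`eq_zero_of_wirtBar_eq`, a maximum
principle with a Gaussian weight). So one of the two derivatives vanishes on all of `ℂ`, and by
continuity in the coordinate `1/w` also at infinity. -/

namespace KahlerGeometry

open RiemannSphere Complex

/-! ### Wirtinger calculus in one variable -/

section Wirtinger

variable {E : Type*} [NormedAddCommGroup E] [NormedSpace ℂ E]

/-- The Wirtinger derivative `∂g/∂w` of a function of one complex variable. -/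
noncomputable def wirt (g : ℂ → E) (w : ℂ) : E :=
  (1 / 2 : ℂ) • (fderiv ℝ g w 1 - I • fderiv ℝ g w I)

/-- The Wirtinger derivative `∂g/∂w̄` of a function of one complex variable. -/
noncomputable def wirtBar (g : ℂ → E) (w : ℂ) : E :=
  (1 / 2 : ℂ) • (fderiv ℝ g w 1 + I • fderiv ℝ g w I)

/-- A real linear map out of `ℂ` is the sum of a complex linear and a conjugate linear one; the
Wirtinger derivatives are their coefficients. -/
theorem fderiv_apply_eq_wirt (g : ℂ → E) (w v : ℂ) :
    fderiv ℝ g w v = v • wirt g w + conj v • wirtBar g w := by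
  have hv : v = v.re • (1 : ℂ) + v.im • I := by
    simp [Complex.real_smul, Complex.re_add_im]
  conv_lhs => rw [hv]
  rw [map_add, map_smul, map_smul, wirt, wirtBar]
  have hI : I * I = -1 := Complex.I_mul_I
  rw [← Complex.coe_smul, ← Complex.coe_smul]
  have h1 : (v.re : ℂ) = (v + conj v) / 2 := by
    rw [Complex.add_conj]; push_cast; ring
  have h2 : (v.im : ℂ) = - I * (v - conj v) / 2 := by
    rw [Complex.sub_conj]; push_cast; linear_combination (v.im : ℂ) * hI
  rw [h1, h2]
  module

theorem wirt_congr {g g' : ℂ → E} {w : ℂ} (h : g =ᶠ[𝓝 w] g') : wirt g w = wirt g' w := by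
  rw [wirt, wirt, h.fderiv_eq]

theorem wirtBar_congr {g g' : ℂ → E} {w : ℂ} (h : g =ᶠ[𝓝 w] g') : wirtBar g w = wirtBar g' w := by
  rw [wirtBar, wirtBar, h.fderiv_eq]

theorem wirt_smul {φ : ℂ → ℂ} {g : ℂ → E} {w : ℂ} (hφ : DifferentiableAt ℝ φ w)
    (hg : DifferentiableAt ℝ g w) :
    wirt (fun w => φ w • g w) w = wirt φ w • g w + φ w • wirt g w := by
  simp only [wirt, fderiv_fun_smul hφ hg]
  simp
  module

theorem wirtBar_smul {φ : ℂ → ℂ} {g : ℂ → E} {w : ℂ} (hφ : DifferentiableAt ℝ φ w)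
    (hg : DifferentiableAt ℝ g w) :
    wirtBar (fun w => φ w • g w) w = wirtBar φ w • g w + φ w • wirtBar g w := by
  simp only [wirtBar, fderiv_fun_smul hφ hg]
  simp
  module

theorem wirt_add {g g' : ℂ → E} {w : ℂ} (hg : DifferentiableAt ℝ g w)
    (hg' : DifferentiableAt ℝ g' w) :
    wirt (fun w => g w + g' w) w = wirt g w + wirt g' w := by
  simp only [wirt, fderiv_fun_add hg hg']
  simp
  module

theorem contDiffAt_wirt {g : ℂ → E} {w : ℂ} (hg : ContDiffAt ℝ ∞ g w) :
    ContDiffAt ℝ ∞ (wirt g) w := by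
  have := hg.fderiv_right (m := ∞) (by simp)
  have h1 := this.clm_apply (contDiffAt_const (c := (1 : ℂ)))
  have h2 := this.clm_apply (contDiffAt_const (c := I))
  exact (h1.sub (h2.const_smul I)).const_smul _

theorem contDiffAt_wirtBar {g : ℂ → E} {w : ℂ} (hg : ContDiffAt ℝ ∞ g w) :
    ContDiffAt ℝ ∞ (wirtBar g) w := by
  have := hg.fderiv_right (m := ∞) (by simp)
  have h1 := this.clm_apply (contDiffAt_const (c := (1 : ℂ)))
  have h2 := this.clm_apply (contDiffAt_const (c := I))
  exact (h1.add (h2.const_smul I)).const_smul _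

theorem fderiv_apply_comm {V W : Type*} [NormedAddCommGroup V] [NormedSpace ℝ V]
    [NormedAddCommGroup W] [NormedSpace ℝ W] {g : V → W} {x : V}
    (hg : ContDiffAt ℝ ∞ g x) (a b : V) :
    fderiv ℝ (fun y => fderiv ℝ g y a) x b = fderiv ℝ (fun y => fderiv ℝ g y b) x a := by
  have h := (hg.fderiv_right (m := ∞) (by simp)).differentiableAt (by simp)
  rw [fderiv_clm_apply h (differentiableAt_const _), fderiv_clm_apply h (differentiableAt_const _)]
  have := hg.isSymmSndFDerivAt (by
    rw [minSmoothness_of_isRCLikeNormedField]; exact (WithTop.coe_le_coe.2 le_top : ((2 : ℕ∞) : WithTop ℕ∞) ≤ ∞))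
  simpa using this b a

theorem fderiv_wirt {g : ℂ → E} {w : ℂ} (hg : ContDiffAt ℝ ∞ g w) (v : ℂ) :
    fderiv ℝ (wirt g) w v = wirt (fun y => fderiv ℝ g y v) w := by
  have := hg.fderiv_right (m := ∞) (by simp)
  have h1 := (this.clm_apply (contDiffAt_const (c := (1 : ℂ)))).differentiableAt (by simp)
  have h2 := (this.clm_apply (contDiffAt_const (c := I))).differentiableAt (by simp)
  have h3 := congr($(((h1.hasFDerivAt.sub (h2.hasFDerivAt.const_smul I)).const_smul
    (1 / 2 : ℂ)).fderiv) v)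
  rw [wirt, ← fderiv_apply_comm hg 1 v, ← fderiv_apply_comm hg I v]
  exact h3

theorem fderiv_wirtBar {g : ℂ → E} {w : ℂ} (hg : ContDiffAt ℝ ∞ g w) (v : ℂ) :
    fderiv ℝ (wirtBar g) w v = wirtBar (fun y => fderiv ℝ g y v) w := by
  have := hg.fderiv_right (m := ∞) (by simp)
  have h1 := (this.clm_apply (contDiffAt_const (c := (1 : ℂ)))).differentiableAt (by simp)
  have h2 := (this.clm_apply (contDiffAt_const (c := I))).differentiableAt (by simp)
  have h3 := congr($(((h1.hasFDerivAt.add (h2.hasFDerivAt.const_smul I)).const_smul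
    (1 / 2 : ℂ)).fderiv) v)
  rw [wirtBar, ← fderiv_apply_comm hg 1 v, ← fderiv_apply_comm hg I v]
  exact h3

/-- Both sides are a quarter of the Laplacian, by symmetry of the second real derivative. -/
theorem wirtBar_wirt_comm {g : ℂ → E} {w : ℂ} (hg : ContDiffAt ℝ ∞ g w) :
    wirtBar (wirt g) w = wirt (wirtBar g) w := by
  have := hg.fderiv_right (m := ∞) (by simp)
  have h1 := (this.clm_apply (contDiffAt_const (c := (1 : ℂ)))).differentiableAt (by simp)
  have h2 := (this.clm_apply (contDiffAt_const (c := I))).differentiableAt (by simp)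
  rw [wirtBar, fderiv_wirt hg, fderiv_wirt hg, wirt, wirt, wirt, fderiv_wirtBar hg, fderiv_wirtBar hg,
    wirtBar, wirtBar]
  rw [fderiv_apply_comm hg I 1]
  module

end Wirtinger

/-! ### Local Hermitian forms -/

section LocalMetric

variable {n : ℕ}

theorem fderiv_eq_dz_add_dzbar (c : Cn n → ℂ) (z v : Cn n) :
    fderiv ℝ c z v = ∑ γ, (dz γ c z * v γ + dzbar γ c z * conj (v γ)) := by
  have hv : v = ∑ γ, ((v γ).re • (coordVec γ : Cn n) + (v γ).im • (I • (coordVec γ : Cn n))) := by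
    ext δ
    simp only [coordVec, WithLp.ofLp_sum, WithLp.ofLp_add, WithLp.ofLp_smul, Finset.sum_apply,
      Pi.add_apply, Pi.smul_apply, PiLp.ofLp_single]
    rw [Finset.sum_eq_single δ]
    · simp
    · intro b _ hb
      simp [hb.symm]
    · simp
  conv_lhs => rw [hv]
  rw [map_sum]
  refine Finset.sum_congr rfl fun γ _ => ?_
  rw [map_add, map_smul, map_smul, dz, dzbar]
  have hI : I * I = -1 := Complex.I_mul_I
  rw [← Complex.coe_smul, ← Complex.coe_smul]
  have h1 : ((v γ).re : ℂ) = (v γ + conj (v γ)) / 2 := by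
    rw [Complex.add_conj]; push_cast; ring
  have h2 : ((v γ).im : ℂ) = - I * (v γ - conj (v γ)) / 2 := by
    rw [Complex.sub_conj]; push_cast; linear_combination ((v γ).im : ℂ) * hI
  rw [h1, h2]
  simp only [smul_eq_mul]
  ring

variable (H : Fin n → Fin n → Cn n → ℂ)

/-- The Hermitian form `∑ H_{αβ̄}(z) u^α v̄^β`. -/
noncomputable def hf (z u v : Cn n) : ℂ := ∑ α, ∑ β, H α β z * u α * conj (v β)

/-- The form `∑ ∂_γ H_{αβ̄}(z) a^γ u^α v̄^β`. -/
noncomputable def hP (z a u v : Cn n) : ℂ :=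
  ∑ γ, ∑ α, ∑ β, dz γ (H α β) z * a γ * u α * conj (v β)

/-- The form `∑ ∂_γ̄ H_{αβ̄}(z) ā^γ u^α v̄^β`. -/
noncomputable def hQ (z a u v : Cn n) : ℂ :=
  ∑ γ, ∑ α, ∑ β, dzbar γ (H α β) z * conj (a γ) * u α * conj (v β)

variable {H}

theorem hf_add_left (z u u' v : Cn n) : hf H z (u + u') v = hf H z u v + hf H z u' v := by
  simp only [hf, ← Finset.sum_add_distrib, PiLp.add_apply]
  exact Finset.sum_congr rfl fun α _ => Finset.sum_congr rfl fun β _ => by ring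

theorem hf_add_right (z u v v' : Cn n) : hf H z u (v + v') = hf H z u v + hf H z u v' := by
  simp only [hf, ← Finset.sum_add_distrib, PiLp.add_apply, map_add]
  exact Finset.sum_congr rfl fun α _ => Finset.sum_congr rfl fun β _ => by ring

theorem hf_smul_left (z u v : Cn n) (c : ℂ) : hf H z (c • u) v = c * hf H z u v := by
  simp only [hf, Finset.mul_sum, PiLp.smul_apply, smul_eq_mul]
  exact Finset.sum_congr rfl fun α _ => Finset.sum_congr rfl fun β _ => by ring

theorem hf_smul_right (z u v : Cn n) (c : ℂ) : hf H z u (c • v) = conj c * hf H z u v := by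
  simp only [hf, Finset.mul_sum, PiLp.smul_apply, smul_eq_mul, map_mul]
  exact Finset.sum_congr rfl fun α _ => Finset.sum_congr rfl fun β _ => by ring

theorem hf_sub_left (z u u' v : Cn n) : hf H z (u - u') v = hf H z u v - hf H z u' v := by
  rw [sub_eq_add_neg, ← neg_one_smul ℂ, hf_add_left, hf_smul_left]; ring

theorem hf_sub_right (z u v v' : Cn n) : hf H z u (v - v') = hf H z u v - hf H z u v' := by
  rw [sub_eq_add_neg, ← neg_one_smul ℂ, hf_add_right, hf_smul_right]; simp; ring

theorem hP_add_fst (z a a' u v : Cn n) : hP H z (a + a') u v = hP H z a u v + hP H z a' u v := by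
  simp only [hP, ← Finset.sum_add_distrib, PiLp.add_apply]
  exact Finset.sum_congr rfl fun γ _ => Finset.sum_congr rfl fun α _ =>
    Finset.sum_congr rfl fun β _ => by ring

theorem hP_smul_fst (z a u v : Cn n) (c : ℂ) : hP H z (c • a) u v = c * hP H z a u v := by
  simp only [hP, Finset.mul_sum, PiLp.smul_apply, smul_eq_mul]
  exact Finset.sum_congr rfl fun γ _ => Finset.sum_congr rfl fun α _ =>
    Finset.sum_congr rfl fun β _ => by ring

theorem hP_sub_fst (z a a' u v : Cn n) : hP H z (a - a') u v = hP H z a u v - hP H z a' u v := by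
  rw [sub_eq_add_neg, ← neg_one_smul ℂ, hP_add_fst, hP_smul_fst]; ring

theorem hP_smul_right (z a u v : Cn n) (c : ℂ) : hP H z a u (c • v) = conj c * hP H z a u v := by
  simp only [hP, Finset.mul_sum, PiLp.smul_apply, smul_eq_mul, map_mul]
  exact Finset.sum_congr rfl fun γ _ => Finset.sum_congr rfl fun α _ =>
    Finset.sum_congr rfl fun β _ => by ring

theorem hP_add_right (z a u v v' : Cn n) : hP H z a u (v + v') = hP H z a u v + hP H z a u v' := by
  simp only [hP, ← Finset.sum_add_distrib, PiLp.add_apply, map_add]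
  exact Finset.sum_congr rfl fun γ _ => Finset.sum_congr rfl fun α _ =>
    Finset.sum_congr rfl fun β _ => by ring

theorem hQ_add_fst (z a a' u v : Cn n) : hQ H z (a + a') u v = hQ H z a u v + hQ H z a' u v := by
  simp only [hQ, ← Finset.sum_add_distrib, PiLp.add_apply, map_add]
  exact Finset.sum_congr rfl fun γ _ => Finset.sum_congr rfl fun α _ =>
    Finset.sum_congr rfl fun β _ => by ring

theorem hQ_smul_fst (z a u v : Cn n) (c : ℂ) : hQ H z (c • a) u v = conj c * hQ H z a u v := by
  simp only [hQ, Finset.mul_sum, PiLp.smul_apply, smul_eq_mul, map_mul]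
  exact Finset.sum_congr rfl fun γ _ => Finset.sum_congr rfl fun α _ =>
    Finset.sum_congr rfl fun β _ => by ring

theorem hQ_sub_fst (z a a' u v : Cn n) : hQ H z (a - a') u v = hQ H z a u v - hQ H z a' u v := by
  rw [sub_eq_add_neg, ← neg_one_smul ℂ, hQ_add_fst, hQ_smul_fst]; simp; ring

theorem hasDerivAt_comp_dz {c : Cn n → ℂ} {Z : ℝ → Cn n} {Z' : Cn n} {s : ℝ}
    (hc : DifferentiableAt ℝ c (Z s)) (hZ : HasDerivAt Z Z' s) :
    HasDerivAt (fun s => c (Z s))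
      (∑ γ, (dz γ c (Z s) * Z' γ + dzbar γ c (Z s) * conj (Z' γ))) s := by
  rw [← fderiv_eq_dz_add_dzbar]
  exact hc.hasFDerivAt.comp_hasDerivAt s hZ

theorem hasDerivAt_coord {u : ℝ → Cn n} {u' : Cn n} {s : ℝ} (hu : HasDerivAt u u' s) (α : Fin n) :
    HasDerivAt (fun s => u s α) (u' α) s :=
  ((EuclideanSpace.proj α : Cn n →L[ℂ] ℂ).restrictScalars ℝ).hasFDerivAt.comp_hasDerivAt s hu

theorem hasDerivAt_conj {u : ℝ → ℂ} {u' : ℂ} {s : ℝ} (hu : HasDerivAt u u' s) :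
    HasDerivAt (fun s => conj (u s)) (conj u') s :=
  (Complex.conjCLE : ℂ →L[ℝ] ℂ).hasFDerivAt.comp_hasDerivAt s hu

/-- The Leibniz rule for a Hermitian form along a curve. -/
theorem hasDerivAt_hf {Z u v : ℝ → Cn n} {Z' u' v' : Cn n} {s : ℝ}
    (hH : ∀ α β, DifferentiableAt ℝ (H α β) (Z s))
    (hZ : HasDerivAt Z Z' s) (hu : HasDerivAt u u' s) (hv : HasDerivAt v v' s) :
    HasDerivAt (fun s => hf H (Z s) (u s) (v s))
      (hP H (Z s) Z' (u s) (v s) + hQ H (Z s) Z' (u s) (v s) + hf H (Z s) u' (v s)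
        + hf H (Z s) (u s) v') s := by
  have key : HasDerivAt (fun s => ∑ α, ∑ β, H α β (Z s) * u s α * conj (v s β))
      (∑ α, ∑ β, (((∑ γ, (dz γ (H α β) (Z s) * Z' γ + dzbar γ (H α β) (Z s) * conj (Z' γ)))
        * u s α + H α β (Z s) * u' α) * conj (v s β) + H α β (Z s) * u s α * conj (v' β))) s := by
    refine HasDerivAt.fun_sum fun α _ => HasDerivAt.fun_sum fun β _ => ?_
    exact ((hasDerivAt_comp_dz (hH α β) hZ).mul (hasDerivAt_coord hu α)).mul
      (hasDerivAt_conj (hasDerivAt_coord hv β))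
  refine key.congr_deriv ?_
  have e1 : hP H (Z s) Z' (u s) (v s) = ∑ α, ∑ β, ∑ γ,
      dz γ (H α β) (Z s) * Z' γ * u s α * conj (v s β) := by
    rw [hP, Finset.sum_comm]
    refine Finset.sum_congr rfl fun α _ => ?_
    rw [Finset.sum_comm]
  have e2 : hQ H (Z s) Z' (u s) (v s) = ∑ α, ∑ β, ∑ γ,
      dzbar γ (H α β) (Z s) * conj (Z' γ) * u s α * conj (v s β) := by
    rw [hQ, Finset.sum_comm]
    refine Finset.sum_congr rfl fun α _ => ?_
    rw [Finset.sum_comm]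
  rw [e1, e2]
  simp only [hf, ← Finset.sum_add_distrib]
  refine Finset.sum_congr rfl fun α _ => Finset.sum_congr rfl fun β _ => ?_
  rw [add_mul, Finset.sum_mul, Finset.sum_mul]
  congr 2
  exact Finset.sum_congr rfl fun γ _ => by ring

variable {V : Type*} [NormedAddCommGroup V] [NormedSpace ℝ V]

theorem contDiffAt_coord {k : WithTop ℕ∞} {u : V → Cn n} {x : V} (hu : ContDiffAt ℝ k u x) (α : Fin n) :
    ContDiffAt ℝ k (fun x => u x α) x :=
  ((EuclideanSpace.proj α : Cn n →L[ℂ] ℂ).restrictScalars ℝ).contDiff.contDiffAt.comp x hu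

theorem contDiffAt_conj {k : WithTop ℕ∞} {u : V → ℂ} {x : V} (hu : ContDiffAt ℝ k u x) :
    ContDiffAt ℝ k (fun x => conj (u x)) x :=
  (Complex.conjCLE : ℂ →L[ℝ] ℂ).contDiff.contDiffAt.comp x hu

theorem contDiffAt_hf {Z u v : V → Cn n} {x : V} {k : WithTop ℕ∞}
    (hH : ∀ α β, ContDiffAt ℝ k (H α β) (Z x))
    (hZ : ContDiffAt ℝ k Z x) (hu : ContDiffAt ℝ k u x) (hv : ContDiffAt ℝ k v x) :
    ContDiffAt ℝ k (fun x => hf H (Z x) (u x) (v x)) x := by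
  unfold hf
  refine ContDiffAt.sum fun α _ => ContDiffAt.sum fun β _ => ?_
  exact (((hH α β).comp x hZ).mul (contDiffAt_coord hu α)).mul
    (contDiffAt_conj (contDiffAt_coord hv β))

theorem fderiv_hf {Z u v : V → Cn n} {x : V}
    (hH : ∀ α β, ContDiffAt ℝ 1 (H α β) (Z x))
    (hZ : ContDiffAt ℝ 1 Z x) (hu : ContDiffAt ℝ 1 u x) (hv : ContDiffAt ℝ 1 v x) (ξ : V) :
    fderiv ℝ (fun x => hf H (Z x) (u x) (v x)) x ξ =
      hP H (Z x) (fderiv ℝ Z x ξ) (u x) (v x) + hQ H (Z x) (fderiv ℝ Z x ξ) (u x) (v x)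
        + hf H (Z x) (fderiv ℝ u x ξ) (v x) + hf H (Z x) (u x) (fderiv ℝ v x ξ) := by
  -- Restricting to the line through `x` in direction `ξ` reduces to the Leibniz rule along a curve.
  have line : ∀ {W : Type} [NormedAddCommGroup W] [NormedSpace ℝ W] {g : V → W},
      ContDiffAt ℝ 1 g x → HasDerivAt (fun s : ℝ => g (x + s • ξ)) (fderiv ℝ g x ξ) 0 :=
    fun hg => (hg.differentiableAt (by simp)).hasFDerivAt.hasLineDerivAt ξ
  have h1 := line (contDiffAt_hf hH hZ hu hv)
  have h2 := hasDerivAt_hf (H := H) (Z := fun s : ℝ => Z (x + s • ξ))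
    (u := fun s : ℝ => u (x + s • ξ)) (v := fun s : ℝ => v (x + s • ξ)) (s := 0)
    (by simpa using fun α β => (hH α β).differentiableAt (by simp)) (line hZ) (line hu) (line hv)
  simpa using h1.unique h2

/-- In a conjugate linear slot `∂_w` becomes the conjugate of `∂_w̄`; this is why `wirtBar Z`
appears inside `hQ` and `wirtBar v` in the last term. -/
theorem wirt_hf {Z u v : ℂ → Cn n} {w : ℂ}
    (hH : ∀ α β, ContDiffAt ℝ 1 (H α β) (Z w))
    (hZ : ContDiffAt ℝ 1 Z w) (hu : ContDiffAt ℝ 1 u w) (hv : ContDiffAt ℝ 1 v w) :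
    wirt (fun w => hf H (Z w) (u w) (v w)) w =
      hP H (Z w) (wirt Z w) (u w) (v w) + hQ H (Z w) (wirtBar Z w) (u w) (v w)
        + hf H (Z w) (wirt u w) (v w) + hf H (Z w) (u w) (wirtBar v w) := by
  rw [wirt, fderiv_hf hH hZ hu hv, fderiv_hf hH hZ hu hv]
  simp only [wirt, wirtBar, hP_smul_fst, hP_sub_fst, hQ_smul_fst, hQ_add_fst, hf_smul_left,
    hf_sub_left, hf_smul_right, hf_add_right]
  simp [Complex.conj_ofNat]
  ring

theorem wirtBar_hf {Z u v : ℂ → Cn n} {w : ℂ}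
    (hH : ∀ α β, ContDiffAt ℝ 1 (H α β) (Z w))
    (hZ : ContDiffAt ℝ 1 Z w) (hu : ContDiffAt ℝ 1 u w) (hv : ContDiffAt ℝ 1 v w) :
    wirtBar (fun w => hf H (Z w) (u w) (v w)) w =
      hP H (Z w) (wirtBar Z w) (u w) (v w) + hQ H (Z w) (wirt Z w) (u w) (v w)
        + hf H (Z w) (wirtBar u w) (v w) + hf H (Z w) (u w) (wirt v w) := by
  rw [wirtBar, fderiv_hf hH hZ hu hv, fderiv_hf hH hZ hu hv]
  simp only [wirt, wirtBar, hP_smul_fst, hP_add_fst, hQ_smul_fst, hQ_sub_fst, hf_smul_left,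
    hf_add_left, hf_smul_right, hf_sub_right]
  simp [Complex.conj_ofNat]
  ring

variable (H) in
/-- The Hermitian matrix `H` of a Kähler metric on an open subset of `ℂⁿ`. -/
structure LocalKahler (Ω : Set (Cn n)) : Prop where
  isOpen : IsOpen Ω
  smooth : ∀ α β, ContDiffOn ℝ ∞ (H α β) Ω
  herm : ∀ z ∈ Ω, ∀ α β, conj (H α β z) = H β α z
  pos : ∀ z ∈ Ω, ∀ u, u ≠ 0 → 0 < (hf H z u u).re
  closed : ∀ z ∈ Ω, ∀ α β γ, dz γ (H α β) z = dz α (H γ β) z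

namespace LocalKahler

variable {Ω : Set (Cn n)} (hK : LocalKahler H Ω) {z : Cn n} (hz : z ∈ Ω)
include hK hz

theorem contDiffAt (α β : Fin n) : ContDiffAt ℝ ∞ (H α β) z :=
  (hK.smooth α β).contDiffAt (hK.isOpen.mem_nhds hz)

theorem contDiffAt_one (α β : Fin n) : ContDiffAt ℝ 1 (H α β) z :=
  (hK.contDiffAt hz α β).of_le (by simp)

theorem conj_hf (u v : Cn n) : conj (hf H z u v) = hf H z v u := by
  simp only [hf, map_sum, map_mul, conj_conj]
  rw [Finset.sum_comm]
  refine Finset.sum_congr rfl fun α _ => Finset.sum_congr rfl fun β _ => ?_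
  rw [hK.herm z hz]; ring

theorem conj_dz (γ α β : Fin n) : conj (dz γ (H α β) z) = dzbar γ (H β α) z := by
  have h : (H β α) =ᶠ[𝓝 z] fun y => conj (H α β y) := by
    filter_upwards [hK.isOpen.mem_nhds hz] with y hy
    rw [hK.herm y hy]
  have hd : HasFDerivAt (fun y => conj (H α β y))
      ((Complex.conjCLE : ℂ →L[ℝ] ℂ).comp (fderiv ℝ (H α β) z)) z :=
    (Complex.conjCLE : ℂ →L[ℝ] ℂ).hasFDerivAt.comp z
      ((hK.contDiffAt hz α β).differentiableAt (by simp)).hasFDerivAt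
  rw [dz, dzbar, h.fderiv_eq, hd.fderiv]
  simp [Complex.conj_ofNat]

theorem conj_hP (a u v : Cn n) : conj (hP H z a u v) = hQ H z a v u := by
  simp only [hP, hQ, map_sum, map_mul, conj_conj]
  refine Finset.sum_congr rfl fun γ _ => ?_
  rw [Finset.sum_comm]
  refine Finset.sum_congr rfl fun α _ => Finset.sum_congr rfl fun β _ => ?_
  rw [hK.conj_dz hz]; ring

/-- This symmetry of the lowered Christoffel symbols is the Kähler condition. All later arguments
use closedness of the fundamental form only through it and its conjugate `hQ_comm`. -/
theorem hP_comm (a u v : Cn n) : hP H z a u v = hP H z u a v := by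
  simp only [hP]
  rw [Finset.sum_comm]
  refine Finset.sum_congr rfl fun γ _ => Finset.sum_congr rfl fun α _ =>
    Finset.sum_congr rfl fun β _ => ?_
  rw [hK.closed z hz]; ring

theorem conj_hQ (a u v : Cn n) : conj (hQ H z a u v) = hP H z a v u := by
  rw [← hK.conj_hP hz, conj_conj]

theorem hQ_comm (a u v : Cn n) : hQ H z a u v = hQ H z v u a := by
  rw [← hK.conj_hP hz, hK.hP_comm hz, hK.conj_hP hz]

end LocalKahler

end LocalMetric

/-! ### Wirtinger calculus in two variables -/

section TwoVariables

variable {E : Type*} [NormedAddCommGroup E] [NormedSpace ℂ E]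

theorem fderiv_slice_right {W : Type*} [NormedAddCommGroup W] [NormedSpace ℝ W] {F : ℂ × ℂ → W}
    {t w : ℂ} (hF : DifferentiableAt ℝ F (t, w)) (v : ℂ) :
    fderiv ℝ (fun y => F (t, y)) w v = fderiv ℝ F (t, w) (0, v) := by
  have h := hF.hasFDerivAt.comp w (hasFDerivAt_prodMk_right (𝕜 := ℝ) t w)
  have h2 : HasFDerivAt (fun y => F (t, y)) _ w := h
  rw [h2.fderiv]; simp

theorem fderiv_slice_left {W : Type*} [NormedAddCommGroup W] [NormedSpace ℝ W] {F : ℂ × ℂ → W}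
    {t w : ℂ} (hF : DifferentiableAt ℝ F (t, w)) (v : ℂ) :
    fderiv ℝ (fun s => F (s, w)) t v = fderiv ℝ F (t, w) (v, 0) := by
  have h := hF.hasFDerivAt.comp t (hasFDerivAt_prodMk_left (𝕜 := ℝ) t w)
  have h2 : HasFDerivAt (fun s => F (s, w)) _ t := h
  rw [h2.fderiv]; simp

theorem contDiffAt_slice_right {W : Type*} [NormedAddCommGroup W] [NormedSpace ℝ W] {F : ℂ × ℂ → W}
    {t w : ℂ} {k : WithTop ℕ∞} (hF : ContDiffAt ℝ k F (t, w)) :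
    ContDiffAt ℝ k (fun y => F (t, y)) w :=
  hF.comp w (contDiff_prodMk_right t).contDiffAt

theorem contDiffAt_slice_left {W : Type*} [NormedAddCommGroup W] [NormedSpace ℝ W] {F : ℂ × ℂ → W}
    {t w : ℂ} {k : WithTop ℕ∞} (hF : ContDiffAt ℝ k F (t, w)) :
    ContDiffAt ℝ k (fun s => F (s, w)) t :=
  hF.comp t (contDiff_prodMk_left w).contDiffAt

/-- The Wirtinger derivative in the second variable. -/
noncomputable def sndWirt (F : ℂ × ℂ → E) (x : ℂ × ℂ) : E := wirt (fun y => F (x.1, y)) x.2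

/-- The conjugate Wirtinger derivative in the second variable. -/
noncomputable def sndWirtBar (F : ℂ × ℂ → E) (x : ℂ × ℂ) : E := wirtBar (fun y => F (x.1, y)) x.2

theorem sndWirt_eq {F : ℂ × ℂ → E} {x : ℂ × ℂ} (hF : DifferentiableAt ℝ F x) :
    sndWirt F x = (1 / 2 : ℂ) • (fderiv ℝ F x (0, 1) - I • fderiv ℝ F x (0, I)) := by
  obtain ⟨t, w⟩ := x
  rw [sndWirt, wirt, fderiv_slice_right hF, fderiv_slice_right hF]

theorem sndWirtBar_eq {F : ℂ × ℂ → E} {x : ℂ × ℂ} (hF : DifferentiableAt ℝ F x) :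
    sndWirtBar F x = (1 / 2 : ℂ) • (fderiv ℝ F x (0, 1) + I • fderiv ℝ F x (0, I)) := by
  obtain ⟨t, w⟩ := x
  rw [sndWirtBar, wirtBar, fderiv_slice_right hF, fderiv_slice_right hF]

theorem _root_.ContDiffAt.eventually_differentiableAt {V W : Type*} [NormedAddCommGroup V]
    [NormedSpace ℝ V] [NormedAddCommGroup W] [NormedSpace ℝ W] {F : V → W} {x : V}
    (hF : ContDiffAt ℝ ∞ F x) : ∀ᶠ y in 𝓝 x, DifferentiableAt ℝ F y := by
  filter_upwards [(hF.of_le (m := 1) (by simp)).eventually (by simp)] with y hy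
  exact hy.differentiableAt (by simp)

theorem _root_.ContDiffAt.contDiffAt_fderiv_apply {V W : Type*} [NormedAddCommGroup V]
    [NormedSpace ℝ V] [NormedAddCommGroup W] [NormedSpace ℝ W] {F : V → W} {x : V}
    (hF : ContDiffAt ℝ ∞ F x) (a : V) : ContDiffAt ℝ ∞ (fun y => fderiv ℝ F y a) x :=
  (hF.fderiv_right (m := ∞) (by simp)).clm_apply contDiffAt_const

/-- The slice derivative equals the expression in the total derivative wherever `F` is
differentiable. Equality on a neighbourhood is what allows a further differentiation in both
variables. -/
theorem sndWirt_eventuallyEq {F : ℂ × ℂ → E} {x : ℂ × ℂ} (hF : ContDiffAt ℝ ∞ F x) :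
    sndWirt F =ᶠ[𝓝 x]
      fun x => (1 / 2 : ℂ) • (fderiv ℝ F x (0, 1) - I • fderiv ℝ F x (0, I)) := by
  filter_upwards [hF.eventually_differentiableAt] with y hy using sndWirt_eq hy

theorem sndWirtBar_eventuallyEq {F : ℂ × ℂ → E} {x : ℂ × ℂ} (hF : ContDiffAt ℝ ∞ F x) :
    sndWirtBar F =ᶠ[𝓝 x]
      fun x => (1 / 2 : ℂ) • (fderiv ℝ F x (0, 1) + I • fderiv ℝ F x (0, I)) := by
  filter_upwards [hF.eventually_differentiableAt] with y hy using sndWirtBar_eq hy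

theorem contDiffAt_sndWirt {F : ℂ × ℂ → E} {x : ℂ × ℂ} (hF : ContDiffAt ℝ ∞ F x) :
    ContDiffAt ℝ ∞ (sndWirt F) x :=
  (((hF.contDiffAt_fderiv_apply (0, 1)).sub
    ((hF.contDiffAt_fderiv_apply (0, I)).const_smul I)).const_smul (1 / 2 : ℂ)).congr_of_eventuallyEq
      (sndWirt_eventuallyEq hF)

theorem contDiffAt_sndWirtBar {F : ℂ × ℂ → E} {x : ℂ × ℂ} (hF : ContDiffAt ℝ ∞ F x) :
    ContDiffAt ℝ ∞ (sndWirtBar F) x :=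
  (((hF.contDiffAt_fderiv_apply (0, 1)).add
    ((hF.contDiffAt_fderiv_apply (0, I)).const_smul I)).const_smul (1 / 2 : ℂ)).congr_of_eventuallyEq
      (sndWirtBar_eventuallyEq hF)

theorem fderiv_sndWirt {F : ℂ × ℂ → E} {t w : ℂ} (hF : ContDiffAt ℝ ∞ F (t, w)) (v : ℂ × ℂ) :
    fderiv ℝ (sndWirt F) (t, w) v = wirt (fun y => fderiv ℝ F (t, y) v) w := by
  have h1 := (hF.contDiffAt_fderiv_apply (0, 1)).differentiableAt (by simp)
  have h2 := (hF.contDiffAt_fderiv_apply (0, I)).differentiableAt (by simp)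
  have hv := (hF.contDiffAt_fderiv_apply v).differentiableAt (by simp)
  have h3 := congr($(((h1.hasFDerivAt.sub (h2.hasFDerivAt.const_smul I)).const_smul
    (1 / 2 : ℂ)).fderiv) v)
  rw [(sndWirt_eventuallyEq hF).fderiv_eq, wirt, fderiv_slice_right hv, fderiv_slice_right hv,
    ← fderiv_apply_comm hF (0, 1) v, ← fderiv_apply_comm hF (0, I) v]
  exact h3

theorem fderiv_sndWirtBar {F : ℂ × ℂ → E} {t w : ℂ} (hF : ContDiffAt ℝ ∞ F (t, w)) (v : ℂ × ℂ) :
    fderiv ℝ (sndWirtBar F) (t, w) v = wirtBar (fun y => fderiv ℝ F (t, y) v) w := by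
  have h1 := (hF.contDiffAt_fderiv_apply (0, 1)).differentiableAt (by simp)
  have h2 := (hF.contDiffAt_fderiv_apply (0, I)).differentiableAt (by simp)
  have hv := (hF.contDiffAt_fderiv_apply v).differentiableAt (by simp)
  have h3 := congr($(((h1.hasFDerivAt.add (h2.hasFDerivAt.const_smul I)).const_smul
    (1 / 2 : ℂ)).fderiv) v)
  rw [(sndWirtBar_eventuallyEq hF).fderiv_eq, wirtBar, fderiv_slice_right hv, fderiv_slice_right hv,
    ← fderiv_apply_comm hF (0, 1) v, ← fderiv_apply_comm hF (0, I) v]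
  exact h3

theorem wirt_fst_eventuallyEq {F : ℂ × ℂ → E} {t w : ℂ} (hF : ContDiffAt ℝ ∞ F (t, w)) :
    (fun y => wirt (fun s => F (s, y)) t) =ᶠ[𝓝 w]
      fun y => (1 / 2 : ℂ) • (fderiv ℝ F (t, y) (1, 0) - I • fderiv ℝ F (t, y) (I, 0)) := by
  have hc : Tendsto (fun y => (t, y)) (𝓝 w) (𝓝 (t, w)) :=
    (Continuous.prodMk_right t).tendsto w
  filter_upwards [hc.eventually hF.eventually_differentiableAt] with y hy
  rw [wirt, fderiv_slice_left hy, fderiv_slice_left hy]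

theorem wirtBar_fst_eventuallyEq {F : ℂ × ℂ → E} {t w : ℂ} (hF : ContDiffAt ℝ ∞ F (t, w)) :
    (fun y => wirtBar (fun s => F (s, y)) t) =ᶠ[𝓝 w]
      fun y => (1 / 2 : ℂ) • (fderiv ℝ F (t, y) (1, 0) + I • fderiv ℝ F (t, y) (I, 0)) := by
  have hc : Tendsto (fun y => (t, y)) (𝓝 w) (𝓝 (t, w)) :=
    (Continuous.prodMk_right t).tendsto w
  filter_upwards [hc.eventually hF.eventually_differentiableAt] with y hy
  rw [wirtBar, fderiv_slice_left hy, fderiv_slice_left hy]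

/-- Mixed Wirtinger derivatives commute. -/
theorem wirt_sndWirtBar {F : ℂ × ℂ → E} {t w : ℂ} (hF : ContDiffAt ℝ ∞ F (t, w)) :
    wirt (fun s => sndWirtBar F (s, w)) t = wirtBar (fun y => wirt (fun s => F (s, y)) t) w := by
  have h0 := (contDiffAt_sndWirtBar hF).differentiableAt (by simp)
  have h1 := (contDiffAt_slice_right (hF.contDiffAt_fderiv_apply (1, 0))).differentiableAt (by simp)
  have h2 := (contDiffAt_slice_right (hF.contDiffAt_fderiv_apply (I, 0))).differentiableAt (by simp)
  have h3 := ((h1.hasFDerivAt.sub (h2.hasFDerivAt.const_smul I)).const_smul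
    (1 / 2 : ℂ)).fderiv
  have h4 := fun v => congr($h3 v)
  rw [wirt, fderiv_slice_left h0, fderiv_slice_left h0, fderiv_sndWirtBar hF, fderiv_sndWirtBar hF,
    wirtBar_congr (wirt_fst_eventuallyEq hF), wirtBar, wirtBar, wirtBar]
  erw [h4, h4]
  simp
  module

theorem wirtBar_sndWirtBar {F : ℂ × ℂ → E} {t w : ℂ} (hF : ContDiffAt ℝ ∞ F (t, w)) :
    wirtBar (fun s => sndWirtBar F (s, w)) t =
      wirtBar (fun y => wirtBar (fun s => F (s, y)) t) w := by
  have h0 := (contDiffAt_sndWirtBar hF).differentiableAt (by simp)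
  have h1 := (contDiffAt_slice_right (hF.contDiffAt_fderiv_apply (1, 0))).differentiableAt (by simp)
  have h2 := (contDiffAt_slice_right (hF.contDiffAt_fderiv_apply (I, 0))).differentiableAt (by simp)
  have h3 := ((h1.hasFDerivAt.add (h2.hasFDerivAt.const_smul I)).const_smul
    (1 / 2 : ℂ)).fderiv
  have h4 := fun v => congr($h3 v)
  rw [wirtBar, fderiv_slice_left h0, fderiv_slice_left h0, fderiv_sndWirtBar hF, fderiv_sndWirtBar hF,
    wirtBar_congr (wirtBar_fst_eventuallyEq hF), wirtBar, wirtBar, wirtBar]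
  erw [h4, h4]
  simp
  module

/-- Translates between real second derivatives, whose sign is known at an extremum, and `∂∂̄`, in
which the geometric identities are computed. -/
theorem laplacian_eq_wirt_wirtBar {g : ℂ → E} {w : ℂ} (hg : ContDiffAt ℝ ∞ g w) :
    fderiv ℝ (fun y => fderiv ℝ g y 1) w 1 + fderiv ℝ (fun y => fderiv ℝ g y I) w I =
      (4 : ℂ) • wirt (wirtBar g) w := by
  have hI : I * I = -1 := Complex.I_mul_I
  rw [wirt, fderiv_wirtBar hg, fderiv_wirtBar hg, wirtBar, wirtBar, fderiv_apply_comm hg I 1]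
  simp only [smul_add, smul_sub, smul_smul]
  linear_combination (norm := module) hI • fderiv ℝ (fun y => fderiv ℝ g y I) w I

end TwoVariables

/-! ### Identities for maps into a Kähler chart -/

section Identities

variable {n : ℕ} {H : Fin n → Fin n → Cn n → ℂ} {Ω : Set (Cn n)}

theorem re_fderiv {V : Type*} [NormedAddCommGroup V] [NormedSpace ℝ V] {g : V → ℂ} {x : V}
    (hg : DifferentiableAt ℝ g x) (v : V) :
    fderiv ℝ (fun y => (g y).re) x v = (fderiv ℝ g x v).re := by
  have h : HasFDerivAt (fun y => (g y).re) (Complex.reCLM.comp (fderiv ℝ g x)) x :=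
    Complex.reCLM.hasFDerivAt.comp x hg.hasFDerivAt
  rw [h.fderiv]; rfl

/-- Algebraic core of the closedness of the pulled-back form: `a = f_w`, `b = f_w̄`, `σ` the
velocity, `m = f_{ww̄}`, `sw = σ_w`, `sb = σ_w̄`. On the right the terms in `m` cancel, and the two
mixed terms `hP b a σ`, `hP a b σ` cancel by symmetry; the rest matches after conjugation under the
real part. -/
theorem LocalKahler.re_closed (hK : LocalKahler H Ω) {z : Cn n} (hz : z ∈ Ω)
    (a b σ m sw sb : Cn n) :
    (hP H z σ a a + hQ H z σ a a + hf H z sw a + hf H z a sw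
      - (hP H z σ b b + hQ H z σ b b + hf H z sb b + hf H z b sb)).re =
    2 * (hP H z b a σ + hQ H z a a σ + hf H z m σ + hf H z a sw
      - (hP H z a b σ + hQ H z b b σ + hf H z m σ + hf H z b sb)).re := by
  have e1 := hK.hP_comm hz b a σ
  have e2 := hK.hQ_comm hz a a σ
  have e3 := hK.hQ_comm hz b b σ
  have e4 := congrArg Complex.re (hK.conj_hQ hz σ a a)
  have e5 := congrArg Complex.re (hK.conj_hQ hz σ b b)
  have e6 := congrArg Complex.re (hK.conj_hf hz a sw)
  have e7 := congrArg Complex.re (hK.conj_hf hz b sb)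
  rw [e1, e2, e3]
  simp only [Complex.conj_re] at e4 e5 e6 e7
  simp only [Complex.sub_re, Complex.add_re]
  linarith

theorem wirtBar_sndWirt_slice {E : Type*} [NormedAddCommGroup E] [NormedSpace ℂ E]
    {F : ℂ × ℂ → E} {t w : ℂ} (hF : ContDiffAt ℝ ∞ F (t, w)) :
    wirtBar (fun y => sndWirt F (t, y)) w = wirt (fun y => sndWirtBar F (t, y)) w :=
  wirtBar_wirt_comm (g := fun y => F (t, y)) (contDiffAt_slice_right hF)

/-- The pullback of the fundamental form is closed. -/
theorem LocalKahler.fderiv_hf_sub (hK : LocalKahler H Ω) {F : ℂ × ℂ → Cn n} {t w : ℂ}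
    (hF : ContDiffAt ℝ ∞ F (t, w)) (hz : F (t, w) ∈ Ω) (ξ : ℂ) :
    (fderiv ℝ (fun x => hf H (F x) (sndWirt F x) (sndWirt F x)) (t, w) (ξ, 0)
      - fderiv ℝ (fun x => hf H (F x) (sndWirtBar F x) (sndWirtBar F x)) (t, w) (ξ, 0)).re =
    2 * (wirtBar (fun y => hf H (F (t, y)) (sndWirt F (t, y)) (fderiv ℝ F (t, y) (ξ, 0))) w
      - wirt (fun y => hf H (F (t, y)) (sndWirtBar F (t, y)) (fderiv ℝ F (t, y) (ξ, 0))) w).re := by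
  have hH := hK.contDiffAt_one hz
  have one : ∀ {V W : Type} [NormedAddCommGroup V] [NormedSpace ℝ V] [NormedAddCommGroup W]
      [NormedSpace ℝ W] {g : V → W} {x : V}, ContDiffAt ℝ ∞ g x → ContDiffAt ℝ 1 g x :=
    fun hg => hg.of_le (by simp)
  have hW := contDiffAt_sndWirt hF
  have hWb := contDiffAt_sndWirtBar hF
  have hσ := hF.contDiffAt_fderiv_apply (ξ, 0)
  have d1 := fderiv_hf hH (one hF) (one hW) (one hW) (ξ, 0)
  have d2 := fderiv_hf hH (one hF) (one hWb) (one hWb) (ξ, 0)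
  have d3 := wirtBar_hf (Z := fun y => F (t, y)) hH (one (contDiffAt_slice_right hF))
    (one (contDiffAt_slice_right hW)) (one (contDiffAt_slice_right hσ))
  have d4 := wirt_hf (Z := fun y => F (t, y)) hH (one (contDiffAt_slice_right hF))
    (one (contDiffAt_slice_right hWb)) (one (contDiffAt_slice_right hσ))
  rw [fderiv_sndWirt hF] at d1
  rw [fderiv_sndWirtBar hF] at d2
  rw [wirtBar_sndWirt_slice hF] at d3
  rw [d1, d2, d3, d4]
  exact hK.re_closed hz _ _ _ _ _ _

/-- The first variation of `|∂f/∂w̄|²`. -/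
theorem LocalKahler.fderiv_hf_bar (hK : LocalKahler H Ω) {F : ℂ × ℂ → Cn n} {t w : ℂ}
    (hF : ContDiffAt ℝ ∞ F (t, w)) (hz : F (t, w) ∈ Ω) (ξ : ℂ) :
    (fderiv ℝ (fun x => hf H (F x) (sndWirtBar F x) (sndWirtBar F x)) (t, w) (ξ, 0)).re =
    2 * (wirt (fun y => hf H (F (t, y)) (sndWirtBar F (t, y)) (fderiv ℝ F (t, y) (ξ, 0))) w
      - (hf H (F (t, w)) (wirt (fun y => sndWirtBar F (t, y)) w) (fderiv ℝ F (t, w) (ξ, 0))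
        + hP H (F (t, w)) (sndWirt F (t, w)) (sndWirtBar F (t, w))
          (fderiv ℝ F (t, w) (ξ, 0)))).re := by
  have hH := hK.contDiffAt_one hz
  have one : ∀ {V W : Type} [NormedAddCommGroup V] [NormedSpace ℝ V] [NormedAddCommGroup W]
      [NormedSpace ℝ W] {g : V → W} {x : V}, ContDiffAt ℝ ∞ g x → ContDiffAt ℝ 1 g x :=
    fun hg => hg.of_le (by simp)
  have hWb := contDiffAt_sndWirtBar hF
  have hσ := hF.contDiffAt_fderiv_apply (ξ, 0)
  rw [fderiv_hf hH (one hF) (one hWb) (one hWb),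
    wirt_hf hH (one (contDiffAt_slice_right hF)) (one (contDiffAt_slice_right hWb))
      (one (contDiffAt_slice_right hσ)), fderiv_sndWirtBar hF]
  have hA : wirt (fun y => F (t, y)) w = sndWirt F (t, w) := rfl
  have hB : wirtBar (fun y => F (t, y)) w = sndWirtBar F (t, w) := rfl
  rw [hA, hB]
  generalize fderiv ℝ F (t, w) (ξ, 0) = σ
  generalize sndWirt F (t, w) = a
  generalize sndWirtBar F (t, w) = b
  generalize wirtBar (fun y => fderiv ℝ F (t, y) (ξ, 0)) w = sb
  have e3 := hK.hQ_comm hz b b σ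
  have e5 := congrArg Complex.re (hK.conj_hQ hz σ b b)
  have e7 := congrArg Complex.re (hK.conj_hf hz b sb)
  rw [e3]
  simp only [Complex.conj_re] at e5 e7
  simp only [Complex.sub_re, Complex.add_re]
  linarith

variable (H) in
/-- The lowered tension field of `Z`, as a conjugate linear functional. -/
noncomputable def tension (Z : ℂ → Cn n) (w : ℂ) (b : Cn n) : ℂ :=
  hf H (Z w) (wirt (wirtBar Z) w) b + hP H (Z w) (wirt Z w) (wirtBar Z w) b

/-- Metric compatibility gives `∂_w̄ ⟨f_w, f_w̄⟩ = ⟨D_w̄ f_w, f_w̄⟩ + ⟨f_w, D_w f_w̄⟩`. On a Kähler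
manifold `D_w̄ f_w = D_w f_w̄` is the tension, so both terms vanish for a harmonic map. -/
theorem LocalKahler.wirtBar_hopf (hK : LocalKahler H Ω) {Z : ℂ → Cn n} {w : ℂ}
    (hZ : ContDiffAt ℝ ∞ Z w) (hz : Z w ∈ Ω) (hE : ∀ b, tension H Z w b = 0) :
    wirtBar (fun y => hf H (Z y) (wirt Z y) (wirtBar Z y)) w = 0 := by
  have hH := hK.contDiffAt_one hz
  have h1 := contDiffAt_wirt hZ
  have h2 := contDiffAt_wirtBar hZ
  rw [wirtBar_hf hH (hZ.of_le (by simp)) (h1.of_le (by simp)) (h2.of_le (by simp)),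
    wirtBar_wirt_comm hZ]
  have e1 := hE (wirtBar Z w)
  have e2 := congrArg conj (hE (wirt Z w))
  rw [tension] at e1 e2
  rw [map_add, hK.conj_hf hz, hK.conj_hP hz, map_zero] at e2
  rw [hK.hP_comm hz (wirtBar Z w)]
  linear_combination e1 + e2

end Identities

/-! ### Curvature and the complex Hessian of the `∂̄`-energy density -/

section SecondVariation

variable {n : ℕ} {H : Fin n → Fin n → Cn n → ℂ} {Ω : Set (Cn n)}

variable (H) in
/-- The bisectional curvature of a Hermitian matrix valued function. -/
noncomputable def localBisectional (z : Cn n) (X Y : Fin n → ℂ) : ℂ :=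
  ∑ α, ∑ β, ∑ γ, ∑ δ, (- dz α (fun u => dzbar β (H γ δ) u) z
    + ∑ σ, ∑ τ, (Matrix.of fun α β => H α β z)⁻¹ τ σ * dz α (H γ τ) z * dzbar β (H σ δ) z)
      * X α * conj (X β) * Y γ * conj (Y δ)

theorem contDiffAt_dzbar {c : Cn n → ℂ} {z : Cn n} (hc : ContDiffAt ℝ ∞ c z) (β : Fin n) :
    ContDiffAt ℝ ∞ (dzbar β c) z := by
  have h1 := hc.contDiffAt_fderiv_apply (coordVec β)
  have h2 := hc.contDiffAt_fderiv_apply (I • coordVec β)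
  exact contDiffAt_const.mul (h1.add (contDiffAt_const.mul h2))

theorem contDiffAt_dz {c : Cn n → ℂ} {z : Cn n} (hc : ContDiffAt ℝ ∞ c z) (β : Fin n) :
    ContDiffAt ℝ ∞ (dz β c) z := by
  have h1 := hc.contDiffAt_fderiv_apply (coordVec β)
  have h2 := hc.contDiffAt_fderiv_apply (I • coordVec β)
  exact contDiffAt_const.mul (h1.sub (contDiffAt_const.mul h2))

/-- Isolating the index of the `∂̄`-derivative presents `hQ` as a combination of forms with matrices
`∂_δ̄ H`, to which the Leibniz rule applies once more; this is how second derivatives of the metric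
enter. -/
theorem hQ_eq_sum (z a u v : Cn n) :
    hQ H z a u v = ∑ δ, conj (a δ) * hf (fun α β => dzbar δ (H α β)) z u v := by
  simp only [hQ, hf, Finset.mul_sum]
  exact Finset.sum_congr rfl fun γ _ => Finset.sum_congr rfl fun α _ =>
    Finset.sum_congr rfl fun β _ => by ring

theorem hf_zero_left (z v : Cn n) : hf H z 0 v = 0 := by simp [hf]
theorem hf_zero_right (z u : Cn n) : hf H z u 0 = 0 := by simp [hf]
theorem hP_zero_fst (z u v : Cn n) : hP H z 0 u v = 0 := by simp [hP]
theorem hQ_zero_fst (z u v : Cn n) : hQ H z 0 u v = 0 := by simp [hQ]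

theorem wirt_sum {E : Type*} [NormedAddCommGroup E] [NormedSpace ℂ E] {ι : Type*} (s : Finset ι)
    {g : ι → ℂ → E} {w : ℂ} (hg : ∀ i ∈ s, DifferentiableAt ℝ (g i) w) :
    wirt (fun w => ∑ i ∈ s, g i w) w = ∑ i ∈ s, wirt (g i) w := by
  simp only [wirt, fderiv_fun_sum hg]
  simp [Finset.smul_sum, Finset.sum_sub_distrib, smul_sub]

theorem wirt_conj {g : ℂ → ℂ} {w : ℂ} (hg : DifferentiableAt ℝ g w) :
    wirt (fun w => conj (g w)) w = conj (wirtBar g w) := by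
  have hd : HasFDerivAt (fun y => conj (g y)) ((Complex.conjCLE : ℂ →L[ℝ] ℂ).comp (fderiv ℝ g w)) w :=
    (Complex.conjCLE : ℂ →L[ℝ] ℂ).hasFDerivAt.comp w hg.hasFDerivAt
  rw [wirt, wirtBar, hd.fderiv]
  simp [Complex.conj_ofNat, sub_eq_add_neg]

theorem wirtBar_coord {u : ℂ → Cn n} {w : ℂ} (hu : DifferentiableAt ℝ u w) (α : Fin n) :
    wirtBar (fun w => u w α) w = wirtBar u w α := by
  have hd : HasFDerivAt (fun y => u y α)
      (((EuclideanSpace.proj α : Cn n →L[ℂ] ℂ).restrictScalars ℝ).comp (fderiv ℝ u w)) w :=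
    ((EuclideanSpace.proj α : Cn n →L[ℂ] ℂ).restrictScalars ℝ).hasFDerivAt.comp w hu.hasFDerivAt
  rw [wirtBar, wirtBar, hd.fderiv]
  simp
  ring

/-- The complex Hessian of the squared length of a holomorphic vector field `u` along a
holomorphic curve `z`. -/
theorem LocalKahler.wirt_wirtBar_hf (hK : LocalKahler H Ω) {z u : ℂ → Cn n} {t : ℂ}
    (hz : ContDiffAt ℝ ∞ z t) (hu : ContDiffAt ℝ ∞ u t) (hΩ : z t ∈ Ω)
    (hz' : wirtBar z =ᶠ[𝓝 t] 0) (hu' : wirtBar u =ᶠ[𝓝 t] 0) :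
    wirt (wirtBar fun s => hf H (z s) (u s) (u s)) t =
      (∑ δ, conj (wirt z t δ) * hP (fun α β => dzbar δ (H α β)) (z t) (wirt z t) (u t) (u t))
        + hQ H (z t) (wirt z t) (wirt u t) (u t) + hP H (z t) (wirt z t) (u t) (wirt u t)
        + hf H (z t) (wirt u t) (wirt u t) := by
  have one : ∀ {V W : Type} [NormedAddCommGroup V] [NormedSpace ℝ V] [NormedAddCommGroup W]
      [NormedSpace ℝ W] {g : V → W} {x : V}, ContDiffAt ℝ ∞ g x → ContDiffAt ℝ 1 g x :=
    fun hg => hg.of_le (by simp)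
  have hH := fun α β => hK.contDiffAt hΩ α β
  have hzΩ : ∀ᶠ s in 𝓝 t, z s ∈ Ω := hz.continuousAt.eventually (hK.isOpen.mem_nhds hΩ)
  -- For holomorphic `z` and `u`, `∂̄` sees only the conjugated occurrences: `z̄` inside the metric
  -- and the second argument.
  have first : (wirtBar fun s => hf H (z s) (u s) (u s)) =ᶠ[𝓝 t] fun s =>
      (∑ δ, conj (wirt z s δ) * hf (fun α β => dzbar δ (H α β)) (z s) (u s) (u s))
        + hf H (z s) (u s) (wirt u s) := by
    filter_upwards [hzΩ, hz', hu', (one hz).eventually (by simp), (one hu).eventually (by simp)]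
      with s h1 h2 h3 h4 h5
    rw [wirtBar_hf (hK.contDiffAt_one h1) h4 h5 h5, h2, h3, hQ_eq_sum]
    simp [hP_zero_fst, hf_zero_left]
  have hVt : wirtBar (wirt z) t = 0 := by
    rw [wirtBar_wirt_comm hz, wirt_congr hz']; simp [wirt]
  have hUt : wirtBar (wirt u) t = 0 := by
    rw [wirtBar_wirt_comm hu, wirt_congr hu']; simp [wirt]
  have hV := contDiffAt_wirt hz
  have hU := contDiffAt_wirt hu
  have hHd : ∀ δ α β, ContDiffAt ℝ ∞ (dzbar δ (H α β)) (z t) := fun δ α β =>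
    contDiffAt_dzbar (hH α β) δ
  have hterm : ∀ δ, ContDiffAt ℝ ∞
      (fun s => hf (fun α β => dzbar δ (H α β)) (z s) (u s) (u s)) t :=
    fun δ => contDiffAt_hf (H := fun α β => dzbar δ (H α β)) (hHd δ) hz hu hu
  have hcV : ∀ δ, ContDiffAt ℝ ∞ (fun s => conj (wirt z s δ)) t := fun δ =>
    contDiffAt_conj (contDiffAt_coord hV δ)
  have hdiff : ∀ δ ∈ Finset.univ, DifferentiableAt ℝ (fun s => conj (wirt z s δ)
      * hf (fun α β => dzbar δ (H α β)) (z s) (u s) (u s)) t := fun δ _ =>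
    ((hcV δ).mul (hterm δ)).differentiableAt (by simp)
  rw [wirt_congr first, wirt_add (DifferentiableAt.fun_sum hdiff)
    ((contDiffAt_hf hH hz hu hU).differentiableAt (by simp)), wirt_sum _ hdiff,
    wirt_hf (fun α β => one (hH α β)) (one hz) (one hu) (one hU), hUt, hz'.eq_of_nhds]
  have hsum : ∀ δ, wirt (fun s => conj (wirt z s δ)
      * hf (fun α β => dzbar δ (H α β)) (z s) (u s) (u s)) t =
      conj (wirt z t δ) * hP (fun α β => dzbar δ (H α β)) (z t) (wirt z t) (u t) (u t)
      + conj (wirt z t δ) * hf (fun α β => dzbar δ (H α β)) (z t) (wirt u t) (u t) := by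
    intro δ
    have := wirt_smul ((hcV δ).differentiableAt (by simp)) ((hterm δ).differentiableAt (by simp))
    simp only [smul_eq_mul] at this
    rw [this, wirt_conj ((contDiffAt_coord hV δ).differentiableAt (by simp)),
      wirtBar_coord (hV.differentiableAt (by simp)), hVt,
      wirt_hf (H := fun α β => dzbar δ (H α β)) (fun α β => one (hHd δ α β)) (one hz) (one hu) (one hu),
      hz'.eq_of_nhds, hu'.eq_of_nhds]
    simp [hQ_zero_fst, hf_zero_right]
    ring
  rw [Finset.sum_congr rfl fun δ _ => hsum δ, Finset.sum_add_distrib, ← hQ_eq_sum]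
  simp [hQ_zero_fst, hf_zero_right]
  ring

/-- A vector killed by the matrix from the left would have length zero. Row vectors are the right
side here, since the first index of `H` carries the linear slot. -/
theorem LocalKahler.isUnit_matrix (hK : LocalKahler H Ω) {z : Cn n} (hz : z ∈ Ω) :
    IsUnit (Matrix.of fun α β => H α β z) := by
  rw [← Matrix.vecMul_injective_iff_isUnit]
  refine (injective_iff_map_eq_zero
    (Matrix.vecMulLinear (Matrix.of fun α β => H α β z))).2 fun x hx => ?_
  by_contra hne
  have h := hK.pos z hz (WithLp.toLp 2 x) (by simpa using hne)
  have h0 : hf H z (WithLp.toLp 2 x) (WithLp.toLp 2 x) = 0 := by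
    rw [hf, Finset.sum_comm]
    refine Finset.sum_eq_zero fun β _ => ?_
    rw [← Finset.sum_mul]
    have := congrFun hx β
    simp only [Matrix.vecMulLinear_apply, Matrix.vecMul, dotProduct, Matrix.of_apply,
      Pi.zero_apply] at this
    rw [Finset.sum_congr rfl fun α _ => mul_comm (H α β z) _]
    simp only
    rw [this, zero_mul]
  rw [h0] at h
  simp at h

theorem hP_coordVec (z a u : Cn n) (τ : Fin n) :
    hP H z a u (coordVec τ) = ∑ γ, ∑ α, dz γ (H α τ) z * a γ * u α := by
  simp only [hP]
  refine Finset.sum_congr rfl fun γ _ => Finset.sum_congr rfl fun α _ => ?_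
  rw [Finset.sum_eq_single τ]
  · simp [coordVec]
  · intro b _ hb
    simp [coordVec, hb]
  · simp

theorem hf_coordVec (z u : Cn n) (τ : Fin n) :
    hf H z u (coordVec τ) = ∑ α, H α τ z * u α := by
  simp only [hf]
  refine Finset.sum_congr rfl fun α _ => ?_
  rw [Finset.sum_eq_single τ]
  · simp [coordVec]
  · intro b _ hb
    simp [coordVec, hb]
  · simp

theorem hQ_coordVec (z a v : Cn n) (σ : Fin n) :
    hQ H z a (coordVec σ) v = ∑ γ, ∑ β, dzbar γ (H σ β) z * conj (a γ) * conj (v β) := by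
  simp only [hQ]
  refine Finset.sum_congr rfl fun γ _ => ?_
  rw [Finset.sum_eq_single σ]
  · simp [coordVec]
  · intro b _ hb
    simp [coordVec, hb]
  · simp

theorem sum_comm_four {ι κ : Type*} [Fintype ι] [Fintype κ] (G : κ → ι → ι → ι → ι → ℂ) :
    ∑ σ, ∑ α, ∑ β, ∑ γ, ∑ δ, G σ α β γ δ = ∑ α, ∑ β, ∑ γ, ∑ δ, ∑ σ, G σ α β γ δ := by
  rw [Finset.sum_comm]
  refine Finset.sum_congr rfl fun α _ => ?_
  rw [Finset.sum_comm]
  refine Finset.sum_congr rfl fun β _ => ?_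
  rw [Finset.sum_comm]
  refine Finset.sum_congr rfl fun γ _ => ?_
  rw [Finset.sum_comm]

theorem sum_mul_sum_four {ι : Type*} [Fintype ι] (p q : ι → ι → ℂ) :
    (∑ α, ∑ γ, p α γ) * (∑ β, ∑ δ, q β δ) = ∑ α, ∑ β, ∑ γ, ∑ δ, p α γ * q β δ := by
  rw [Finset.sum_mul]
  refine Finset.sum_congr rfl fun α _ => ?_
  rw [Finset.mul_sum]
  refine Finset.sum_congr rfl fun β _ => ?_
  rw [Finset.sum_mul_sum]

/-- The curvature in terms of the second derivatives of the metric and a vector `x` representing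
the first derivatives. -/
theorem LocalKahler.localBisectional_eq (hK : LocalKahler H Ω) {z : Cn n} (hz : z ∈ Ω)
    {V u x : Cn n} (hx : ∀ b, hf H z x b = - hP H z V u b) :
    localBisectional H z V u =
      - (∑ δ, conj (V δ) * hP (fun α β => dzbar δ (H α β)) z V u u) + hf H z x x := by
  set A : Matrix (Fin n) (Fin n) ℂ := Matrix.of fun α β => H α β z with hA
  have hdet : IsUnit A.det := (Matrix.isUnit_iff_isUnit_det A).1 (hK.isUnit_matrix hz)
  -- Contracting the coordinate formula with the vectors turns its quadratic part into the inverse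
  -- matrix applied to the functionals `hP V u ·` and `hQ V · u`.
  have hsplit : localBisectional H z V u =
      - (∑ δ, conj (V δ) * hP (fun α β => dzbar δ (H α β)) z V u u)
      + ∑ σ, ∑ τ, A⁻¹ τ σ * hP H z V u (coordVec τ) * hQ H z V (coordVec σ) u := by
    have e1 : (∑ δ, conj (V δ) * hP (fun α β => dzbar δ (H α β)) z V u u) =
        ∑ α, ∑ β, ∑ γ, ∑ δ, dz α (fun u => dzbar β (H γ δ) u) z * V α * conj (V β) * u γ
          * conj (u δ) := by
      rw [Finset.sum_comm]
      refine Finset.sum_congr rfl fun β _ => ?_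
      simp only [hP, Finset.mul_sum]
      exact Finset.sum_congr rfl fun α _ => Finset.sum_congr rfl fun γ _ =>
        Finset.sum_congr rfl fun δ _ => by ring
    have e2 : ∑ σ, ∑ τ, A⁻¹ τ σ * hP H z V u (coordVec τ) * hQ H z V (coordVec σ) u =
        ∑ α, ∑ β, ∑ γ, ∑ δ, (∑ σ, ∑ τ, A⁻¹ τ σ * dz α (H γ τ) z * dzbar β (H σ δ) z)
          * V α * conj (V β) * u γ * conj (u δ) := by
      have e3 : ∀ σ τ, A⁻¹ τ σ * hP H z V u (coordVec τ) * hQ H z V (coordVec σ) u =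
          ∑ α, ∑ β, ∑ γ, ∑ δ, A⁻¹ τ σ * dz α (H γ τ) z * dzbar β (H σ δ) z
          * V α * conj (V β) * u γ * conj (u δ) := by
        intro σ τ
        rw [hP_coordVec, hQ_coordVec, mul_assoc, sum_mul_sum_four]
        simp only [Finset.mul_sum]
        exact Finset.sum_congr rfl fun α _ => Finset.sum_congr rfl fun β _ =>
          Finset.sum_congr rfl fun γ _ => Finset.sum_congr rfl fun δ _ => by ring
      rw [Finset.sum_congr rfl fun σ _ => (Finset.sum_congr rfl fun τ _ => e3 σ τ).trans
        (sum_comm_four _), sum_comm_four]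
      exact Finset.sum_congr rfl fun α _ => Finset.sum_congr rfl fun β _ =>
        Finset.sum_congr rfl fun γ _ => Finset.sum_congr rfl fun δ _ => by simp only [Finset.sum_mul]
    rw [e1, e2, localBisectional, ← Finset.sum_neg_distrib, ← Finset.sum_add_distrib]
    refine Finset.sum_congr rfl fun α _ => ?_
    rw [← Finset.sum_neg_distrib, ← Finset.sum_add_distrib]
    refine Finset.sum_congr rfl fun β _ => ?_
    rw [← Finset.sum_neg_distrib, ← Finset.sum_add_distrib]
    refine Finset.sum_congr rfl fun γ _ => ?_
    rw [← Finset.sum_neg_distrib, ← Finset.sum_add_distrib]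
    refine Finset.sum_congr rfl fun δ _ => ?_
    ring
  rw [hsplit]
  congr 1
  -- The hypothesis on `x` says that the components of `hP V u ·` are those of `-xA`; multiplying by
  -- `A⁻¹` recovers `-x`, and the quadratic part becomes `hf x x`.
  have ha : ∀ τ, hP H z V u (coordVec τ) = - (Matrix.vecMul x A) τ := by
    intro τ
    have := hx (coordVec τ)
    rw [hf_coordVec] at this
    rw [← neg_eq_iff_eq_neg, ← this]
    simp only [Matrix.vecMul, dotProduct, hA, Matrix.of_apply]
    exact Finset.sum_congr rfl fun α _ => mul_comm _ _
  have hb : ∀ σ, hQ H z V (coordVec σ) u = - hf H z (coordVec σ) x := by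
    intro σ
    rw [← hK.conj_hP hz, ← hK.conj_hf hz, hx]; simp
  have hinv : ∀ σ, ∑ τ, A⁻¹ τ σ * hP H z V u (coordVec τ) = - x σ := by
    intro σ
    have h1 : Matrix.vecMul (Matrix.vecMul x A) A⁻¹ = x := by
      rw [Matrix.vecMul_vecMul, Matrix.mul_nonsing_inv _ hdet, Matrix.vecMul_one]
    have h2 := congrFun h1 σ
    rw [← h2]
    simp only [Matrix.vecMul, dotProduct]
    rw [← Finset.sum_neg_distrib]
    refine Finset.sum_congr rfl fun τ _ => ?_
    rw [ha]
    simp only [Matrix.vecMul, dotProduct]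
    ring
  have hxx : hf H z x x = ∑ σ, x σ * hf H z (coordVec σ) x := by
    simp only [hf, Finset.mul_sum]
    refine Finset.sum_congr rfl fun σ _ => ?_
    rw [Finset.sum_comm]
    refine Finset.sum_congr rfl fun β _ => ?_
    rw [Finset.sum_eq_single σ]
    · simp [coordVec]; ring
    · intro b _ hb
      simp [coordVec, hb]
    · simp
  rw [hxx]
  refine Finset.sum_congr rfl fun σ _ => ?_
  rw [← Finset.sum_mul, hinv, hb]
  ring

/-- The second variation of `|∂f/∂w̄|²` along a family which is holomorphic in the parameter and
whose initial velocity is a multiple of `∂f/∂w`. -/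
theorem LocalKahler.wirt_wirtBar_second (hK : LocalKahler H Ω) {F : ℂ × ℂ → Cn n} {w : ℂ} {φ : ℂ → ℂ}
    (h2 : ∀ᶠ x in 𝓝 ((0 : ℂ), w), ContDiffAt ℝ ∞ F x) (hΩ : F (0, w) ∈ Ω) (hφ : DifferentiableAt ℝ φ w)
    (hhol : ∀ᶠ x : ℂ × ℂ in 𝓝 (0, w), wirtBar (fun t => F (t, x.2)) x.1 = 0)
    (hvel : ∀ᶠ y in 𝓝 w, wirt (fun t => F (t, y)) 0 = φ y • wirt (fun y => F (0, y)) y)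
    (hE : ∀ b, tension H (fun y => F (0, y)) w b = 0) :
    wirt (wirtBar fun t => hf H (F (t, w)) (sndWirtBar F (t, w)) (sndWirtBar F (t, w))) 0 =
      wirtBar φ w * conj (wirtBar φ w) * hf H (F (0, w)) (sndWirt F (0, w)) (sndWirt F (0, w))
      - φ w * conj (φ w) * localBisectional H (F (0, w)) (sndWirt F (0, w) : Cn n)
          (sndWirtBar F (0, w) : Cn n) := by
  have hF := h2.self_of_nhds
  have hz := contDiffAt_slice_left hF
  have hu := contDiffAt_slice_left (contDiffAt_sndWirtBar hF)
  have hc1 : Tendsto (fun t : ℂ => (t, w)) (𝓝 0) (𝓝 (0, w)) := (Continuous.prodMk_left w).tendsto 0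
  have hz' : wirtBar (fun t => F (t, w)) =ᶠ[𝓝 0] 0 := hc1.eventually hhol
  -- `∂_t̄` commutes with `∂_w̄`, so `∂F/∂w̄` is again holomorphic in `t`.
  have hu' : wirtBar (fun t => sndWirtBar F (t, w)) =ᶠ[𝓝 0] 0 := by
    filter_upwards [hc1.eventually h2, hc1.eventually hhol.eventually_nhds] with t ht1 ht2
    have hc2 : Tendsto (fun y : ℂ => (t, y)) (𝓝 w) (𝓝 (t, w)) := (Continuous.prodMk_right t).tendsto w
    rw [wirtBar_sndWirtBar ht1]
    have h3 : (fun y => wirtBar (fun s => F (s, y)) t) =ᶠ[𝓝 w] fun _ => 0 := hc2.eventually ht2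
    rw [wirtBar_congr h3]
    simp [wirtBar]
  have hZ := contDiffAt_slice_right hF
  -- `∂_t f_w̄ = ∂_w̄ (φ f_w)`, expanded by the product rule.
  have hut : wirt (fun t => sndWirtBar F (t, w)) 0 =
      wirtBar φ w • sndWirt F (0, w) + φ w • wirt (fun y => sndWirtBar F (0, y)) w := by
    rw [wirt_sndWirtBar hF, wirtBar_congr hvel,
      wirtBar_smul hφ ((contDiffAt_wirt hZ).differentiableAt (by simp)), wirtBar_wirt_comm hZ]
    rfl
  have hV : wirt (fun t => F (t, w)) 0 = φ w • sndWirt F (0, w) := hvel.self_of_nhds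
  rw [hK.wirt_wirtBar_hf hz hu hΩ hz' hu', hut, hV]
  -- Harmonicity says that the vector `f_{ww̄}` represents minus the Christoffel term of `f_w` and
  -- `f_w̄`; it is thus the vector `x` required by the curvature formula.
  have hE' : ∀ b, hf H (F (0, w)) (wirt (fun y => sndWirtBar F (0, y)) w) b =
      - hP H (F (0, w)) (sndWirt F (0, w)) (sndWirtBar F (0, w)) b := fun b =>
    eq_neg_of_add_eq_zero_left (hE b)
  rw [hK.localBisectional_eq hΩ hE']
  generalize wirt (fun y => sndWirtBar F (0, y)) w = x at *
  generalize sndWirt F (0, w) = a at *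
  generalize sndWirtBar F (0, w) = b at *
  generalize F (0, w) = z at *
  generalize wirtBar φ w = c
  generalize φ w = p
  -- With `e1` and `e2` every first derivative of the metric is expressed through `x`. The mixed
  -- terms in `a` and `x` then cancel, and what remains of `hf x x` completes the second derivatives
  -- of the metric to the curvature.
  have e1 : ∀ v, hP H z a b v = - hf H z x v := fun v => by rw [hE' v, neg_neg]
  have e2 : ∀ v, hQ H z a v b = - hf H z v x := fun v => by
    rw [← hK.conj_hP hΩ, e1, map_neg, hK.conj_hf hΩ]
  have e3 : ∀ δ, hP (fun α β => dzbar δ (H α β)) z (p • a) b b =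
      p * hP (fun α β => dzbar δ (H α β)) z a b b := fun δ => hP_smul_fst _ _ _ _ _
  simp only [e3, hP_smul_fst, hQ_smul_fst, hf_add_left, hf_smul_left, hf_add_right,
    hf_smul_right, hP_add_right, hP_smul_right, e1, e2, PiLp.smul_apply, smul_eq_mul, map_mul]
  have e4 : ∑ δ, conj p * conj (a δ) * (p * hP (fun α β => dzbar δ (H α β)) z a b b) =
      p * conj p * ∑ δ, conj (a δ) * hP (fun α β => dzbar δ (H α β)) z a b b := by
    rw [Finset.mul_sum]
    exact Finset.sum_congr rfl fun δ _ => by ring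
  rw [e4]
  ring

end SecondVariation

/-! ### Maximum principle and unique continuation -/

section UniqueContinuation

/-- A negative second derivative would make the point a local maximum too, so the function would be
locally constant and its second derivative zero. -/
theorem deriv_deriv_nonneg_of_isLocalMin {f : ℝ → ℝ} {x : ℝ} (h : IsLocalMin f x)
    (hc : ContinuousAt f x) : 0 ≤ deriv (deriv f) x := by
  by_contra! hneg
  have hmax := isLocalMax_of_deriv_deriv_neg hneg h.deriv_eq_zero hc
  have hconst : f =ᶠ[𝓝 x] fun _ => f x := by
    filter_upwards [h, hmax] with y h1 h2 using le_antisymm h2 h1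
  have : deriv f =ᶠ[𝓝 x] fun _ => 0 := by
    filter_upwards [hconst.eventuallyEq_nhds] with y hy
    rw [hy.deriv_eq]; simp
  rw [this.deriv_eq] at hneg
  simp at hneg

theorem deriv_deriv_line {V : Type*} [NormedAddCommGroup V] [NormedSpace ℝ V] {g : V → ℝ} {x : V}
    (hg : ContDiffAt ℝ ∞ g x) (v : V) :
    deriv (deriv fun s : ℝ => g (x + s • v)) 0 = fderiv ℝ (fun y => fderiv ℝ g y v) x v := by
  have hc : Tendsto (fun s : ℝ => x + s • v) (𝓝 0) (𝓝 x) := by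
    have : Continuous fun s : ℝ => x + s • v := by fun_prop
    simpa using this.tendsto 0
  have hd : deriv (fun s : ℝ => g (x + s • v)) =ᶠ[𝓝 0] fun s => fderiv ℝ g (x + s • v) v := by
    filter_upwards [hc.eventually hg.eventually_differentiableAt] with s hs
    have h2 : HasDerivAt (fun r : ℝ => x + r • v) v s := by
      simpa using ((hasDerivAt_id s).smul_const v).const_add x
    exact (hs.hasFDerivAt.comp_hasDerivAt s h2).deriv
  rw [hd.deriv_eq]
  exact (((hg.contDiffAt_fderiv_apply v).differentiableAt
    (by simp)).hasFDerivAt.hasLineDerivAt v).deriv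

theorem fderiv_fderiv_nonpos_of_isLocalMax {V : Type*} [NormedAddCommGroup V] [NormedSpace ℝ V]
    {g : V → ℝ} {x : V} (hg : ContDiffAt ℝ ∞ g x) (h : IsLocalMax g x) (v : V) :
    fderiv ℝ (fun y => fderiv ℝ g y v) x v ≤ 0 := by
  have hc : Tendsto (fun s : ℝ => x + s • v) (𝓝 0) (𝓝 x) := by
    have : Continuous fun s : ℝ => x + s • v := by fun_prop
    simpa using this.tendsto 0
  have hmin : IsLocalMin (fun s : ℝ => -g (x + s • v)) 0 := by
    filter_upwards [hc.eventually h] with s hs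
    simpa using hs
  have hcont : ContinuousAt (fun s : ℝ => -g (x + s • v)) 0 := by
    have : ContinuousAt g (x + (0 : ℝ) • v) := by simpa using hg.continuousAt
    exact (ContinuousAt.comp (f := fun s : ℝ => x + s • v) this (by fun_prop)).neg
  have h1 := deriv_deriv_nonneg_of_isLocalMin hmin hcont
  have h2 := deriv_deriv_line hg.neg v
  have h3 : fderiv ℝ (fun y => fderiv ℝ (fun z => -g z) y v) x v =
      - fderiv ℝ (fun y => fderiv ℝ g y v) x v := by
    simp only [fderiv_fun_neg, neg_apply]
  change deriv (deriv fun s : ℝ => -g (x + s • v)) 0 = fderiv ℝ (fun y => fderiv ℝ (fun z => -g z) y v) x v at h2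
  linarith

theorem fderiv_ofReal {V : Type*} [NormedAddCommGroup V] [NormedSpace ℝ V] {g : V → ℝ} {x : V}
    (hg : DifferentiableAt ℝ g x) (a : V) :
    fderiv ℝ (fun y => (g y : ℂ)) x a = (fderiv ℝ g x a : ℝ) := by
  have h : HasFDerivAt (fun y => (g y : ℂ)) (Complex.ofRealCLM.comp (fderiv ℝ g x)) x :=
    Complex.ofRealCLM.hasFDerivAt.comp x hg.hasFDerivAt
  rw [h.fderiv]; rfl

variable {E : Type*} [NormedAddCommGroup E] [InnerProductSpace ℂ E]

theorem wirt_inner {u v : ℂ → E} {w : ℂ} (hu : DifferentiableAt ℝ u w)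
    (hv : DifferentiableAt ℝ v w) :
    wirt (fun w => (inner ℂ (v w) (u w))) w = (inner ℂ (v w) (wirt u w)) + (inner ℂ (wirtBar v w) (u w)) := by
  simp only [wirt, wirtBar, fderiv_inner_apply ℂ hv hu, inner_smul_left, inner_smul_right,
    inner_add_left, inner_sub_right, smul_eq_mul]
  simp [Complex.conj_ofNat]
  ring

theorem wirtBar_inner {u v : ℂ → E} {w : ℂ} (hu : DifferentiableAt ℝ u w)
    (hv : DifferentiableAt ℝ v w) :
    wirtBar (fun w => (inner ℂ (v w) (u w))) w = (inner ℂ (v w) (wirtBar u w)) + (inner ℂ (wirt v w) (u w)) := by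
  simp only [wirt, wirtBar, fderiv_inner_apply ℂ hv hu, inner_smul_left, inner_smul_right,
    inner_sub_left, inner_add_right, smul_eq_mul]
  simp [Complex.conj_ofNat]
  ring

/-- The weight `exp(τ |w - q|²)`. -/
noncomputable def gaussWeight (τ : ℝ) (q w : ℂ) : ℂ := cexp (τ * ((w - q) * conj (w - q)))

theorem contDiff_gaussWeight (τ : ℝ) (q : ℂ) : ContDiff ℝ ∞ (gaussWeight τ q) := by
  have h : ContDiff ℝ ∞ fun w : ℂ => conj (w - q) :=
    (Complex.conjCLE : ℂ →L[ℝ] ℂ).contDiff.comp (contDiff_id.sub contDiff_const)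
  exact Complex.contDiff_exp.comp (contDiff_const.mul ((contDiff_id.sub contDiff_const).mul h))

theorem gaussWeight_eq (τ : ℝ) (q w : ℂ) :
    gaussWeight τ q w = (Real.exp (τ * ‖w - q‖ ^ 2) : ℝ) := by
  rw [gaussWeight, Complex.mul_conj, Complex.normSq_eq_norm_sq]; push_cast; rfl

theorem fderiv_gaussWeight (τ : ℝ) (q w v : ℂ) :
    fderiv ℝ (gaussWeight τ q) w v =
      τ * (v * conj (w - q) + (w - q) * conj v) * gaussWeight τ q w := by
  have h1 : HasDerivAt (fun s : ℝ => w + s • v - q) v 0 := by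
    simpa using (((hasDerivAt_id (0 : ℝ)).smul_const v).const_add w).sub_const q
  have h2 := ((h1.mul (hasDerivAt_conj h1)).const_mul (τ : ℂ)).cexp
  have h3 := ((contDiff_gaussWeight τ q).contDiffAt.differentiableAt (x := w)
    (by simp)).hasFDerivAt.hasLineDerivAt v
  have := HasDerivAt.unique h3 h2
  rw [this]
  simp [gaussWeight]
  ring

theorem wirt_gaussWeight (τ : ℝ) (q w : ℂ) :
    wirt (gaussWeight τ q) w = τ * conj (w - q) * gaussWeight τ q w := by
  rw [wirt, fderiv_gaussWeight, fderiv_gaussWeight]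
  simp
  linear_combination (-(1 / 2) * τ * (conj w - conj q - (w - q)) * gaussWeight τ q w) * Complex.I_mul_I

theorem wirtBar_gaussWeight (τ : ℝ) (q w : ℂ) :
    wirtBar (gaussWeight τ q) w = τ * (w - q) * gaussWeight τ q w := by
  rw [wirtBar, fderiv_gaussWeight, fderiv_gaussWeight]
  simp
  linear_combination ((1 / 2) * τ * (conj w - conj q - (w - q)) * gaussWeight τ q w) * Complex.I_mul_I

theorem wirt_clm_apply {E F : Type*} [NormedAddCommGroup E] [NormedSpace ℂ E] [NormedAddCommGroup F]
    [NormedSpace ℂ F] {A : ℂ → E →L[ℂ] F} {u : ℂ → E} {w : ℂ}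
    (hA : DifferentiableAt ℝ A w) (hu : DifferentiableAt ℝ u w) :
    wirt (fun w => A w (u w)) w = wirt A w (u w) + A w (wirt u w) := by
  have hd : ∀ v, fderiv ℝ (fun w => A w (u w)) w v = fderiv ℝ A w v (u w) + A w (fderiv ℝ u w v) := by
    intro v
    -- The product rule is applied over `ℝ`, after forgetting that the operators `A w` are complex
    -- linear.
    let r : (E →L[ℂ] F) →L[ℝ] (E →L[ℝ] F) := ContinuousLinearMap.restrictScalarsL ℂ E F ℝ ℝ
    have h1 : HasFDerivAt (fun w => r (A w)) (r.comp (fderiv ℝ A w)) w :=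
      r.hasFDerivAt.comp w hA.hasFDerivAt
    have h2 := (h1.clm_apply hu.hasFDerivAt).fderiv
    have h3 := congr($h2 v)
    rw [show (fun w => A w (u w)) = fun w => r (A w) (u w) from rfl, h3]
    simp [r, add_comm]
  simp only [wirt, hd]
  simp
  module

/-- A weighted Bochner formula: solutions of `∂v/∂w̄ = A v` have strictly subharmonic weighted
length where they do not vanish. -/
theorem re_wirt_wirtBar_weighted_pos {v : ℂ → E} {A : ℂ → E →L[ℂ] E} {w q : ℂ} {C τ : ℝ}
    (hτ : 2 * C + C ^ 2 < τ)
    (hv : ContDiffAt ℝ ∞ v w) (hA : DifferentiableAt ℝ A w)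
    (hAC : ‖A w‖ ≤ C) (hAC' : ‖wirt A w‖ ≤ C) (heq : wirtBar v =ᶠ[𝓝 w] fun y => A y (v y))
    (hne : v w ≠ 0) :
    0 < (wirt (wirtBar fun y => (inner ℂ (v y) (v y)) * gaussWeight τ q y) w).re := by
  have hvd := hv.eventually_differentiableAt
  have hvd0 := hvd.self_of_nhds
  have hW : ∀ y, DifferentiableAt ℝ (gaussWeight τ q) y := fun y =>
    (contDiff_gaussWeight τ q).contDiffAt.differentiableAt (by simp)
  have first : (wirtBar fun y => (inner ℂ (v y) (v y)) * gaussWeight τ q y) =ᶠ[𝓝 w] fun y =>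
      ((inner ℂ (v y) (wirtBar v y)) + (inner ℂ (wirt v y) (v y)) + (inner ℂ (v y) (v y)) * (τ * (y - q))) * gaussWeight τ q y := by
    filter_upwards [hvd] with y hy
    have := wirtBar_smul (hy.inner ℂ hy) (hW y)
    simp only [smul_eq_mul] at this
    rw [this, wirtBar_inner hy hy, wirtBar_gaussWeight]
    ring
  have hvw := contDiffAt_wirt hv
  have hvb := contDiffAt_wirtBar hv
  have d1 : DifferentiableAt ℝ (wirt v) w := hvw.differentiableAt (by simp)
  have d2 : DifferentiableAt ℝ (wirtBar v) w := hvb.differentiableAt (by simp)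
  have d3 : DifferentiableAt ℝ (fun y : ℂ => (τ : ℂ) * (y - q)) w := by fun_prop
  have d4 : DifferentiableAt ℝ (fun y => (inner ℂ (v y) (wirtBar v y))) w := hvd0.inner ℂ d2
  have d5 : DifferentiableAt ℝ (fun y => (inner ℂ (wirt v y) (v y))) w := d1.inner ℂ hvd0
  have d6 : DifferentiableAt ℝ (fun y => (inner ℂ (v y) (v y))) w := hvd0.inner ℂ hvd0
  have hlin : wirt (fun y : ℂ => (τ : ℂ) * (y - q)) w = τ := by
    have h : ∀ x : ℂ, fderiv ℝ (fun y : ℂ => (τ : ℂ) * (y - q)) w x = τ * x := by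
      intro x
      have : HasFDerivAt (fun y : ℂ => (τ : ℂ) * (y - q)) ((τ : ℂ) • ContinuousLinearMap.id ℝ ℂ) w :=
        ((hasFDerivAt_id w).sub_const q).const_mul (τ : ℂ)
      rw [this.fderiv]; simp
    rw [wirt, h, h]
    simp
    linear_combination (-(1 / 2) * τ : ℂ) * Complex.I_mul_I
  have hsw : wirtBar (wirt v) w = wirt (wirtBar v) w := wirtBar_wirt_comm hv
  have hswE : wirt (wirtBar v) w = wirt A w (v w) + A w (wirt v w) := by
    rw [wirt_congr heq, wirt_clm_apply hA hvd0]
  have m1 := wirt_smul ((d4.add d5).add (d6.mul d3)) (hW w)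
  have m2 := wirt_smul d6 d3
  simp only [smul_eq_mul] at m1 m2
  rw [wirt_congr first]
  have m3 : wirt (fun y => ((inner ℂ (v y) (wirtBar v y)) + (inner ℂ (wirt v y) (v y)) + (inner ℂ (v y) (v y)) * (τ * (y - q)))
      * gaussWeight τ q y) w = _ := m1
  rw [m3]
  have m4 : wirt ((fun y => (inner ℂ (v y) (wirtBar v y))) + (fun y => (inner ℂ (wirt v y) (v y)))
      + (fun y => (inner ℂ (v y) (v y))) * (fun y => (τ : ℂ) * (y - q))) w =
      ((inner ℂ (v w) (wirt (wirtBar v) w)) + (inner ℂ (wirtBar v w) (wirtBar v w))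
        + ((inner ℂ (wirt v w) (wirt v w)) + (inner ℂ (wirtBar (wirt v) w) (v w))))
        + (((inner ℂ (v w) (wirt v w)) + (inner ℂ (wirtBar v w) (v w))) * (τ * (w - q)) + (inner ℂ (v w) (v w)) * τ) := by
    have e1 := wirt_add (d4.add d5) (d6.mul d3)
    have e2 := wirt_add d4 d5
    rw [← wirt_inner d2 hvd0, ← wirt_inner hvd0 d1, ← wirt_inner hvd0 hvd0]
    rw [hlin] at m2
    rw [← m2, ← e2]
    exact e1
  rw [m4, wirt_gaussWeight, hsw, hswE, heq.self_of_nhds]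
  set a : ℂ := τ * conj (w - q) with ha
  have hca : (τ : ℂ) * (w - q) = conj a := by simp [ha]
  set x := v w
  set y := wirt v w
  set B := A w
  set B' := wirt A w
  set W := gaussWeight τ q w
  -- Completing the square: `a x` is the contribution of the gradient of the weight, and `y + a x`
  -- is the derivative of `v` twisted by it. The unbounded factor `a` then occurs only inside `y + a
  -- x`, and the second derivative of the weight leaves the good term `τ |x|²`.
  have expand : ((inner ℂ (x) (B' x + B y)) + (inner ℂ (B x) (B x)) + ((inner ℂ (y) (y)) + (inner ℂ (B' x + B y) (x)))
        + (((inner ℂ (x) (y)) + (inner ℂ (B x) (x))) * (τ * (w - q)) + (inner ℂ (x) (x)) * τ)) * W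
      + ((inner ℂ (x) (B x)) + (inner ℂ (y) (x)) + (inner ℂ (x) (x)) * (τ * (w - q))) * (τ * conj (w - q) * W) =
      ((inner ℂ (y + a • x) (y + a • x)) + (inner ℂ (B x) (B x)) + ((inner ℂ (x) (B' x)) + (inner ℂ (B' x) (x)))
        + ((inner ℂ (x) (B (y + a • x))) + (inner ℂ (B (y + a • x)) (x))) + τ * (inner ℂ (x) (x))) * W := by
    simp only [hca, ← ha, inner_add_left, inner_add_right, inner_smul_left, inner_smul_right, map_add,
      map_smul]
    ring
  change 0 < (((inner ℂ (x) (B' x + B y)) + (inner ℂ (B x) (B x)) + ((inner ℂ (y) (y)) + (inner ℂ (B' x + B y) (x)))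
        + (((inner ℂ (x) (y)) + (inner ℂ (B x) (x))) * (τ * (w - q)) + (inner ℂ (x) (x)) * τ)) * W
      + ((inner ℂ (x) (wirtBar v w)) + (inner ℂ (y) (x)) + (inner ℂ (x) (x)) * (τ * (w - q))) * (τ * conj (w - q) * W)).re
  rw [heq.self_of_nhds, expand, show W = _ from gaussWeight_eq τ q w, Complex.re_mul_ofReal]
  refine mul_pos ?_ (Real.exp_pos _)
  have re_self : ∀ z : E, ((inner ℂ (z) (z))).re = ‖z‖ ^ 2 := fun z => by
    rw [inner_self_eq_norm_sq_to_K]; norm_cast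
  have re_le : ∀ z z' : E, -(‖z‖ * ‖z'‖) ≤ ((inner ℂ (z) (z'))).re := fun z z' =>
    (abs_le.1 ((Complex.abs_re_le_norm _).trans (norm_inner_le_norm z z'))).1
  have b1 : ‖B' x‖ ≤ C * ‖x‖ := B'.le_of_opNorm_le hAC' x
  have b2 : ‖B (y + a • x)‖ ≤ C * ‖y + a • x‖ := B.le_of_opNorm_le hAC _
  have hx : 0 < ‖x‖ := norm_pos_iff.2 hne
  generalize y + a • x = D at *
  have r1 := re_le x (B' x)
  have r2 := re_le (B' x) x
  have r3 := re_le x (B D)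
  have r4 := re_le (B D) x
  have s1 : ‖x‖ * ‖B' x‖ ≤ C * ‖x‖ ^ 2 := by nlinarith
  have s2 : ‖x‖ * ‖B D‖ ≤ C * ‖x‖ * ‖D‖ := by nlinarith
  have h5 : ((τ : ℂ) * (inner ℂ (x) (x))).re = τ * ‖x‖ ^ 2 := by rw [Complex.re_ofReal_mul, re_self]
  simp only [Complex.add_re, re_self, h5]
  have h6 : 0 < (τ - (2 * C + C ^ 2)) * ‖x‖ ^ 2 := by
    have : 0 < τ - (2 * C + C ^ 2) := by linarith
    positivity
  -- The bad terms are at most `2C|x|² + 2C|x||D|`. Against `|D|²` the last one costs `C²|x|²`,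
  -- whence the threshold `2C + C²` for `τ`.
  nlinarith [sq_nonneg (‖D‖ - C * ‖x‖), sq_nonneg ‖B x‖]

/-- Unique continuation across circles for solutions of `∂u/∂w̄ = A u`. -/
theorem eq_zero_of_wirtBar_eq {u : ℂ → E} {A : ℂ → E →L[ℂ] E} {q : ℂ} {R : ℝ}
    (hu : ∀ w ∈ Metric.closedBall q R, ContDiffAt ℝ ∞ u w)
    (hA : ∀ w ∈ Metric.closedBall q R, ContDiffAt ℝ ∞ A w)
    (heq : ∀ w ∈ Metric.closedBall q R, wirtBar u =ᶠ[𝓝 w] fun y => A y (u y))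
    (h0 : u =ᶠ[𝓝 q] 0) {w : ℂ} (hw : w ∈ Metric.ball q R) : u w = 0 := by
  have hR : 0 < R := Metric.pos_of_mem_ball hw
  have hcomp : IsCompact (Metric.closedBall q R) := isCompact_closedBall q R
  obtain ⟨C₁, hC₁⟩ := hcomp.exists_bound_of_continuousOn (f := A)
    (fun y hy => (hA y hy).continuousAt.continuousWithinAt)
  obtain ⟨C₂, hC₂⟩ := hcomp.exists_bound_of_continuousOn (f := wirt A)
    (fun y hy => (contDiffAt_wirt (hA y hy)).continuousAt.continuousWithinAt)
  set C := max (max C₁ C₂) 0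
  have hC : 0 ≤ C := le_max_right _ _
  set τ := 2 * C + C ^ 2 + 1
  have hτ : 2 * C + C ^ 2 < τ := by simp [τ]
  obtain ⟨r, hr, hrz⟩ := Metric.eventually_nhds_iff_ball.1 h0
  obtain ⟨M, hM⟩ := hcomp.exists_bound_of_continuousOn
    (f := fun y => ‖u y‖ ^ 2 * Real.exp (τ * ‖y - q‖ ^ 2)) (fun y hy => by
      have := (hu y hy).continuousAt
      exact ContinuousAt.continuousWithinAt (by fun_prop))
  -- As `u` vanishes near `q`, it may be divided by any power of `w - q`. The maximum principle on
  -- the disc then gains the factor `(|w - q| / R)^{2k}`, with `M` independent of `k`, and `k → ∞`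
  -- forces `u w = 0`.
  have key : ∀ k : ℕ, ‖u w‖ ^ 2 ≤ (‖w - q‖ / R) ^ (2 * k) * M := by
    intro k
    by_cases hwr : w ∈ Metric.ball q r
    · rw [hrz w hwr]
      simp only [Pi.zero_apply, norm_zero, ne_eq, OfNat.ofNat_ne_zero, not_false_eq_true, zero_pow]
      have := (norm_nonneg _).trans (hM q (Metric.mem_closedBall_self hR.le))
      positivity
    have hwr' : r ≤ ‖w - q‖ := by simpa [dist_eq_norm] using hwr
    have hwR : ‖w - q‖ < R := by simpa [dist_eq_norm] using hw
    set v : ℂ → E := fun y => ((y - q) ^ k)⁻¹ • u y with hv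
    set g : ℂ → ℝ := fun y => ‖v y‖ ^ 2 * Real.exp (τ * ‖y - q‖ ^ 2) with hg
    -- The radius `r / 2` removes the pole at `q` but leaves a collar where `v = 0`, so a maximum
    -- with nonzero value never lies on the inner circle.
    set K : Set ℂ := Metric.closedBall q R \ Metric.ball q (r / 2) with hK
    have hKc : IsCompact K := hcomp.diff Metric.isOpen_ball
    have hKne : ∀ y ∈ K, y - q ≠ 0 := by
      intro y hy h
      rw [sub_eq_zero] at h
      exact hy.2 (h ▸ Metric.mem_ball_self (by positivity))
    have hholo : ∀ y, y - q ≠ 0 → DifferentiableAt ℂ (fun y => ((y - q) ^ k)⁻¹) y := fun y hy =>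
      ((differentiableAt_id.sub_const q).pow k).inv (pow_ne_zero k hy)
    have hψ : ∀ y, y - q ≠ 0 → ContDiffAt ℝ ∞ (fun y => ((y - q) ^ k)⁻¹) y := fun y hy =>
      ((contDiffAt_id.sub contDiffAt_const).pow k).inv (pow_ne_zero k hy)
    have hvs : ∀ y ∈ K, ContDiffAt ℝ ∞ v y := fun y hy => (hψ y (hKne y hy)).smul (hu y hy.1)
    have hgc : ContinuousOn g K := fun y hy => by
      have := (hvs y hy).continuousAt
      exact ContinuousAt.continuousWithinAt (by fun_prop)
    have hwK : w ∈ K := ⟨Metric.ball_subset_closedBall hw, by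
      simp only [Metric.mem_ball, dist_eq_norm]; linarith⟩
    obtain ⟨y, hyK, hmax⟩ := hKc.exists_isMaxOn ⟨w, hwK⟩ hgc
    have hgv : ∀ y, g y = (‖y - q‖ ^ (2 * k))⁻¹ * (‖u y‖ ^ 2 * Real.exp (τ * ‖y - q‖ ^ 2)) := by
      intro y
      simp only [hg, hv, norm_smul, norm_inv, norm_pow, mul_pow, inv_pow, ← pow_mul, mul_comm k 2]
      ring
    have hge : ‖u w‖ ^ 2 ≤ ‖w - q‖ ^ (2 * k) * g w := by
      rw [hgv, ← mul_assoc, mul_inv_cancel₀ (pow_ne_zero _ (norm_ne_zero_iff.2 (hKne w hwK))), one_mul]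
      exact le_mul_of_one_le_right (by positivity) (Real.one_le_exp (by positivity))
    -- At a maximum point `y` either `v y = 0`, or `y` lies on the outer circle and the bound is
    -- explicit, or `y` is an interior maximum, which contradicts strict subharmonicity.
    have hgy : g y ≤ (R ^ (2 * k))⁻¹ * M := by
      have hM0 := (norm_nonneg _).trans (hM q (Metric.mem_closedBall_self hR.le))
      by_cases hy0 : v y = 0
      · simp only [hg, hy0, norm_zero, ne_eq, OfNat.ofNat_ne_zero, not_false_eq_true, zero_pow,
          zero_mul]
        positivity
      have hur : r ≤ ‖y - q‖ := by
        by_contra! hlt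
        exact hy0 (by simp [hv, hrz y (by simpa [dist_eq_norm] using hlt)])
      have hyR : ‖y - q‖ ≤ R := by simpa [dist_eq_norm] using hyK.1
      rcases hyR.eq_or_lt with hyR | hyR
      · rw [hgv, hyR]
        have := hM y hyK.1
        rw [Real.norm_of_nonneg (by positivity), hyR] at this
        gcongr
      exfalso
      have hlm : IsLocalMax g y := by
        have h1 : ∀ᶠ y' in 𝓝 y, y' ∈ K := by
          have o1 : IsOpen {y' : ℂ | ‖y' - q‖ < R} := isOpen_lt (by fun_prop) continuous_const
          have o2 : IsOpen {y' : ℂ | r / 2 < ‖y' - q‖} := isOpen_lt continuous_const (by fun_prop)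
          filter_upwards [o1.mem_nhds hyR, o2.mem_nhds (show r / 2 < ‖y - q‖ by linarith)]
            with y' h1 h2
          refine ⟨?_, ?_⟩
          · simpa [dist_eq_norm] using h1.le
          · simpa [dist_eq_norm] using h2.le
        filter_upwards [h1] with y' hy' using hmax hy'
      have hG : (fun y => inner ℂ (v y) (v y) * gaussWeight τ q y) = fun y => (g y : ℂ) := by
        funext y
        rw [gaussWeight_eq, inner_self_eq_norm_sq_to_K]
        simp [hg]
      have hGs : ContDiffAt ℝ ∞ (fun y => inner ℂ (v y) (v y) * gaussWeight τ q y) y :=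
        ((hvs y hyK).inner ℂ (hvs y hyK)).mul (contDiff_gaussWeight τ q).contDiffAt
      have hgs : ContDiffAt ℝ ∞ g y := by
        have := Complex.reCLM.contDiff.contDiffAt.comp y hGs
        rw [hG] at this
        exact this
      -- Multiplication by a holomorphic function preserves the equation, because each `A y` is
      -- complex linear.
      have hveq : wirtBar v =ᶠ[𝓝 y] fun y => A y (v y) := by
        have hne : ∀ᶠ y' in 𝓝 y, y' - q ≠ 0 :=
          (continuousAt_id.sub continuousAt_const).eventually_ne (hKne y hyK)
        filter_upwards [heq y hyK.1, hne, (hu y hyK.1).eventually_differentiableAt] with y' h1 h2 h3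
        have hd := (hholo y' h2).hasFDerivAt.restrictScalars ℝ
        have hb : wirtBar (fun y => ((y - q) ^ k)⁻¹) y' = 0 := by
          rw [wirtBar, hd.fderiv]
          have : (fderiv ℂ (fun y => ((y - q) ^ k)⁻¹) y') I =
              I * (fderiv ℂ (fun y => ((y - q) ^ k)⁻¹) y') 1 := by
            rw [← smul_eq_mul, ← map_smul]; simp
          simp only [ContinuousLinearMap.coe_restrictScalars', this, smul_eq_mul]
          linear_combination (1 / 2 * (fderiv ℂ (fun y => ((y - q) ^ k)⁻¹) y') 1) * Complex.I_mul_I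
        rw [hv, wirtBar_smul hd.differentiableAt h3, hb, h1]
        simp
      have hpos := re_wirt_wirtBar_weighted_pos (q := q) hτ (hvs y hyK)
        ((hA y hyK.1).differentiableAt (by simp))
        ((hC₁ y hyK.1).trans ((le_max_left _ _).trans (le_max_left _ _)))
        ((hC₂ y hyK.1).trans ((le_max_right _ _).trans (le_max_left _ _))) hveq hy0
      have hlap := congrArg Complex.re (laplacian_eq_wirt_wirtBar hGs)
      have hcast2 : ∀ a : ℂ, fderiv ℝ (fun y' => fderiv ℝ (fun y => (g y : ℂ)) y' a) y a =
          (fderiv ℝ (fun y' => fderiv ℝ g y' a) y a : ℝ) := by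
        intro a
        have hcast : (fun y' => fderiv ℝ (fun y => (g y : ℂ)) y' a) =ᶠ[𝓝 y]
            fun y' => ((fderiv ℝ g y' a : ℝ) : ℂ) := by
          filter_upwards [hgs.eventually_differentiableAt] with y' hy' using fderiv_ofReal hy' a
        rw [hcast.fderiv_eq]
        exact fderiv_ofReal ((hgs.contDiffAt_fderiv_apply a).differentiableAt (by simp)) a
      have n1 := fderiv_fderiv_nonpos_of_isLocalMax hgs hlm 1
      have n2 := fderiv_fderiv_nonpos_of_isLocalMax hgs hlm I
      rw [hG, hcast2, hcast2] at hlap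
      rw [hG] at hpos
      simp only [Complex.add_re, Complex.ofReal_re, smul_eq_mul] at hlap
      have h4 : ((4 : ℂ) * wirt (wirtBar fun y => (g y : ℂ)) y).re =
          4 * (wirt (wirtBar fun y => (g y : ℂ)) y).re := by simp
      rw [h4] at hlap
      linarith
    calc ‖u w‖ ^ 2 ≤ ‖w - q‖ ^ (2 * k) * g w := hge
      _ ≤ ‖w - q‖ ^ (2 * k) * ((R ^ (2 * k))⁻¹ * M) := by
        gcongr
        exact (hmax hwK).trans hgy
      _ = (‖w - q‖ / R) ^ (2 * k) * M := by rw [div_pow]; ring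
  have hlim : Tendsto (fun k : ℕ => (‖w - q‖ / R) ^ (2 * k) * M) atTop (𝓝 (0 * M)) := by
    refine Tendsto.mul_const M ?_
    have hlt : ‖w - q‖ / R < 1 := by
      rw [div_lt_one hR]; simpa [dist_eq_norm] using hw
    exact (tendsto_pow_atTop_nhds_zero_of_lt_one (by positivity) hlt).comp
      (tendsto_id.const_mul_atTop' (by norm_num))
  have := ge_of_tendsto' hlim key
  rw [zero_mul] at this
  exact norm_eq_zero.1 (pow_eq_zero_iff (two_ne_zero) |>.1 (le_antisymm this (by positivity)))

end UniqueContinuation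

/-! ### Real and complex smoothness on complex manifolds -/

section RealStructure

variable {E : Type*} [NormedAddCommGroup E] [NormedSpace ℂ E]
  {M : Type*} [TopologicalSpace M] [ChartedSpace E M]
  {V : Type*} [NormedAddCommGroup V] [NormedSpace ℝ V]

theorem contDiffGroupoid_real {f : OpenPartialHomeomorph E E}
    (hf : f ∈ contDiffGroupoid ω 𝓘(ℂ, E)) : f ∈ contDiffGroupoid ∞ 𝓘(ℝ, E) := by
  rw [contDiffGroupoid, mem_groupoid_of_pregroupoid] at hf ⊢
  simp only [contDiffPregroupoid, modelWithCornersSelf_coe, modelWithCornersSelf_coe_symm,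
    Function.id_comp, Function.comp_id, Set.preimage_id, Set.range_id, Set.inter_univ] at hf ⊢
  exact ⟨(hf.1.restrict_scalars ℝ).of_le (by simp), (hf.2.restrict_scalars ℝ).of_le (by simp)⟩

/-- Lets holomorphic charts serve as charts of the underlying real smooth manifold, the structure in
which the maps are smooth. -/
theorem mem_maximalAtlas_real {e : OpenPartialHomeomorph M E}
    (he : e ∈ IsManifold.maximalAtlas 𝓘(ℂ, E) ω M) : e ∈ IsManifold.maximalAtlas 𝓘(ℝ, E) ∞ M :=
  fun e' he' => ⟨contDiffGroupoid_real (he e' he').1, contDiffGroupoid_real (he e' he').2⟩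

variable {e e' : OpenPartialHomeomorph M E}

theorem contMDiffAt_iff_chart (he : e ∈ IsManifold.maximalAtlas 𝓘(ℂ, E) ω M) {g : V → M} {x : V}
    (hx : g x ∈ e.source) : ContMDiffAt 𝓘(ℝ, V) 𝓘(ℝ, E) ∞ g x ↔
      ContinuousAt g x ∧ ContDiffAt ℝ ∞ (fun y => e (g y)) x := by
  rw [contMDiffAt_iff_of_mem_maximalAtlas (IsManifold.chart_mem_maximalAtlas (I := 𝓘(ℝ, V)) x)
    (mem_maximalAtlas_real he) (by simp) hx]
  simp [Function.comp_def, contDiffWithinAt_univ, chartAt_self_eq]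

theorem ContMDiffAt.contDiffAt_chart (he : e ∈ IsManifold.maximalAtlas 𝓘(ℂ, E) ω M) {g : V → M}
    {x : V} (hg : ContMDiffAt 𝓘(ℝ, V) 𝓘(ℝ, E) ∞ g x) (hx : g x ∈ e.source) :
    ContDiffAt ℝ ∞ (fun y => e (g y)) x :=
  ((contMDiffAt_iff_chart he hx).1 hg).2

theorem contDiffAt_transition (he : e ∈ IsManifold.maximalAtlas 𝓘(ℂ, E) ω M)
    (he' : e' ∈ IsManifold.maximalAtlas 𝓘(ℂ, E) ω M) {z : E} (hz : z ∈ e.target)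
    (hz' : e.symm z ∈ e'.source) : ContDiffAt ℂ ω (fun y => e' (e.symm y)) z := by
  have h := (contDiffGroupoid ω 𝓘(ℂ, E)).compatible_of_mem_maximalAtlas he he'
  rw [contDiffGroupoid, mem_groupoid_of_pregroupoid] at h
  simp only [contDiffPregroupoid, modelWithCornersSelf_coe, modelWithCornersSelf_coe_symm,
    Function.id_comp, Function.comp_id, Set.preimage_id, Set.range_id, Set.inter_univ] at h
  exact h.1.contDiffAt ((e.symm.trans e').open_source.mem_nhds (by simp [hz, hz']))

theorem differentiableAt_transition (he : e ∈ IsManifold.maximalAtlas 𝓘(ℂ, E) ω M)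
    (he' : e' ∈ IsManifold.maximalAtlas 𝓘(ℂ, E) ω M) {z : E} (hz : z ∈ e.target)
    (hz' : e.symm z ∈ e'.source) : DifferentiableAt ℂ (fun y => e' (e.symm y)) z :=
  (contDiffAt_transition he he' hz hz').differentiableAt (by simp)

theorem eventually_chart_eq_transition (e' : OpenPartialHomeomorph M E) {g : V → M} {x : V}
    (hg : ContinuousAt g x) (hx : g x ∈ e.source) :
    (fun y => e' (g y)) =ᶠ[𝓝 x] fun y => e' (e.symm (e (g y))) := by
  filter_upwards [hg.eventually (e.open_source.mem_nhds hx)] with y hy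
  rw [e.left_inv hy]

/-- The real differential of a map changes by the complex linear Jacobian of the transition; hence
its splitting into `∂/∂w` and `∂/∂w̄` parts does not depend on the holomorphic chart. -/
theorem fderiv_chart_change (he : e ∈ IsManifold.maximalAtlas 𝓘(ℂ, E) ω M)
    (he' : e' ∈ IsManifold.maximalAtlas 𝓘(ℂ, E) ω M) {g : V → M} {x : V}
    (hg : ContMDiffAt 𝓘(ℝ, V) 𝓘(ℝ, E) ∞ g x) (hx : g x ∈ e.source) (hx' : g x ∈ e'.source) (v : V) :
    fderiv ℝ (fun y => e' (g y)) x v =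
      fderiv ℂ (fun y => e' (e.symm y)) (e (g x)) (fderiv ℝ (fun y => e (g y)) x v) := by
  have h1 := (differentiableAt_transition he he' (e.map_source hx)
    (by rwa [e.left_inv hx])).hasFDerivAt.restrictScalars ℝ
  have h2 := ((ContMDiffAt.contDiffAt_chart he hg hx).differentiableAt (by simp)).hasFDerivAt
  rw [(eventually_chart_eq_transition e' hg.continuousAt hx).fderiv_eq]
  have h3 : HasFDerivAt (fun y => e' (e.symm (e (g y)))) _ x :=
    HasFDerivAt.comp (g := fun y => e' (e.symm y)) (f := fun y => e (g y)) x h1 h2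
  rw [h3.fderiv]
  rfl

/-- The intrinsic differential is by definition read in the preferred chart at the image point;
other charts are compared with this one. -/
theorem mfderiv_real_apply {g : V → M} {x : V} (hg : ContMDiffAt 𝓘(ℝ, V) 𝓘(ℝ, E) ∞ g x) (v : V) :
    (mfderiv 𝓘(ℝ, V) 𝓘(ℝ, E) g x v : E) = fderiv ℝ (fun y => chartAt E (g x) (g y)) x v := by
  rw [(hg.mdifferentiableAt (by simp)).mfderiv]
  simp only [writtenInExtChartAt, extChartAt, mfld_simps, Function.comp_def]
  rw [fderivWithin_univ]
  rfl

theorem mfderiv_symm_apply (he : e ∈ IsManifold.maximalAtlas 𝓘(ℂ, E) ω M) {z : E} (hz : z ∈ e.target)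
    (v : E) : (mfderiv 𝓘(ℂ, E) 𝓘(ℂ, E) e.symm z v : E) =
      fderiv ℂ (fun y => chartAt E (e.symm z) (e.symm y)) z v := by
  rw [((contMDiffAt_symm_of_mem_maximalAtlas he hz).mdifferentiableAt (by simp)).mfderiv]
  simp only [writtenInExtChartAt, extChartAt, mfld_simps, Function.comp_def]
  rw [fderivWithin_univ]
  rfl

/-- The real differential of a map, read in a holomorphic chart. -/
theorem mfderiv_real_apply_eq [IsManifold 𝓘(ℂ, E) ω M] (he : e ∈ IsManifold.maximalAtlas 𝓘(ℂ, E) ω M) {g : V → M} {x : V}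
    (hg : ContMDiffAt 𝓘(ℝ, V) 𝓘(ℝ, E) ∞ g x) (hx : g x ∈ e.source) (v : V) :
    (mfderiv 𝓘(ℝ, V) 𝓘(ℝ, E) g x v : E) =
      (mfderiv 𝓘(ℂ, E) 𝓘(ℂ, E) e.symm (e (g x)) (fderiv ℝ (fun y => e (g y)) x v) : E) := by
  rw [mfderiv_real_apply hg, mfderiv_symm_apply he (e.map_source hx), e.left_inv hx]
  exact fderiv_chart_change he (IsManifold.chart_mem_maximalAtlas _) hg hx
    (mem_chart_source _ _) v

end RealStructure

/-! ### The Kähler metric in charts -/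

section MetricCharts

variable {n : ℕ} {M : Type*} [TopologicalSpace M] [ChartedSpace (Cn n) M]

theorem sum_smul_coordVec (u : Cn n) : u = ∑ α, u α • (coordVec α : Cn n) := by
  ext δ
  simp only [coordVec, WithLp.ofLp_sum, WithLp.ofLp_smul, Finset.sum_apply, Pi.smul_apply,
    PiLp.ofLp_single]
  rw [Finset.sum_eq_single δ]
  · simp
  · intro b _ hb
    simp [hb.symm]
  · simp

theorem form_mfderiv_symm (h : KahlerMetric n M) (e : OpenPartialHomeomorph M (Cn n)) (z u v : Cn n) :
    h.form (e.symm z) (mfderiv 𝓘(ℂ, Cn n) 𝓘(ℂ, Cn n) e.symm z u)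
      (mfderiv 𝓘(ℂ, Cn n) 𝓘(ℂ, Cn n) e.symm z v) = hf (metricCoeff h.form e) z u v := by
  set L : Cn n →ₗ[ℂ] TangentSpace 𝓘(ℂ, Cn n) (e.symm z) :=
    (mfderiv 𝓘(ℂ, Cn n) 𝓘(ℂ, Cn n) e.symm z).toLinearMap
  have hL : h.form (e.symm z) (L u) (L v) = hf (metricCoeff h.form e) z u v := by
    conv_lhs => rw [sum_smul_coordVec u, sum_smul_coordVec v]
    simp only [map_sum, LinearMap.sum_apply, map_smul, LinearMap.smul_apply, LinearMap.map_smulₛₗ,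
      smul_eq_mul, Finset.mul_sum, hf, metricCoeff]
    rw [Finset.sum_comm]
    refine Finset.sum_congr rfl fun α _ => Finset.sum_congr rfl fun β _ => ?_
    change conj (v β) * (u α * h.form (e.symm z) (L (coordVec α)) (L (coordVec β))) =
      h.form (e.symm z) (L (coordVec α)) (L (coordVec β)) * u α * conj (v β)
    ring
  exact hL

/-- The link between the intrinsic metric and the coordinate computations. Positivity of the matrix
uses that the differential of the inverse chart is injective. -/
theorem KahlerMetric.localKahler (h : KahlerMetric n M) {e : OpenPartialHomeomorph M (Cn n)}
    (he : e ∈ IsManifold.maximalAtlas 𝓘(ℂ, Cn n) ω M) :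
    LocalKahler (metricCoeff h.form e) e.target where
  isOpen := e.open_target
  smooth := h.smooth e he
  herm z _ α β := h.conj_symm _ _ _
  pos z hz u hu := by
    rw [← form_mfderiv_symm]
    refine h.pos _ _ fun h0 => hu ?_
    have hm : e.MDifferentiable 𝓘(ℂ, Cn n) 𝓘(ℂ, Cn n) :=
      ⟨(contMDiffOn_of_mem_maximalAtlas he).mdifferentiableOn (by simp),
        (contMDiffOn_symm_of_mem_maximalAtlas he).mdifferentiableOn (by simp)⟩
    exact hm.symm.mfderiv_injective hz (h0.trans (map_zero _).symm)
  closed z hz α β γ := h.closed e he z hz α β γ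

/-- The differential of the inverse of a chart, as a map between the model spaces. -/
noncomputable def frame (e : OpenPartialHomeomorph M (Cn n)) (z : Cn n) : Cn n →L[ℂ] Cn n :=
  mfderiv 𝓘(ℂ, Cn n) 𝓘(ℂ, Cn n) e.symm z

/-- The metric on two vectors given by their components in a chart. -/
theorem form_eq_hf (h : KahlerMetric n M) {e : OpenPartialHomeomorph M (Cn n)} {x : M}
    (hx : x ∈ e.source) {a b u v : Cn n}
    (ha : a = frame e (e x) u)
    (hb : b = frame e (e x) v) :
    h.form x (a : Cn n) (b : Cn n) = hf (metricCoeff h.form e) (e x) u v := by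
  rw [← form_mfderiv_symm]
  obtain ⟨z, hz, rfl⟩ : ∃ z ∈ e.target, x = e.symm z := ⟨e x, e.map_source hx, (e.left_inv hx).symm⟩
  subst ha hb
  rw [e.right_inv hz]
  rfl

/-- The real differential of a curve of complex parameter, as a map between the model spaces. -/
noncomputable def realD (g : ℂ → M) (w : ℂ) : ℂ →L[ℝ] Cn n := mfderiv 𝓘(ℝ, ℂ) 𝓘(ℝ, Cn n) g w

/-- The `(1,0)`-part of `g_*(∂/∂w)`. -/
noncomputable def mWirt (g : ℂ → M) (w : ℂ) : Cn n :=
  (1 / 2 : ℂ) • (realD g w 1 - I • realD g w I)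

/-- The `(1,0)`-part of `g_*(∂/∂w̄)`. -/
noncomputable def mWirtBar (g : ℂ → M) (w : ℂ) : Cn n :=
  (1 / 2 : ℂ) • (realD g w 1 + I • realD g w I)

variable {e : OpenPartialHomeomorph M (Cn n)}

variable [IsManifold 𝓘(ℂ, Cn n) ω M]

theorem realD_eq (he : e ∈ IsManifold.maximalAtlas 𝓘(ℂ, Cn n) ω M) {g : ℂ → M} {w : ℂ}
    (hg : ContMDiffAt 𝓘(ℝ, ℂ) 𝓘(ℝ, Cn n) ∞ g w) (hx : g w ∈ e.source) (v : ℂ) :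
    realD g w v = frame e (e (g w)) (fderiv ℝ (fun y => e (g y)) w v) :=
  mfderiv_real_apply_eq he hg hx v

theorem mWirt_eq (he : e ∈ IsManifold.maximalAtlas 𝓘(ℂ, Cn n) ω M) {g : ℂ → M} {w : ℂ}
    (hg : ContMDiffAt 𝓘(ℝ, ℂ) 𝓘(ℝ, Cn n) ∞ g w) (hx : g w ∈ e.source) :
    mWirt g w = frame e (e (g w)) (wirt (fun y => e (g y)) w) := by
  rw [mWirt, realD_eq he hg hx, realD_eq he hg hx, wirt, map_smul, map_sub, map_smul]

theorem mWirtBar_eq (he : e ∈ IsManifold.maximalAtlas 𝓘(ℂ, Cn n) ω M) {g : ℂ → M} {w : ℂ}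
    (hg : ContMDiffAt 𝓘(ℝ, ℂ) 𝓘(ℝ, Cn n) ∞ g w) (hx : g w ∈ e.source) :
    mWirtBar g w = frame e (e (g w)) (wirtBar (fun y => e (g y)) w) := by
  rw [mWirtBar, realD_eq he hg hx, realD_eq he hg hx, wirtBar, map_smul, map_add, map_smul]

/-- The energy density of the `∂/∂w` part. -/
noncomputable def densW (h : KahlerMetric n M) (g : ℂ → M) (w : ℂ) : ℝ :=
  (h.form (g w) (mWirt (n := n) g w) (mWirt (n := n) g w)).re

/-- The energy density of the `∂/∂w̄` part. -/
noncomputable def densBar (h : KahlerMetric n M) (g : ℂ → M) (w : ℂ) : ℝ :=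
  (h.form (g w) (mWirtBar (n := n) g w) (mWirtBar (n := n) g w)).re

theorem energy_eq (h : KahlerMetric n M) (f : P1 → M) :
    energy h f = ∫ w : ℂ, 2 * (densW h (fun u : ℂ => f (u : P1)) w
      + densBar h (fun u : ℂ => f (u : P1)) w) := rfl

theorem densW_eq (h : KahlerMetric n M) (he : e ∈ IsManifold.maximalAtlas 𝓘(ℂ, Cn n) ω M) {g : ℂ → M}
    {w : ℂ} (hg : ContMDiffAt 𝓘(ℝ, ℂ) 𝓘(ℝ, Cn n) ∞ g w) (hx : g w ∈ e.source) :
    densW h g w = (hf (metricCoeff h.form e) (e (g w)) (wirt (fun y => e (g y)) w)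
      (wirt (fun y => e (g y)) w)).re := by
  rw [densW, form_eq_hf h hx (mWirt_eq he hg hx) (mWirt_eq he hg hx)]

theorem KahlerMetric.form_self_nonneg (h : KahlerMetric n M) (x : M)
    (v : TangentSpace 𝓘(ℂ, Cn n) x) : 0 ≤ (h.form x v v).re := by
  by_cases h0 : v = 0
  · rw [h0]; simp
  · exact (h.pos _ _ h0).le

theorem densW_nonneg (h : KahlerMetric n M) (g : ℂ → M) (w : ℂ) : 0 ≤ densW h g w :=
  h.form_self_nonneg _ _

end MetricCharts

/-! ### Integrals over the plane -/

section Integrals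

/-- On a compact segment of parameters times `K` the derivative is bounded, which supplies the
dominating constant. The statement is at an arbitrary point of the line, so that it can be applied
again to the derivative. -/
theorem hasDerivAt_setIntegral_dir {Φ : ℂ × ℂ → ℝ} {r : ℝ}
    (hΦ : ∀ x : ℂ × ℂ, x.1 ∈ Metric.ball 0 r → ContDiffAt ℝ ∞ Φ x) {K : Set ℂ} (hK : IsCompact K)
    (t ξ : ℂ) (s₀ : ℝ) (hs : t + s₀ • ξ ∈ Metric.ball (0 : ℂ) r) :
    HasDerivAt (fun s : ℝ => ∫ w in K, Φ (t + s • ξ, w))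
      (∫ w in K, fderiv ℝ Φ (t + s₀ • ξ, w) (ξ, 0)) s₀ := by
  have hline : Continuous fun s : ℝ => t + s • ξ := by fun_prop
  obtain ⟨ε, hε, hεs⟩ := Metric.nhds_basis_closedBall.mem_iff.1
    (hline.continuousAt.preimage_mem_nhds (Metric.isOpen_ball.mem_nhds hs))
  have hcont : ContinuousOn (fun x : ℝ × ℂ => fderiv ℝ Φ (t + x.1 • ξ, x.2) (ξ, 0))
      (Metric.closedBall s₀ ε ×ˢ K) := by
    intro x hx
    have h1 : ContinuousAt (fun y => fderiv ℝ Φ y (ξ, 0)) (t + x.1 • ξ, x.2) :=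
      ((hΦ (t + x.1 • ξ, x.2) (hεs hx.1)).contDiffAt_fderiv_apply (ξ, 0)).continuousAt
    have h2 : ContinuousAt (fun x : ℝ × ℂ => (t + x.1 • ξ, x.2)) x := by fun_prop
    exact (ContinuousAt.comp (f := fun x : ℝ × ℂ => (t + x.1 • ξ, x.2)) h1 h2).continuousWithinAt
  obtain ⟨C, hC⟩ := ((isCompact_closedBall s₀ ε).prod hK).exists_bound_of_continuousOn hcont
  have hslice : ∀ s ∈ Metric.closedBall s₀ ε, Continuous fun w => Φ (t + s • ξ, w) := by
    intro s hs
    rw [continuous_iff_continuousAt]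
    intro w
    exact ContinuousAt.comp (f := fun w => (t + s • ξ, w)) (hΦ (t + s • ξ, w) (hεs hs)).continuousAt
      (by fun_prop)
  have hslice' : ContinuousOn (fun w => fderiv ℝ Φ (t + s₀ • ξ, w) (ξ, 0)) K :=
    ContinuousOn.comp hcont (f := fun w => (s₀, w)) (by fun_prop)
      fun w hw => ⟨Metric.mem_closedBall_self hε.le, hw⟩
  refine (hasDerivAt_integral_of_dominated_loc_of_deriv_le (bound := fun _ => C)
    (F' := fun s w => fderiv ℝ Φ (t + s • ξ, w) (ξ, 0)) (Metric.closedBall_mem_nhds s₀ hε)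
    ?_ ?_ ?_ ?_ ?_ ?_).2
  · filter_upwards [Metric.closedBall_mem_nhds s₀ hε] with s hs
    exact (hslice s hs).aestronglyMeasurable
  · exact (hslice s₀ (Metric.mem_closedBall_self hε.le)).continuousOn.integrableOn_compact hK
  · exact hslice'.aestronglyMeasurable_of_isCompact hK hK.measurableSet
  · refine (ae_restrict_iff' hK.measurableSet).2 (Eventually.of_forall fun w hw s hs => ?_)
    exact hC (s, w) ⟨hs, hw⟩
  · exact (continuousOn_const.integrableOn_compact hK)
  · refine Eventually.of_forall fun w s hs => ?_
    have h1 : HasFDerivAt Φ _ (t + s • ξ, w) :=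
      ((hΦ (t + s • ξ, w) (hεs hs)).differentiableAt (by simp)).hasFDerivAt
    have h2 : HasDerivAt (fun s : ℝ => (t + s • ξ, w)) (ξ, (0 : ℂ)) s := by
      refine HasDerivAt.prodMk ?_ (hasDerivAt_const _ _)
      simpa using ((hasDerivAt_id s).smul_const ξ).const_add t
    exact h1.comp_hasDerivAt s h2

/-- Integration by parts against the constant function `1`. -/
theorem integral_fderiv_eq_zero {p : ℂ → ℂ} (hp : ContDiff ℝ ∞ p) (hc : HasCompactSupport p) (v : ℂ) :
    ∫ w, fderiv ℝ p w v = 0 := by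
  have h := integral_smul_fderiv_eq_neg_fderiv_smul_of_integrable (μ := volume) (𝕜 := ℝ)
    (f := fun _ : ℂ => (1 : ℝ)) (g := p) (v := v) ?_ ?_ ?_ (fun _ _ => by fun_prop)
    (fun w _ => hp.differentiable (by simp) w)
  · simpa using h
  · simp
  · simp only [one_smul]
    exact ((hp.continuous_fderiv (by simp)).clm_apply continuous_const).integrable_of_hasCompactSupport
      (hc.fderiv_apply (𝕜 := ℝ) v)
  · simpa using hp.continuous.integrable_of_hasCompactSupport hc

theorem integrable_fderiv_apply {p : ℂ → ℂ} (hp : ContDiff ℝ ∞ p) (hc : HasCompactSupport p) (v : ℂ) :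
    Integrable fun w => fderiv ℝ p w v :=
  ((hp.continuous_fderiv (by simp)).clm_apply continuous_const).integrable_of_hasCompactSupport
    (hc.fderiv_apply (𝕜 := ℝ) v)

theorem integral_wirt_eq_zero {p : ℂ → ℂ} (hp : ContDiff ℝ ∞ p) (hc : HasCompactSupport p) :
    ∫ w, wirt p w = 0 := by
  have hI : Integrable fun w => I • fderiv ℝ p w I := (integrable_fderiv_apply hp hc I).smul I
  simp only [wirt]
  rw [integral_smul, integral_sub (integrable_fderiv_apply hp hc 1) hI, integral_smul, integral_fderiv_eq_zero hp hc,
    integral_fderiv_eq_zero hp hc]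
  simp

theorem integral_wirtBar_eq_zero {p : ℂ → ℂ} (hp : ContDiff ℝ ∞ p) (hc : HasCompactSupport p) :
    ∫ w, wirtBar p w = 0 := by
  have hI : Integrable fun w => I • fderiv ℝ p w I := (integrable_fderiv_apply hp hc I).smul I
  simp only [wirtBar]
  rw [integral_smul, integral_add (integrable_fderiv_apply hp hc 1) hI, integral_smul, integral_fderiv_eq_zero hp hc,
    integral_fderiv_eq_zero hp hc]
  simp

theorem integrable_wirt {p : ℂ → ℂ} (hp : ContDiff ℝ ∞ p) (hc : HasCompactSupport p) :
    Integrable (wirt p) :=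
  ((integrable_fderiv_apply hp hc 1).sub ((integrable_fderiv_apply hp hc I).smul I)).smul (1 / 2 : ℂ)

theorem integrable_wirtBar {p : ℂ → ℂ} (hp : ContDiff ℝ ∞ p) (hc : HasCompactSupport p) :
    Integrable (wirtBar p) :=
  ((integrable_fderiv_apply hp hc 1).add ((integrable_fderiv_apply hp hc I).smul I)).smul (1 / 2 : ℂ)

variable {K : Set ℂ}

theorem wirt_eq_zero_of_eventually {p : ℂ → ℂ} {w : ℂ} (h : p =ᶠ[𝓝 w] 0) : wirt p w = 0 := by
  rw [wirt_congr h]; simp [wirt]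

theorem wirtBar_eq_zero_of_eventually {p : ℂ → ℂ} {w : ℂ} (h : p =ᶠ[𝓝 w] 0) : wirtBar p w = 0 := by
  rw [wirtBar_congr h]; simp [wirtBar]

theorem eventually_eq_zero_of_notMem (hK : IsCompact K) {p : ℂ → ℂ} (h0 : ∀ w ∉ K, p w = 0) {w : ℂ}
    (hw : w ∉ K) : p =ᶠ[𝓝 w] 0 := by
  filter_upwards [hK.isClosed.isOpen_compl.mem_nhds hw] with y hy
  exact h0 y hy

theorem setIntegral_re_wirt_eq_zero (hK : IsCompact K) {p : ℂ → ℂ} (hp : ContDiff ℝ ∞ p)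
    (h0 : ∀ w ∉ K, p w = 0) : ∫ w in K, (wirt p w).re = 0 := by
  have hc := HasCompactSupport.intro hK h0
  rw [setIntegral_eq_integral_of_forall_compl_eq_zero fun w hw => by
    rw [wirt_eq_zero_of_eventually (eventually_eq_zero_of_notMem hK h0 hw)]; rfl]
  have := reCLM.integral_comp_comm (integrable_wirt hp hc)
  simpa [integral_wirt_eq_zero hp hc] using this

theorem setIntegral_re_wirtBar_eq_zero (hK : IsCompact K) {p : ℂ → ℂ} (hp : ContDiff ℝ ∞ p)
    (h0 : ∀ w ∉ K, p w = 0) : ∫ w in K, (wirtBar p w).re = 0 := by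
  have hc := HasCompactSupport.intro hK h0
  rw [setIntegral_eq_integral_of_forall_compl_eq_zero fun w hw => by
    rw [wirtBar_eq_zero_of_eventually (eventually_eq_zero_of_notMem hK h0 hw)]; rfl]
  have := reCLM.integral_comp_comm (integrable_wirtBar hp hc)
  simpa [integral_wirtBar_eq_zero hp hc] using this

/-- The exponent 4 exceeds the real dimension 2. The comparison is with `(1 + |w|)⁻⁴`, the factor
`16 = 2⁴` coming from `1 + |w| ≤ 2 max(1, |w|)`. -/
theorem integrable_of_decay {D : ℂ → ℝ} (hD : Continuous D) {C : ℝ}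
    (hC : ∀ w, 1 ≤ ‖w‖ → ‖D w‖ ≤ C * (‖w‖ ^ 4)⁻¹) : Integrable D := by
  obtain ⟨C', hC'⟩ := (isCompact_closedBall (0 : ℂ) 1).exists_bound_of_continuousOn hD.continuousOn
  have hint : Integrable fun w : ℂ => (1 + ‖w‖) ^ (-(4 : ℝ)) :=
    integrable_one_add_norm (by rw [Complex.finrank_real_complex]; norm_num)
  refine (hint.const_mul (16 * (|C| + |C'|))).mono' hD.aestronglyMeasurable
    (Eventually.of_forall fun w => ?_)
  have hpos : (0 : ℝ) < 1 + ‖w‖ := by positivity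
  rw [Real.rpow_neg hpos.le, show (4 : ℝ) = ((4 : ℕ) : ℝ) by norm_num, Real.rpow_natCast]
  rcases le_or_gt ‖w‖ 1 with hw | hw
  · have h1 : ‖D w‖ ≤ C' := hC' w (by simpa using hw)
    have h2 : (1 + ‖w‖) ^ 4 ≤ 16 := by
      calc (1 + ‖w‖) ^ 4 ≤ 2 ^ 4 := by gcongr; linarith
        _ = 16 := by norm_num
    have h3 : (1 : ℝ) ≤ 16 * ((1 + ‖w‖) ^ 4)⁻¹ := by
      rw [← div_eq_mul_inv, le_div_iff₀ (by positivity)]; linarith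
    nlinarith [le_abs_self C', abs_nonneg C, abs_nonneg C']
  · have h1 := hC w hw.le
    have h2 : (‖w‖ ^ 4)⁻¹ ≤ 16 * ((1 + ‖w‖) ^ 4)⁻¹ := by
      rw [← div_eq_mul_inv, inv_eq_one_div, div_le_div_iff₀ (by positivity) (by positivity), one_mul]
      calc (1 + ‖w‖) ^ 4 ≤ (2 * ‖w‖) ^ 4 := by gcongr; linarith
        _ = 16 * ‖w‖ ^ 4 := by ring
    have h3 : 0 ≤ (‖w‖ ^ 4)⁻¹ := by positivity
    have h4 : 0 ≤ ((1 + ‖w‖) ^ 4)⁻¹ := by positivity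
    calc ‖D w‖ ≤ C * (‖w‖ ^ 4)⁻¹ := h1
      _ ≤ (|C| + |C'|) * (‖w‖ ^ 4)⁻¹ := by
        gcongr; linarith [le_abs_self C, abs_nonneg C']
      _ ≤ (|C| + |C'|) * (16 * ((1 + ‖w‖) ^ 4)⁻¹) := by gcongr
      _ = _ := by ring

theorem eqOn_zero_of_setIntegral_eq_zero {φ : ℂ → ℝ} {K : Set ℂ} (hK : IsCompact K) (hφ : Continuous φ)
    (h0 : ∀ w, 0 ≤ φ w) (hs : ∀ w ∉ K, φ w = 0) (hint : ∫ w in K, φ w = 0) (w : ℂ) : φ w = 0 := by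
  rw [setIntegral_eq_integral_of_forall_compl_eq_zero hs] at hint
  have hi : Integrable φ :=
    hφ.integrable_of_hasCompactSupport (HasCompactSupport.intro hK hs)
  have := (integral_eq_zero_iff_of_nonneg h0 hi).1 hint
  exact congrFun (hφ.ae_eq_iff_eq volume continuous_const |>.1 this) w

end Integrals

/-! ### Families of maps -/

section Pairing

variable {n : ℕ} {M : Type*} [TopologicalSpace M] [ChartedSpace (Cn n) M]

/-- The metric as a pairing of vectors of the model space. -/
noncomputable def pairing (h : KahlerMetric n M) (x : M) (a b : Cn n) : ℂ := h.form x a b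

variable (h : KahlerMetric n M) {e : OpenPartialHomeomorph M (Cn n)}

theorem pairing_frame {x : M} (hx : x ∈ e.source) (u v : Cn n) :
    pairing h x (frame e (e x) u) (frame e (e x) v) = hf (metricCoeff h.form e) (e x) u v :=
  form_eq_hf h hx rfl rfl

theorem pairing_zero_right (x : M) (a : Cn n) : pairing h x a 0 = 0 :=
  map_zero (h.form x a)

theorem pairing_smul (x : M) (a b : Cn n) (c d : ℂ) :
    pairing h x (c • a) (d • b) = c * conj d * pairing h x a b := by
  have h1 : pairing h x (c • a) (d • b) = c * pairing h x a (d • b) :=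
    congr($((h.form x).map_smul c a) (d • b))
  have h2 : pairing h x a (d • b) = conj d * pairing h x a b := (h.form x a).map_smulₛₗ d b
  rw [h1, h2]; ring

theorem densW_eq_pairing (g : ℂ → M) (w : ℂ) :
    densW h g w = (pairing h (g w) (mWirt g w) (mWirt g w)).re := rfl

theorem densBar_eq_pairing (g : ℂ → M) (w : ℂ) :
    densBar h g w = (pairing h (g w) (mWirtBar g w) (mWirtBar g w)).re := rfl

theorem eq_zero_of_pairing_self {x : M} {a : Cn n} (ha : (pairing h x a a).re = 0) : a = 0 := by
  by_contra h0
  exact (h.pos x a h0).ne' ha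

theorem realD_congr {g g' : ℂ → M} {w : ℂ} (hg : g =ᶠ[𝓝 w] g') : realD (n := n) g w = realD (n := n) g' w :=
  hg.mfderiv_eq

theorem mWirt_congr {g g' : ℂ → M} {w : ℂ} (hg : g =ᶠ[𝓝 w] g') : mWirt (n := n) g w = mWirt (n := n) g' w := by
  rw [mWirt, mWirt, realD_congr hg]

theorem mWirtBar_congr {g g' : ℂ → M} {w : ℂ} (hg : g =ᶠ[𝓝 w] g') :
    mWirtBar (n := n) g w = mWirtBar (n := n) g' w := by
  rw [mWirtBar, mWirtBar, realD_congr hg]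

theorem densW_congr {g g' : ℂ → M} {w : ℂ} (hg : g =ᶠ[𝓝 w] g') : densW h g w = densW h g' w := by
  rw [densW_eq_pairing, densW_eq_pairing, mWirt_congr hg, hg.self_of_nhds]

theorem densBar_congr {g g' : ℂ → M} {w : ℂ} (hg : g =ᶠ[𝓝 w] g') :
    densBar h g w = densBar h g' w := by
  rw [densBar_eq_pairing, densBar_eq_pairing, mWirtBar_congr hg, hg.self_of_nhds]

variable [IsManifold 𝓘(ℂ, Cn n) ω M]

theorem frame_injective (he : e ∈ IsManifold.maximalAtlas 𝓘(ℂ, Cn n) ω M) {z : Cn n}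
    (hz : z ∈ e.target) : Function.Injective (frame e z) := by
  have hm : e.MDifferentiable 𝓘(ℂ, Cn n) 𝓘(ℂ, Cn n) :=
    ⟨(contMDiffOn_of_mem_maximalAtlas he).mdifferentiableOn (by simp),
      (contMDiffOn_symm_of_mem_maximalAtlas he).mdifferentiableOn (by simp)⟩
  exact hm.symm.mfderiv_injective hz

variable {V : Type*} [NormedAddCommGroup V] [NormedSpace ℝ V]

theorem pairing_eventuallyEq {G : V → M} {x : V} {a b u v : V → Cn n} (hG : ContinuousAt G x)
    (hx : G x ∈ e.source) (ha : ∀ᶠ y in 𝓝 x, a y = frame e (e (G y)) (u y))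
    (hb : ∀ᶠ y in 𝓝 x, b y = frame e (e (G y)) (v y)) :
    (fun y => pairing h (G y) (a y) (b y)) =ᶠ[𝓝 x]
      fun y => hf (metricCoeff h.form e) (e (G y)) (u y) (v y) := by
  filter_upwards [hG.eventually (e.open_source.mem_nhds hx), ha, hb] with y h1 h2 h3
  rw [h2, h3, pairing_frame h h1]

theorem contDiffAt_pairing (he : e ∈ IsManifold.maximalAtlas 𝓘(ℂ, Cn n) ω M) {G : V → M} {x : V}
    {a b u v : V → Cn n} (hG : ContMDiffAt 𝓘(ℝ, V) 𝓘(ℝ, Cn n) ∞ G x)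
    (hx : G x ∈ e.source) (ha : ∀ᶠ y in 𝓝 x, a y = frame e (e (G y)) (u y))
    (hb : ∀ᶠ y in 𝓝 x, b y = frame e (e (G y)) (v y)) (hu : ContDiffAt ℝ ∞ u x)
    (hv : ContDiffAt ℝ ∞ v x) : ContDiffAt ℝ ∞ (fun y => pairing h (G y) (a y) (b y)) x :=
  (contDiffAt_hf (Z := fun y => e (G y))
    (fun α β => (h.localKahler he).contDiffAt (e.map_source hx) α β)
    (ContMDiffAt.contDiffAt_chart (g := G) he hG hx) hu hv).congr_of_eventuallyEq
    (pairing_eventuallyEq h hG.continuousAt hx ha hb)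

end Pairing

/-! ### Smoothness of the densities and of the Hopf coefficient of one map -/

section Maps

variable {n : ℕ} {M : Type*} [TopologicalSpace M] [ChartedSpace (Cn n) M]
  [IsManifold 𝓘(ℂ, Cn n) ω M] (h : KahlerMetric n M) {e : OpenPartialHomeomorph M (Cn n)}
  {g : ℂ → M}

theorem eventually_mWirt (he : e ∈ IsManifold.maximalAtlas 𝓘(ℂ, Cn n) ω M)
    (hg : ContMDiff 𝓘(ℝ, ℂ) 𝓘(ℝ, Cn n) ∞ g) {w : ℂ} (hx : g w ∈ e.source) :
    ∀ᶠ y in 𝓝 w, mWirt (n := n) g y = frame e (e (g y)) (wirt (fun y => e (g y)) y) := by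
  filter_upwards [hg.continuous.continuousAt.eventually (e.open_source.mem_nhds hx)] with y hy
  exact mWirt_eq he hg.contMDiffAt hy

theorem eventually_mWirtBar (he : e ∈ IsManifold.maximalAtlas 𝓘(ℂ, Cn n) ω M)
    (hg : ContMDiff 𝓘(ℝ, ℂ) 𝓘(ℝ, Cn n) ∞ g) {w : ℂ} (hx : g w ∈ e.source) :
    ∀ᶠ y in 𝓝 w, mWirtBar (n := n) g y = frame e (e (g y)) (wirtBar (fun y => e (g y)) y) := by
  filter_upwards [hg.continuous.continuousAt.eventually (e.open_source.mem_nhds hx)] with y hy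
  exact mWirtBar_eq he hg.contMDiffAt hy

theorem contDiff_pairing_mWirt (hg : ContMDiff 𝓘(ℝ, ℂ) 𝓘(ℝ, Cn n) ∞ g) :
    ContDiff ℝ ∞ fun w => pairing h (g w) (mWirt g w) (mWirt g w) := by
  rw [contDiff_iff_contDiffAt]
  intro w
  have he := IsManifold.chart_mem_maximalAtlas (I := 𝓘(ℂ, Cn n)) (n := ω) (g w)
  have hx := mem_chart_source (Cn n) (g w)
  have hZ := ContMDiffAt.contDiffAt_chart he hg.contMDiffAt hx
  exact contDiffAt_pairing h he hg.contMDiffAt hx (eventually_mWirt he hg hx)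
    (eventually_mWirt he hg hx) (contDiffAt_wirt hZ) (contDiffAt_wirt hZ)

theorem contDiff_pairing_mWirtBar (hg : ContMDiff 𝓘(ℝ, ℂ) 𝓘(ℝ, Cn n) ∞ g) :
    ContDiff ℝ ∞ fun w => pairing h (g w) (mWirtBar g w) (mWirtBar g w) := by
  rw [contDiff_iff_contDiffAt]
  intro w
  have he := IsManifold.chart_mem_maximalAtlas (I := 𝓘(ℂ, Cn n)) (n := ω) (g w)
  have hx := mem_chart_source (Cn n) (g w)
  have hZ := ContMDiffAt.contDiffAt_chart he hg.contMDiffAt hx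
  exact contDiffAt_pairing h he hg.contMDiffAt hx (eventually_mWirtBar he hg hx)
    (eventually_mWirtBar he hg hx) (contDiffAt_wirtBar hZ) (contDiffAt_wirtBar hZ)

theorem contDiff_hopf (hg : ContMDiff 𝓘(ℝ, ℂ) 𝓘(ℝ, Cn n) ∞ g) :
    ContDiff ℝ ∞ fun w => pairing h (g w) (mWirt g w) (mWirtBar g w) := by
  rw [contDiff_iff_contDiffAt]
  intro w
  have he := IsManifold.chart_mem_maximalAtlas (I := 𝓘(ℂ, Cn n)) (n := ω) (g w)
  have hx := mem_chart_source (Cn n) (g w)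
  have hZ := ContMDiffAt.contDiffAt_chart he hg.contMDiffAt hx
  exact contDiffAt_pairing h he hg.contMDiffAt hx (eventually_mWirt he hg hx)
    (eventually_mWirtBar he hg hx) (contDiffAt_wirt hZ) (contDiffAt_wirtBar hZ)

theorem continuous_densW (hg : ContMDiff 𝓘(ℝ, ℂ) 𝓘(ℝ, Cn n) ∞ g) : Continuous (densW h g) :=
  continuous_re.comp (contDiff_pairing_mWirt h hg).continuous

theorem continuous_densBar (hg : ContMDiff 𝓘(ℝ, ℂ) 𝓘(ℝ, Cn n) ∞ g) : Continuous (densBar h g) :=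
  continuous_re.comp (contDiff_pairing_mWirtBar h hg).continuous

end Maps

/-! ### Densities and their first variation along a two-parameter family -/

section Families

variable {n : ℕ} {M : Type*} [TopologicalSpace M] [ChartedSpace (Cn n) M]
  [IsManifold 𝓘(ℂ, Cn n) ω M] (h : KahlerMetric n M) {e : OpenPartialHomeomorph M (Cn n)}
  {F : ℂ × ℂ → M} {x : ℂ × ℂ}

/-- The velocity of a family of maps in the direction `ξ` of the parameter. -/
noncomputable def velocity (F : ℂ × ℂ → M) (ξ : ℂ) (x : ℂ × ℂ) : Cn n :=
  mfderiv 𝓘(ℝ, ℂ × ℂ) 𝓘(ℝ, Cn n) F x (ξ, 0)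

/-- A family of maps is smooth near a point. -/
def SmoothNear (n : ℕ) {M : Type*} [TopologicalSpace M] [ChartedSpace (Cn n) M] (F : ℂ × ℂ → M) (x : ℂ × ℂ) : Prop :=
  ∀ᶠ y in 𝓝 x, ContMDiffAt 𝓘(ℝ, ℂ × ℂ) 𝓘(ℝ, Cn n) ∞ F y

omit [IsManifold 𝓘(ℂ, Cn n) ω M] in
theorem contMDiffAt_slice {t w : ℂ} (hF : ContMDiffAt 𝓘(ℝ, ℂ × ℂ) 𝓘(ℝ, Cn n) ∞ F (t, w)) :
    ContMDiffAt 𝓘(ℝ, ℂ) 𝓘(ℝ, Cn n) ∞ (fun y => F (t, y)) w :=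
  ContMDiffAt.comp (f := fun y : ℂ => (t, y)) w hF (contDiff_prodMk_right t).contMDiff.contMDiffAt

omit [IsManifold 𝓘(ℂ, Cn n) ω M] in
theorem contMDiffAt_slice_left {t w : ℂ} (hF : ContMDiffAt 𝓘(ℝ, ℂ × ℂ) 𝓘(ℝ, Cn n) ∞ F (t, w)) :
    ContMDiffAt 𝓘(ℝ, ℂ) 𝓘(ℝ, Cn n) ∞ (fun s => F (s, w)) t :=
  ContMDiffAt.comp (f := fun s : ℂ => (s, w)) t hF (contDiff_prodMk_left w).contMDiff.contMDiffAt

theorem SmoothNear.eventually_wirt (he : e ∈ IsManifold.maximalAtlas 𝓘(ℂ, Cn n) ω M)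
    (hF : SmoothNear n F x) (hx : F x ∈ e.source) :
    ∀ᶠ y in 𝓝 x, mWirt (n := n) (fun z => F (y.1, z)) y.2 =
      frame e (e (F y)) (sndWirt (fun y => e (F y)) y) := by
  filter_upwards [hF, hF.self_of_nhds.continuousAt.eventually (e.open_source.mem_nhds hx)]
    with y h1 h2
  exact mWirt_eq he (contMDiffAt_slice h1) h2

theorem SmoothNear.eventually_wirtBar (he : e ∈ IsManifold.maximalAtlas 𝓘(ℂ, Cn n) ω M)
    (hF : SmoothNear n F x) (hx : F x ∈ e.source) :
    ∀ᶠ y in 𝓝 x, mWirtBar (n := n) (fun z => F (y.1, z)) y.2 =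
      frame e (e (F y)) (sndWirtBar (fun y => e (F y)) y) := by
  filter_upwards [hF, hF.self_of_nhds.continuousAt.eventually (e.open_source.mem_nhds hx)]
    with y h1 h2
  exact mWirtBar_eq he (contMDiffAt_slice h1) h2

theorem velocity_eq (he : e ∈ IsManifold.maximalAtlas 𝓘(ℂ, Cn n) ω M)
    (hF : ContMDiffAt 𝓘(ℝ, ℂ × ℂ) 𝓘(ℝ, Cn n) ∞ F x) (hx : F x ∈ e.source) (ξ : ℂ) :
    velocity (n := n) F ξ x = frame e (e (F x)) (fderiv ℝ (fun y => e (F y)) x (ξ, 0)) :=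
  mfderiv_real_apply_eq he hF hx _

theorem SmoothNear.eventually_velocity (he : e ∈ IsManifold.maximalAtlas 𝓘(ℂ, Cn n) ω M)
    (hF : SmoothNear n F x) (hx : F x ∈ e.source) (ξ : ℂ) :
    ∀ᶠ y in 𝓝 x, velocity (n := n) F ξ y = frame e (e (F y)) (fderiv ℝ (fun y => e (F y)) y (ξ, 0)) := by
  filter_upwards [hF, hF.self_of_nhds.continuousAt.eventually (e.open_source.mem_nhds hx)]
    with y h1 h2
  exact velocity_eq he h1 h2 ξ

/-- The density of the `∂/∂w` part along a family. -/
noncomputable def famW (h : KahlerMetric n M) (F : ℂ × ℂ → M) (x : ℂ × ℂ) : ℝ :=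
  densW h (fun z => F (x.1, z)) x.2

/-- The density of the `∂/∂w̄` part along a family. -/
noncomputable def famBar (h : KahlerMetric n M) (F : ℂ × ℂ → M) (x : ℂ × ℂ) : ℝ :=
  densBar h (fun z => F (x.1, z)) x.2

theorem famW_eventuallyEq (he : e ∈ IsManifold.maximalAtlas 𝓘(ℂ, Cn n) ω M) (hF : SmoothNear n F x)
    (hx : F x ∈ e.source) : famW h F =ᶠ[𝓝 x] fun y => (hf (metricCoeff h.form e) (e (F y))
      (sndWirt (fun y => e (F y)) y) (sndWirt (fun y => e (F y)) y)).re := by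
  filter_upwards [pairing_eventuallyEq h hF.self_of_nhds.continuousAt hx (hF.eventually_wirt he hx)
    (hF.eventually_wirt he hx)] with y hy
  exact congrArg Complex.re hy

theorem famBar_eventuallyEq (he : e ∈ IsManifold.maximalAtlas 𝓘(ℂ, Cn n) ω M) (hF : SmoothNear n F x)
    (hx : F x ∈ e.source) : famBar h F =ᶠ[𝓝 x] fun y => (hf (metricCoeff h.form e) (e (F y))
      (sndWirtBar (fun y => e (F y)) y) (sndWirtBar (fun y => e (F y)) y)).re := by
  filter_upwards [pairing_eventuallyEq h hF.self_of_nhds.continuousAt hx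
    (hF.eventually_wirtBar he hx) (hF.eventually_wirtBar he hx)] with y hy
  exact congrArg Complex.re hy

section Chart

variable (he : e ∈ IsManifold.maximalAtlas 𝓘(ℂ, Cn n) ω M) (hF : SmoothNear n F x)
  (hx : F x ∈ e.source)

include he hF hx

theorem contDiffAt_hf_sndWirt : ContDiffAt ℝ ∞ (fun y => hf (metricCoeff h.form e) (e (F y))
      (sndWirt (fun y => e (F y)) y) (sndWirt (fun y => e (F y)) y)) x := by
  have hZ := ContMDiffAt.contDiffAt_chart he hF.self_of_nhds hx
  exact contDiffAt_hf (fun α β => (h.localKahler he).contDiffAt (e.map_source hx) α β) hZ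
    (contDiffAt_sndWirt hZ) (contDiffAt_sndWirt hZ)

theorem contDiffAt_hf_sndWirtBar : ContDiffAt ℝ ∞ (fun y => hf (metricCoeff h.form e) (e (F y))
      (sndWirtBar (fun y => e (F y)) y) (sndWirtBar (fun y => e (F y)) y)) x := by
  have hZ := ContMDiffAt.contDiffAt_chart he hF.self_of_nhds hx
  exact contDiffAt_hf (fun α β => (h.localKahler he).contDiffAt (e.map_source hx) α β) hZ
    (contDiffAt_sndWirtBar hZ) (contDiffAt_sndWirtBar hZ)

theorem fderiv_famW (v : ℂ × ℂ) : fderiv ℝ (famW h F) x v =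
    (fderiv ℝ (fun y => hf (metricCoeff h.form e) (e (F y))
      (sndWirt (fun y => e (F y)) y) (sndWirt (fun y => e (F y)) y)) x v).re := by
  rw [(famW_eventuallyEq h he hF hx).fderiv_eq,
    re_fderiv ((contDiffAt_hf_sndWirt h he hF hx).differentiableAt (by simp))]

theorem fderiv_famBar (v : ℂ × ℂ) : fderiv ℝ (famBar h F) x v =
    (fderiv ℝ (fun y => hf (metricCoeff h.form e) (e (F y))
      (sndWirtBar (fun y => e (F y)) y) (sndWirtBar (fun y => e (F y)) y)) x v).re := by
  rw [(famBar_eventuallyEq h he hF hx).fderiv_eq,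
    re_fderiv ((contDiffAt_hf_sndWirtBar h he hF hx).differentiableAt (by simp))]

end Chart

theorem contDiffAt_famW (hF : SmoothNear n F x) : ContDiffAt ℝ ∞ (famW h F) x := by
  have he := IsManifold.chart_mem_maximalAtlas (I := 𝓘(ℂ, Cn n)) (n := ω) (F x)
  have hx := mem_chart_source (Cn n) (F x)
  exact (reCLM.contDiff.contDiffAt.comp x (contDiffAt_hf_sndWirt h he hF hx)).congr_of_eventuallyEq
    (famW_eventuallyEq h he hF hx)

theorem contDiffAt_famBar (hF : SmoothNear n F x) : ContDiffAt ℝ ∞ (famBar h F) x := by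
  have he := IsManifold.chart_mem_maximalAtlas (I := 𝓘(ℂ, Cn n)) (n := ω) (F x)
  have hx := mem_chart_source (Cn n) (F x)
  exact (reCLM.contDiff.contDiffAt.comp x
    (contDiffAt_hf_sndWirtBar h he hF hx)).congr_of_eventuallyEq (famBar_eventuallyEq h he hF hx)

/-- The pairing of the `∂/∂w` derivative with the velocity. -/
noncomputable def velW (h : KahlerMetric n M) (F : ℂ × ℂ → M) (ξ : ℂ) (x : ℂ × ℂ) : ℂ :=
  pairing h (F x) (mWirt (fun z => F (x.1, z)) x.2) (velocity F ξ x)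

/-- The pairing of the `∂/∂w̄` derivative with the velocity. -/
noncomputable def velBar (h : KahlerMetric n M) (F : ℂ × ℂ → M) (ξ : ℂ) (x : ℂ × ℂ) : ℂ :=
  pairing h (F x) (mWirtBar (fun z => F (x.1, z)) x.2) (velocity F ξ x)

theorem contDiffAt_velW (hF : SmoothNear n F x) (ξ : ℂ) : ContDiffAt ℝ ∞ (velW h F ξ) x := by
  have he := IsManifold.chart_mem_maximalAtlas (I := 𝓘(ℂ, Cn n)) (n := ω) (F x)
  have hx := mem_chart_source (Cn n) (F x)
  have hZ := ContMDiffAt.contDiffAt_chart he hF.self_of_nhds hx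
  exact contDiffAt_pairing h he hF.self_of_nhds hx (hF.eventually_wirt he hx)
    (hF.eventually_velocity he hx ξ) (contDiffAt_sndWirt hZ) (hZ.contDiffAt_fderiv_apply _)

theorem contDiffAt_velBar (hF : SmoothNear n F x) (ξ : ℂ) : ContDiffAt ℝ ∞ (velBar h F ξ) x := by
  have he := IsManifold.chart_mem_maximalAtlas (I := 𝓘(ℂ, Cn n)) (n := ω) (F x)
  have hx := mem_chart_source (Cn n) (F x)
  have hZ := ContMDiffAt.contDiffAt_chart he hF.self_of_nhds hx
  exact contDiffAt_pairing h he hF.self_of_nhds hx (hF.eventually_wirtBar he hx)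
    (hF.eventually_velocity he hx ξ) (contDiffAt_sndWirtBar hZ) (hZ.contDiffAt_fderiv_apply _)

theorem velW_slice_eventuallyEq (he : e ∈ IsManifold.maximalAtlas 𝓘(ℂ, Cn n) ω M) {t w : ℂ}
    (hF : SmoothNear n F (t, w)) (hx : F (t, w) ∈ e.source) (ξ : ℂ) :
    (fun y => velW h F ξ (t, y)) =ᶠ[𝓝 w] fun y => hf (metricCoeff h.form e) (e (F (t, y)))
      (sndWirt (fun y => e (F y)) (t, y)) (fderiv ℝ (fun y => e (F y)) (t, y) (ξ, 0)) :=
  ((Continuous.prodMk_right t).tendsto w).eventually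
    (pairing_eventuallyEq h hF.self_of_nhds.continuousAt hx (hF.eventually_wirt he hx)
      (hF.eventually_velocity he hx ξ))

theorem velBar_slice_eventuallyEq (he : e ∈ IsManifold.maximalAtlas 𝓘(ℂ, Cn n) ω M) {t w : ℂ}
    (hF : SmoothNear n F (t, w)) (hx : F (t, w) ∈ e.source) (ξ : ℂ) :
    (fun y => velBar h F ξ (t, y)) =ᶠ[𝓝 w] fun y => hf (metricCoeff h.form e) (e (F (t, y)))
      (sndWirtBar (fun y => e (F y)) (t, y)) (fderiv ℝ (fun y => e (F y)) (t, y) (ξ, 0)) :=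
  ((Continuous.prodMk_right t).tendsto w).eventually
    (pairing_eventuallyEq h hF.self_of_nhds.continuousAt hx (hF.eventually_wirtBar he hx)
      (hF.eventually_velocity he hx ξ))

/-- The difference of the two densities varies by a divergence. -/
theorem fderiv_famW_sub_famBar {t w : ℂ} (hF : SmoothNear n F (t, w)) (ξ : ℂ) :
    fderiv ℝ (famW h F) (t, w) (ξ, 0) - fderiv ℝ (famBar h F) (t, w) (ξ, 0) =
      2 * ((wirtBar (fun y => velW h F ξ (t, y)) w).re
        - (wirt (fun y => velBar h F ξ (t, y)) w).re) := by
  have he := IsManifold.chart_mem_maximalAtlas (I := 𝓘(ℂ, Cn n)) (n := ω) (F (t, w))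
  have hx := mem_chart_source (Cn n) (F (t, w))
  have hZ := ContMDiffAt.contDiffAt_chart he hF.self_of_nhds hx
  rw [fderiv_famW h he hF hx, fderiv_famBar h he hF hx, ← sub_re,
    (h.localKahler he).fderiv_hf_sub hZ ((chartAt (Cn n) (F (t, w))).map_source hx), sub_re,
    wirtBar_congr (velW_slice_eventuallyEq h he hF hx ξ),
    wirt_congr (velBar_slice_eventuallyEq h he hF hx ξ)]

/-- The first variation of the density of the `∂/∂w̄` part. -/
theorem fderiv_famBar_eq (he : e ∈ IsManifold.maximalAtlas 𝓘(ℂ, Cn n) ω M) {t w : ℂ}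
    (hF : SmoothNear n F (t, w)) (hx : F (t, w) ∈ e.source) (ξ : ℂ) :
    fderiv ℝ (famBar h F) (t, w) (ξ, 0) = 2 * ((wirt (fun y => velBar h F ξ (t, y)) w).re
      - (tension (metricCoeff h.form e) (fun y => e (F (t, y))) w
          (fderiv ℝ (fun y => e (F y)) (t, w) (ξ, 0))).re) := by
  have hZ := ContMDiffAt.contDiffAt_chart he hF.self_of_nhds hx
  rw [fderiv_famBar h he hF hx, (h.localKahler he).fderiv_hf_bar hZ (e.map_source hx), sub_re,
    wirt_congr (velBar_slice_eventuallyEq h he hF hx ξ)]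
  rfl

theorem velocity_eq_zero {t w : ℂ} (hF : SmoothNear n F (t, w))
    (hc : ∀ᶠ s in 𝓝 t, F (s, w) = F (t, w)) (ξ : ℂ) : velocity (n := n) F ξ (t, w) = 0 := by
  have he := IsManifold.chart_mem_maximalAtlas (I := 𝓘(ℂ, Cn n)) (n := ω) (F (t, w))
  have hx := mem_chart_source (Cn n) (F (t, w))
  have hZ := ContMDiffAt.contDiffAt_chart he hF.self_of_nhds hx
  have h0 : (fun s => chartAt (Cn n) (F (t, w)) (F (s, w))) =ᶠ[𝓝 t]
      fun _ => chartAt (Cn n) (F (t, w)) (F (t, w)) := by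
    filter_upwards [hc] with s hs
    rw [hs]
  rw [velocity_eq he hF.self_of_nhds hx,
    ← fderiv_slice_left (F := fun y => chartAt (Cn n) (F (t, w)) (F y))
      (hZ.differentiableAt (by simp)), h0.fderiv_eq]
  simp

end Families

/-! ### Variations which are holomorphic in the parameter -/

section Variations

variable {n : ℕ} {M : Type*} [TopologicalSpace M] [ChartedSpace (Cn n) M]

/-- A smooth family `F (t, ·)`, `|t| < r`, of maps with `F (0, ·) = g`, constant in `t` off the
compact set `K`, holomorphic in `t`, and with velocity `X` at `t = 0`. -/
structure IsVariation (g : ℂ → M) (F : ℂ × ℂ → M) (r : ℝ) (K : Set ℂ) (X : ℂ → Cn n) : Prop where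
  pos : 0 < r
  isCompact : IsCompact K
  smooth : ∀ x : ℂ × ℂ, x.1 ∈ Metric.ball (0 : ℂ) r → ContMDiffAt 𝓘(ℝ, ℂ × ℂ) 𝓘(ℝ, Cn n) ∞ F x
  zero : ∀ w, F (0, w) = g w
  off : ∀ t, ∀ w ∉ K, F (t, w) = g w
  hol : ∀ t ∈ Metric.ball (0 : ℂ) r, ∀ w,
    MDifferentiableAt 𝓘(ℂ, ℂ) 𝓘(ℂ, Cn n) (fun t => F (t, w)) t
  vel : ∀ w, mWirt (fun t => F (t, w)) 0 = X w

theorem mWirt_const (x : M) (w : ℂ) : mWirt (n := n) (fun _ => x) w = 0 := by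
  have : realD (n := n) (fun _ : ℂ => x) w = 0 := mfderiv_const
  simp [mWirt, this]

theorem IsVariation.const {g : ℂ → M} (hg : ContMDiff 𝓘(ℝ, ℂ) 𝓘(ℝ, Cn n) ∞ g) {K : Set ℂ}
    (hK : IsCompact K) : IsVariation g (fun x => g x.2) 1 K (0 : ℂ → Cn n) where
  pos := one_pos
  isCompact := hK
  smooth x _ := ContMDiffAt.comp (g := g) (f := fun x : ℂ × ℂ => x.2) x hg.contMDiffAt
    (contDiff_snd.contMDiff.contMDiffAt)
  zero _ := rfl
  off _ _ _ := rfl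
  hol t _ w := mdifferentiableAt_const (c := g w) (x := t)
  vel w := mWirt_const (g w) 0

theorem wirt_smul_const {E : Type*} [NormedAddCommGroup E] [NormedSpace ℂ E] (c : E) (w : ℂ) :
    wirt (fun s : ℂ => s • c) w = c := by
  have h : HasFDerivAt (fun s : ℂ => s • c) ((ContinuousLinearMap.id ℝ ℂ).smulRight c) w :=
    (hasFDerivAt_id w).smul_const c
  rw [wirt, h.fderiv]
  simp [smul_smul, ← two_smul ℂ c]

variable [IsManifold 𝓘(ℂ, Cn n) ω M] {e : OpenPartialHomeomorph M (Cn n)} {g : ℂ → M}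
  {F : ℂ × ℂ → M} {r : ℝ} {K : Set ℂ} {X : ℂ → Cn n}

theorem IsVariation.smoothNear (hF : IsVariation g F r K X) {x : ℂ × ℂ}
    (hx : x.1 ∈ Metric.ball (0 : ℂ) r) : SmoothNear n F x := by
  filter_upwards [(Metric.isOpen_ball.preimage continuous_fst).mem_nhds hx] with y hy
  exact hF.smooth y hy

/-- In the chart `e` the term `t Y(w)` is added to the given family. This is affine in `t`, so
holomorphy in `t` is preserved and the velocities at `t = 0` add up; the radius may have to shrink
to stay inside the chart. -/
theorem IsVariation.add_chart (hF : IsVariation g F r K X)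
    (he : e ∈ IsManifold.maximalAtlas 𝓘(ℂ, Cn n) ω M) {Y : ℂ → Cn n} (hY : ContDiff ℝ ∞ Y)
    (hYc : HasCompactSupport Y) (hYs : tsupport Y ⊆ g ⁻¹' e.source) (hYK : tsupport Y ⊆ K) :
    ∃ F' r', IsVariation g F' r' K (fun w => X w + frame e (e (g w)) (Y w)) := by
  classical
  have hpoint : ∀ x : ℂ × ℂ, x.1 ∈ Metric.ball (0 : ℂ) r → F x ∈ e.source →
      ContDiffAt ℝ ∞ (fun x => e (F x) + x.1 • Y x.2) x := fun x hx hs =>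
    (ContMDiffAt.contDiffAt_chart he (hF.smooth x hx) hs).add
      (contDiffAt_fst.smul (hY.contDiffAt.comp x contDiffAt_snd))
  have hgood : ∀ x : ℂ × ℂ, x.1 ∈ Metric.ball (0 : ℂ) r → F x ∈ e.source →
      e (F x) + x.1 • Y x.2 ∈ e.target → ∀ᶠ y in 𝓝 x,
        F y ∈ e.source ∧ e (F y) + y.1 • Y y.2 ∈ e.target := fun x hx hs ht =>
    ((hF.smooth x hx).continuousAt.eventually (e.open_source.mem_nhds hs)).and
      ((hpoint x hx hs).continuousAt.eventually (e.open_target.mem_nhds ht))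
  have h0 : (0 : ℂ) ∈ Metric.ball (0 : ℂ) r := Metric.mem_ball_self hF.pos
  -- Compactness of the support of `Y` gives one radius in `t` that works for all `w`.
  have htube : ∀ᶠ t in 𝓝 (0 : ℂ), ∀ w ∈ tsupport Y,
      F (t, w) ∈ e.source ∧ e (F (t, w)) + t • Y w ∈ e.target := by
    refine IsCompact.eventually_forall_of_forall_eventually hYc fun w hw => ?_
    have hs : F (0, w) ∈ e.source := by rw [hF.zero]; exact hYs hw
    exact hgood (0, w) h0 hs (by simpa using e.map_source hs)
  obtain ⟨r₁, hr₁, htube⟩ := Metric.eventually_nhds_iff_ball.1 htube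
  have hsub : ∀ {t : ℂ}, t ∈ Metric.ball (0 : ℂ) (min r r₁) → t ∈ Metric.ball (0 : ℂ) r := fun ht =>
    Metric.ball_subset_ball (min_le_left _ _) ht
  have hsub' : ∀ {t : ℂ}, t ∈ Metric.ball (0 : ℂ) (min r r₁) → t ∈ Metric.ball (0 : ℂ) r₁ := fun ht =>
    Metric.ball_subset_ball (min_le_right _ _) ht
  set F' : ℂ × ℂ → M := fun x =>
    if x.2 ∈ tsupport Y then e.symm (e (F x) + x.1 • Y x.2) else F x with hF'
  -- Off the support the added term is zero, so the two branches of `F'` agree wherever `F` lies in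
  -- the chart; this gives smoothness across the boundary of the support.
  have hFs : ∀ x : ℂ × ℂ, F x ∈ e.source → F' x = e.symm (e (F x) + x.1 • Y x.2) := by
    intro x hx
    by_cases hw : x.2 ∈ tsupport Y
    · simp only [hF', if_pos hw]
    · simp only [hF', if_neg hw, image_eq_zero_of_notMem_tsupport hw, smul_zero, add_zero]
      exact (e.left_inv hx).symm
  have hsmooth : ∀ x : ℂ × ℂ, x.1 ∈ Metric.ball (0 : ℂ) (min r r₁) →
      ContMDiffAt 𝓘(ℝ, ℂ × ℂ) 𝓘(ℝ, Cn n) ∞ F' x := by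
    intro x hx
    by_cases hw : x.2 ∈ tsupport Y
    · obtain ⟨hs, ht⟩ := htube x.1 (hsub' hx) x.2 hw
      have hc := ContMDiffAt.comp (g := e.symm) (f := fun x => e (F x) + x.1 • Y x.2) x
        (contMDiffAt_symm_of_mem_maximalAtlas (mem_maximalAtlas_real he) ht)
        (hpoint x (hsub hx) hs).contMDiffAt
      refine hc.congr_of_eventuallyEq ?_
      filter_upwards [hgood x (hsub hx) hs ht] with y hy
      exact hFs y hy.1
    · refine (hF.smooth x (hsub hx)).congr_of_eventuallyEq ?_
      filter_upwards [((isClosed_tsupport Y).isOpen_compl.preimage continuous_snd).mem_nhds hw]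
        with y hy
      exact if_neg hy
  have hzero : ∀ w, F' (0, w) = g w := by
    intro w
    by_cases hw : w ∈ tsupport Y
    · simp only [hF', if_pos hw, zero_smul, add_zero, hF.zero]
      exact e.left_inv (hYs hw)
    · simp only [hF', if_neg hw, hF.zero]
  refine ⟨F', min r r₁, ⟨lt_min hF.pos hr₁, hF.isCompact, hsmooth, hzero, ?_, ?_, ?_⟩⟩
  · intro t w hw
    have : w ∉ tsupport Y := fun h => hw (hYK h)
    simp only [hF', if_neg this, hF.off t w hw]
  · intro t ht w
    by_cases hw : w ∈ tsupport Y
    · obtain ⟨hs, htt⟩ := htube t (hsub' ht) w hw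
      have h1 : MDifferentiableAt 𝓘(ℂ, ℂ) 𝓘(ℂ, Cn n) (fun t => e (F (t, w))) t :=
        MDifferentiableAt.comp (f := fun t => F (t, w)) t
          ((contMDiffAt_of_mem_maximalAtlas he hs).mdifferentiableAt (by simp))
          (hF.hol t (hsub ht) w)
      have h2 : DifferentiableAt ℂ (fun t => e (F (t, w)) + t • Y w) t :=
        h1.differentiableAt.add (differentiableAt_id.smul_const _)
      have h3 : MDifferentiableAt 𝓘(ℂ, ℂ) 𝓘(ℂ, Cn n)
          (fun t => e.symm (e (F (t, w)) + t • Y w)) t :=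
        MDifferentiableAt.comp (g := e.symm) (f := fun t => e (F (t, w)) + t • Y w) t
          ((contMDiffAt_symm_of_mem_maximalAtlas he htt).mdifferentiableAt (by simp))
          h2.mdifferentiableAt
      simpa only [hF', if_pos hw] using h3
    · simpa only [hF', if_neg hw] using hF.hol t (hsub ht) w
  · intro w
    by_cases hw : w ∈ tsupport Y
    · have hs : F (0, w) ∈ e.source := by rw [hF.zero]; exact hYs hw
      have hs' : F' (0, w) ∈ e.source := by rw [hzero]; exact hYs hw
      have ht : e (F (0, w)) + (0 : ℂ) • Y w ∈ e.target := by
        rw [zero_smul, add_zero]; exact e.map_source hs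
      rw [mWirt_eq he (contMDiffAt_slice_left (hsmooth (0, w)
        (Metric.mem_ball_self (lt_min hF.pos hr₁)))) hs', ← hF.vel w,
        mWirt_eq he (contMDiffAt_slice_left (hF.smooth (0, w) h0)) hs, hzero, hF.zero, ← map_add]
      congr 1
      have hev : (fun t => e (F' (t, w))) =ᶠ[𝓝 0] fun t => e (F (t, w)) + t • Y w := by
        filter_upwards [((Continuous.prodMk_left w).tendsto 0).eventually
          (hgood (0, w) h0 hs ht)] with t ht
        rw [hFs _ ht.1]
        exact e.right_inv ht.2
      have hd : DifferentiableAt ℝ (fun t => e (F (t, w))) 0 :=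
        (contDiffAt_slice_left (F := fun x => e (F x))
          (ContMDiffAt.contDiffAt_chart he (hF.smooth (0, w) h0) hs)).differentiableAt (by simp)
      rw [wirt_congr hev, wirt_add hd (by fun_prop), wirt_smul_const]
    · have : (fun t => F' (t, w)) = fun t => F (t, w) := by
        funext t; simp only [hF', if_neg hw]
      rw [this, hF.vel, image_eq_zero_of_notMem_tsupport hw, map_zero, add_zero]

/-- A variation whose velocity is a compactly supported vector field in the domain of a chart. -/
theorem exists_variation_chart (hg : ContMDiff 𝓘(ℝ, ℂ) 𝓘(ℝ, Cn n) ∞ g)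
    (he : e ∈ IsManifold.maximalAtlas 𝓘(ℂ, Cn n) ω M) {Y : ℂ → Cn n} (hY : ContDiff ℝ ∞ Y)
    (hYc : HasCompactSupport Y) (hYs : tsupport Y ⊆ g ⁻¹' e.source) :
    ∃ F r, IsVariation g F r (tsupport Y) (fun w => frame e (e (g w)) (Y w)) := by
  obtain ⟨F, r, hF⟩ := (IsVariation.const hg hYc).add_chart he hY hYc hYs le_rfl
  exact ⟨F, r, by simpa using hF⟩

/-- A variation in the direction of a compactly supported multiple of `g_*(∂/∂w)`. -/
theorem exists_variation_smul (hg : ContMDiff 𝓘(ℝ, ℂ) 𝓘(ℝ, Cn n) ∞ g) {φ : ℂ → ℂ}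
    (hφ : ContDiff ℝ ∞ φ) (hφc : HasCompactSupport φ) :
    ∃ F r, IsVariation g F r (tsupport φ) (fun w => φ w • mWirt (n := n) g w) := by
  classical
  obtain ⟨s, -, hs⟩ := hφc.elim_nhds_subcover (fun w => g ⁻¹' (chartAt (Cn n) (g w)).source)
    fun w _ => hg.continuous.continuousAt.preimage_mem_nhds
      ((chartAt (Cn n) (g w)).open_source.mem_nhds (mem_chart_source _ _))
  obtain ⟨ρ, hρ⟩ := SmoothPartitionOfUnity.exists_isSubordinate 𝓘(ℝ, ℂ) (isClosed_tsupport φ)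
    (fun i : s => g ⁻¹' (chartAt (Cn n) (g i)).source)
    (fun i => (chartAt (Cn n) (g i)).open_source.preimage hg.continuous)
    (by
      intro w hw
      obtain ⟨i, hi, hwi⟩ := Set.mem_iUnion₂.1 (hs hw)
      exact Set.mem_iUnion.2 ⟨⟨i, hi⟩, hwi⟩)
  have hsum : ∀ w, ∑ i : s, (ρ i w : ℂ) * φ w = φ w := by
    intro w
    rw [← Finset.sum_mul]
    by_cases hw : w ∈ tsupport φ
    · have h1 := ρ.sum_eq_one hw
      rw [finsum_eq_sum_of_fintype] at h1
      rw [← Complex.ofReal_sum, h1, Complex.ofReal_one, one_mul]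
    · rw [image_eq_zero_of_notMem_tsupport hw, mul_zero]
  -- A partition of unity cuts `φ g_*(∂/∂w)` into pieces, each living in a single chart. They are
  -- then added to the family one after another, which replaces an exponential map and keeps the
  -- dependence on `t` holomorphic.
  set Y : s → ℂ → Cn n := fun i w =>
    ((ρ i w : ℂ) * φ w) • wirt (fun y => chartAt (Cn n) (g i) (g y)) w with hYdef
  have hYφ : ∀ i, tsupport (Y i) ⊆ tsupport φ := fun i =>
    closure_mono fun w hw h0 => hw (by simp [hYdef, Function.notMem_support.1 (by simpa using h0)])
  have hYρ : ∀ i, tsupport (Y i) ⊆ tsupport (ρ i) := fun i =>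
    closure_mono fun w hw h0 => hw (by simp [hYdef, show ρ i w = 0 by simpa using h0])
  have hYU : ∀ i, tsupport (Y i) ⊆ g ⁻¹' (chartAt (Cn n) (g i)).source := fun i =>
    (hYρ i).trans (hρ i)
  have hatlas : ∀ i : s, chartAt (Cn n) (g i) ∈ IsManifold.maximalAtlas 𝓘(ℂ, Cn n) ω M := fun i =>
    IsManifold.chart_mem_maximalAtlas _
  have hYsm : ∀ i, ContDiff ℝ ∞ (Y i) := by
    intro i
    refine (contMDiff_of_tsupport (I := 𝓘(ℝ, ℂ)) (I' := 𝓘(ℝ, Cn n))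
      fun w hw => ContDiffAt.contMDiffAt ?_).contDiff
    have hZ := ContMDiffAt.contDiffAt_chart (hatlas i) hg.contMDiffAt (hYU i hw)
    have hρs : ContDiff ℝ ∞ (ρ i) := (ρ i).contMDiff.contDiff
    exact ((ofRealCLM.contDiff.contDiffAt.comp w hρs.contDiffAt).mul hφ.contDiffAt).smul
      (contDiffAt_wirt hZ)
  have key : ∀ T : Finset s, ∃ F r, IsVariation g F r (tsupport φ)
      (fun w => ∑ i ∈ T, frame (chartAt (Cn n) (g i)) (chartAt (Cn n) (g i) (g w)) (Y i w)) := by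
    intro T
    induction T using Finset.induction_on with
    | empty =>
      refine ⟨fun x => g x.2, 1, ?_⟩
      simp only [Finset.sum_empty]
      exact IsVariation.const hg hφc
    | insert i T hi ih =>
      obtain ⟨F, r, hF⟩ := ih
      obtain ⟨F', r', hF'⟩ := hF.add_chart (hatlas i) (hYsm i)
        (HasCompactSupport.of_support_subset_isCompact hφc (subset_closure.trans (hYφ i))) (hYU i)
        (hYφ i)
      refine ⟨F', r', ?_⟩
      simp only [Finset.sum_insert hi]
      simpa only [add_comm] using hF'
  obtain ⟨F, r, hF⟩ := key Finset.univ
  refine ⟨F, r, ?_⟩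
  convert hF using 2 with w
  rw [← hsum w, Finset.sum_smul]
  refine Finset.sum_congr rfl fun i _ => ?_
  by_cases hw : w ∈ tsupport (ρ i)
  · rw [hYdef, map_smul, mWirt_eq (hatlas i) hg.contMDiffAt (hρ i hw)]
  · simp [hYdef, image_eq_zero_of_notMem_tsupport hw]

end Variations

/-! ### Smooth maps on the Riemann sphere in the two affine charts -/

section Sphere

theorem chartZero_mem_maximalAtlas : chartZero ∈ IsManifold.maximalAtlas 𝓘(ℂ, ℂ) ω P1 :=
  StructureGroupoid.subset_maximalAtlas _ (Set.mem_insert _ _)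

theorem chartInfty_mem_maximalAtlas : chartInfty ∈ IsManifold.maximalAtlas 𝓘(ℂ, ℂ) ω P1 :=
  StructureGroupoid.subset_maximalAtlas _ (Set.mem_insert_of_mem _ rfl)

theorem chartInfty_target : chartInfty.target = Set.univ := by
  simp [chartInfty]

theorem contMDiff_coe : ContMDiff 𝓘(ℝ, ℂ) 𝓘(ℝ, ℂ) ∞ ((↑) : ℂ → P1) := fun w =>
  contMDiffAt_symm_of_mem_maximalAtlas (mem_maximalAtlas_real chartZero_mem_maximalAtlas)
    (x := w) (by simp)

theorem contMDiff_invFun_coe : ContMDiff 𝓘(ℝ, ℂ) 𝓘(ℝ, ℂ) ∞ (fun w : ℂ => invFun (w : P1)) :=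
  fun w => contMDiffAt_symm_of_mem_maximalAtlas (mem_maximalAtlas_real chartInfty_mem_maximalAtlas)
    (x := w) (by simp [chartInfty_target])

theorem contMDiffAt_chartZero (w : ℂ) :
    ContMDiffAt 𝓘(ℝ, ℂ) 𝓘(ℝ, ℂ) ∞ chartZero (w : P1) :=
  contMDiffAt_of_mem_maximalAtlas (mem_maximalAtlas_real chartZero_mem_maximalAtlas) (by simp)

end Sphere

/-! ### Transformation under `w ↦ 1/w` and decay at infinity -/

section Inversion

theorem fderiv_comp_holomorphic {E : Type*} [NormedAddCommGroup E] [NormedSpace ℂ E] {Z : ℂ → E}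
    {τ : ℂ → ℂ} {w c : ℂ} (hZ : DifferentiableAt ℝ Z (τ w)) (hτ : HasDerivAt τ c w) (v : ℂ) :
    fderiv ℝ (fun y => Z (τ y)) w v = fderiv ℝ Z (τ w) (v * c) := by
  have h1 : HasFDerivAt τ _ w := hτ.hasFDerivAt.restrictScalars ℝ
  have h2 : HasFDerivAt (fun y => Z (τ y)) _ w := hZ.hasFDerivAt.comp w h1
  rw [h2.fderiv]
  simp

theorem wirt_comp_holomorphic {E : Type*} [NormedAddCommGroup E] [NormedSpace ℂ E] {Z : ℂ → E}
    {τ : ℂ → ℂ} {w c : ℂ} (hZ : DifferentiableAt ℝ Z (τ w)) (hτ : HasDerivAt τ c w) :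
    wirt (fun y => Z (τ y)) w = c • wirt Z (τ w) := by
  have hI : I * I = -1 := Complex.I_mul_I
  rw [wirt, fderiv_comp_holomorphic hZ hτ, fderiv_comp_holomorphic hZ hτ, fderiv_apply_eq_wirt,
    fderiv_apply_eq_wirt Z (τ w) (I * c)]
  simp only [one_mul, map_mul, conj_I, smul_sub, smul_add, smul_smul]
  linear_combination (norm := module) (-(1 / 2 : ℂ) * hI * c) • wirt Z (τ w)
    + ((1 / 2 : ℂ) * hI * conj c) • wirtBar Z (τ w)

theorem wirtBar_comp_holomorphic {E : Type*} [NormedAddCommGroup E] [NormedSpace ℂ E] {Z : ℂ → E}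
    {τ : ℂ → ℂ} {w c : ℂ} (hZ : DifferentiableAt ℝ Z (τ w)) (hτ : HasDerivAt τ c w) :
    wirtBar (fun y => Z (τ y)) w = conj c • wirtBar Z (τ w) := by
  have hI : I * I = -1 := Complex.I_mul_I
  rw [wirtBar, fderiv_comp_holomorphic hZ hτ, fderiv_comp_holomorphic hZ hτ, fderiv_apply_eq_wirt,
    fderiv_apply_eq_wirt Z (τ w) (I * c)]
  simp only [one_mul, map_mul, conj_I, smul_add, smul_smul]
  linear_combination (norm := module) ((1 / 2 : ℂ) * hI * c) • wirt Z (τ w)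
    - ((1 / 2 : ℂ) * hI * conj c) • wirtBar Z (τ w)

variable {n : ℕ} {M : Type*} [TopologicalSpace M] [ChartedSpace (Cn n) M]
  [IsManifold 𝓘(ℂ, Cn n) ω M] (h : KahlerMetric n M) {f : P1 → M}

section Smooth

variable (hf : ContMDiff 𝓘(ℝ, ℂ) 𝓘(ℝ, Cn n) ∞ f)
include hf

omit [IsManifold 𝓘(ℂ, Cn n) ω M] in
theorem contMDiff_affine : ContMDiff 𝓘(ℝ, ℂ) 𝓘(ℝ, Cn n) ∞ (fun w : ℂ => f w) :=
  hf.comp contMDiff_coe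

omit [IsManifold 𝓘(ℂ, Cn n) ω M] in
theorem contMDiff_affine_inv : ContMDiff 𝓘(ℝ, ℂ) 𝓘(ℝ, Cn n) ∞ (fun w : ℂ => f (invFun w)) :=
  hf.comp contMDiff_invFun_coe

omit hf [IsManifold 𝓘(ℂ, Cn n) ω M] in
theorem affine_eventuallyEq {w : ℂ} (hw : w ≠ 0) :
    (fun w : ℂ => f w) =ᶠ[𝓝 w] fun w => f (invFun ((w⁻¹ : ℂ) : P1)) := by
  filter_upwards [isOpen_ne.mem_nhds hw] with y hy
  rw [← invFun_coe hy, invFun_involutive]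

/-- Chain rule for `w ↦ 1/w`, whose derivative is `-w⁻²`. -/
theorem mWirt_affine {w : ℂ} (hw : w ≠ 0) : mWirt (n := n) (fun w : ℂ => f w) w =
    (-(w ^ 2)⁻¹) • mWirt (n := n) (fun w : ℂ => f (invFun w)) w⁻¹ := by
  have hk := contMDiff_affine_inv hf
  have he := IsManifold.chart_mem_maximalAtlas (I := 𝓘(ℂ, Cn n)) (n := ω) (f w)
  have hx := mem_chart_source (Cn n) (f w)
  have hwk : f (invFun ((w⁻¹ : ℂ) : P1)) = f w := (affine_eventuallyEq hw).self_of_nhds.symm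
  have hx' : f (invFun ((w⁻¹ : ℂ) : P1)) ∈ (chartAt (Cn n) (f w)).source := by rw [hwk]; exact hx
  have hev : (fun y : ℂ => chartAt (Cn n) (f w) (f y)) =ᶠ[𝓝 w]
      fun y => chartAt (Cn n) (f w) (f (invFun ((y⁻¹ : ℂ) : P1))) := by
    filter_upwards [affine_eventuallyEq (f := f) hw] with y hy
    rw [hy]
  rw [mWirt_eq he (contMDiff_affine hf).contMDiffAt hx, mWirt_eq he hk.contMDiffAt hx', hwk,
    wirt_congr hev, wirt_comp_holomorphic
      (Z := fun y : ℂ => chartAt (Cn n) (f w) (f (invFun y))) (τ := fun y => y⁻¹)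
      ((ContMDiffAt.contDiffAt_chart he hk.contMDiffAt hx').differentiableAt (by simp))
      (hasDerivAt_inv hw), map_smul]

theorem mWirtBar_affine {w : ℂ} (hw : w ≠ 0) : mWirtBar (n := n) (fun w : ℂ => f w) w =
    conj (-(w ^ 2)⁻¹) • mWirtBar (n := n) (fun w : ℂ => f (invFun w)) w⁻¹ := by
  have hk := contMDiff_affine_inv hf
  have he := IsManifold.chart_mem_maximalAtlas (I := 𝓘(ℂ, Cn n)) (n := ω) (f w)
  have hx := mem_chart_source (Cn n) (f w)
  have hwk : f (invFun ((w⁻¹ : ℂ) : P1)) = f w := (affine_eventuallyEq hw).self_of_nhds.symm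
  have hx' : f (invFun ((w⁻¹ : ℂ) : P1)) ∈ (chartAt (Cn n) (f w)).source := by rw [hwk]; exact hx
  have hev : (fun y : ℂ => chartAt (Cn n) (f w) (f y)) =ᶠ[𝓝 w]
      fun y => chartAt (Cn n) (f w) (f (invFun ((y⁻¹ : ℂ) : P1))) := by
    filter_upwards [affine_eventuallyEq (f := f) hw] with y hy
    rw [hy]
  rw [mWirtBar_eq he (contMDiff_affine hf).contMDiffAt hx, mWirtBar_eq he hk.contMDiffAt hx', hwk,
    wirtBar_congr hev, wirtBar_comp_holomorphic
      (Z := fun y : ℂ => chartAt (Cn n) (f w) (f (invFun y))) (τ := fun y => y⁻¹)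
      ((ContMDiffAt.contDiffAt_chart he hk.contMDiffAt hx').differentiableAt (by simp))
      (hasDerivAt_inv hw), map_smul]

/-- The density picks up `|w⁻²|²`. Since the density in the coordinate `1/w` is bounded near `0`,
the energy integral over the plane converges. -/
theorem densW_affine {w : ℂ} (hw : w ≠ 0) : densW h (fun w : ℂ => f w) w =
    (‖w‖ ^ 4)⁻¹ * densW h (fun w : ℂ => f (invFun w)) w⁻¹ := by
  have hwk : f (invFun ((w⁻¹ : ℂ) : P1)) = f w := (affine_eventuallyEq hw).self_of_nhds.symm
  rw [densW_eq_pairing, densW_eq_pairing, mWirt_affine hf hw, pairing_smul, hwk, mul_conj,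
    normSq_eq_norm_sq, re_ofReal_mul]
  congr 1
  simp
  ring

theorem densBar_affine {w : ℂ} (hw : w ≠ 0) : densBar h (fun w : ℂ => f w) w =
    (‖w‖ ^ 4)⁻¹ * densBar h (fun w : ℂ => f (invFun w)) w⁻¹ := by
  have hwk : f (invFun ((w⁻¹ : ℂ) : P1)) = f w := (affine_eventuallyEq hw).self_of_nhds.symm
  rw [densBar_eq_pairing, densBar_eq_pairing, mWirtBar_affine hf hw, pairing_smul, hwk, mul_conj,
    normSq_eq_norm_sq, re_ofReal_mul]
  congr 1
  simp
  ring

/-- The conjugate factor of `f_w̄` sits in the conjugate linear slot, so the total factor is the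
holomorphic `w⁻⁴`, as for a quadratic differential. -/
theorem hopf_affine {w : ℂ} (hw : w ≠ 0) :
    pairing h (f w) (mWirt (fun w : ℂ => f w) w) (mWirtBar (fun w : ℂ => f w) w) =
      (w⁻¹) ^ 4 * pairing h (f (invFun ((w⁻¹ : ℂ) : P1))) (mWirt (fun w : ℂ => f (invFun w)) w⁻¹)
        (mWirtBar (fun w : ℂ => f (invFun w)) w⁻¹) := by
  have hwk : f (invFun ((w⁻¹ : ℂ) : P1)) = f w := (affine_eventuallyEq hw).self_of_nhds.symm
  rw [mWirt_affine hf hw, mWirtBar_affine hf hw, pairing_smul, hwk, conj_conj]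
  ring

omit [IsManifold 𝓘(ℂ, Cn n) ω M] hf in
theorem integrable_of_inversion {D D' : ℂ → ℝ} (hD : Continuous D) (hD' : Continuous D')
    (hDD : ∀ w, w ≠ 0 → D w = (‖w‖ ^ 4)⁻¹ * D' w⁻¹) : Integrable D := by
  obtain ⟨C, hC⟩ := (isCompact_closedBall (0 : ℂ) 1).exists_bound_of_continuousOn hD'.continuousOn
  refine integrable_of_decay hD (C := C) fun w hw => ?_
  have hw0 : w ≠ 0 := norm_pos_iff.1 (one_pos.trans_le hw)
  rw [hDD w hw0, norm_mul, mul_comm, norm_inv, norm_pow, norm_norm]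
  gcongr
  refine hC _ ?_
  rw [mem_closedBall_zero_iff, norm_inv]
  exact inv_le_one_of_one_le₀ hw

theorem integrable_densW : Integrable (densW h fun w : ℂ => f w) :=
  integrable_of_inversion (continuous_densW h (contMDiff_affine hf))
    (continuous_densW h (contMDiff_affine_inv hf)) fun _ hw => densW_affine h hf hw

theorem integrable_densBar : Integrable (densBar h fun w : ℂ => f w) :=
  integrable_of_inversion (continuous_densBar h (contMDiff_affine hf))
    (continuous_densBar h (contMDiff_affine_inv hf)) fun _ hw => densBar_affine h hf hw

/-- The factor `w⁻⁴` times a quantity continuous at the point at infinity; this is the input for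
Liouville's theorem. -/
theorem tendsto_hopf : Tendsto
    (fun w : ℂ => pairing h (f w) (mWirt (fun w : ℂ => f w) w) (mWirtBar (fun w : ℂ => f w) w))
    (cocompact ℂ) (𝓝 0) := by
  rw [← Metric.cobounded_eq_cocompact]
  have h1 : Tendsto (fun w : ℂ => w⁻¹) (Bornology.cobounded ℂ) (𝓝 0) := tendsto_inv₀_cobounded
  have h2 := ((contDiff_hopf h (contMDiff_affine_inv hf)).continuous.tendsto 0).comp h1
  have h3 := (h1.pow 4).mul h2
  simp only [ne_eq, OfNat.ofNat_ne_zero, not_false_eq_true, zero_pow, zero_mul] at h3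
  refine h3.congr' ?_
  filter_upwards [Bornology.eventually_ne_cobounded (0 : ℂ)] with w hw
  exact (hopf_affine h hf hw).symm

end Smooth

end Inversion

/-! ### Variations of maps of the sphere -/

section Extension

variable {n : ℕ} {M : Type*} [TopologicalSpace M] [ChartedSpace (Cn n) M] {f : P1 → M}
  {F : ℂ × ℂ → M} {r : ℝ} {K : Set ℂ} {X : ℂ → Cn n}

/-- The map of the sphere which is `F (t, ·)` on the affine part and `f` at infinity. -/
noncomputable def extend (f : P1 → M) (F : ℂ × ℂ → M) (t : ℂ) (p : P1) : M :=
  p.elim (f OnePoint.infty) fun w => F (t, w)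

theorem extend_coe (t w : ℂ) : extend f F t (w : P1) = F (t, w) := rfl

variable (hF : IsVariation (fun w : ℂ => f w) F r K X)
include hF

/-- `K` is compact in `ℂ`, so the complement of its image is a neighbourhood of infinity, and there
the family does not move. Smoothness at infinity is then inherited from `f`. -/
theorem IsVariation.eventually_extend_infty :
    ∀ᶠ p in 𝓝 (OnePoint.infty : P1), ∀ t, extend f F t p = f p := by
  have hc : IsClosed (((↑) : ℂ → P1) '' K) :=
    (hF.isCompact.image OnePoint.continuous_coe).isClosed
  have hmem : (OnePoint.infty : P1) ∈ (((↑) : ℂ → P1) '' K)ᶜ := by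
    rintro ⟨w, -, hw⟩
    exact OnePoint.coe_ne_infty w hw
  filter_upwards [hc.isOpen_compl.mem_nhds hmem] with p hp t
  induction p using OnePoint.rec with
  | infty => rfl
  | coe w => exact hF.off t w fun hw => hp ⟨w, hw, rfl⟩

theorem IsVariation.extend_zero (p : P1) : extend f F 0 p = f p := by
  induction p using OnePoint.rec with
  | infty => rfl
  | coe w => exact hF.zero w

theorem IsVariation.contMDiff_extend (hf : ContMDiff 𝓘(ℝ, ℂ) 𝓘(ℝ, Cn n) ∞ f) {t : ℂ}
    (ht : t ∈ Metric.ball (0 : ℂ) r) : ContMDiff 𝓘(ℝ, ℂ) 𝓘(ℝ, Cn n) ∞ (extend f F t) := by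
  intro p
  induction p using OnePoint.rec with
  | infty =>
    refine hf.contMDiffAt.congr_of_eventuallyEq ?_
    filter_upwards [hF.eventually_extend_infty] with p hp using hp t
  | coe w =>
    have h1 : ContMDiffAt 𝓘(ℝ, ℂ) 𝓘(ℝ, Cn n) ∞ (fun y => F (t, y)) (chartZero (w : P1)) := by
      rw [chartZero_coe]
      exact contMDiffAt_slice (hF.smooth (t, w) ht)
    have h2 := ContMDiffAt.comp (g := fun y => F (t, y)) (w : P1) h1 (contMDiffAt_chartZero w)
    refine h2.congr_of_eventuallyEq ?_
    filter_upwards [OnePoint.isOpenEmbedding_coe.isOpen_range.mem_nhds (Set.mem_range_self w)]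
      with p hp
    obtain ⟨y, rfl⟩ := hp
    simp [extend_coe]

theorem IsVariation.continuous_extend (hf : ContMDiff 𝓘(ℝ, ℂ) 𝓘(ℝ, Cn n) ∞ f) {t : ℂ}
    (ht : t ∈ Metric.ball (0 : ℂ) r) :
    Continuous fun q : unitInterval × P1 => extend f F ((q.1 : ℝ) • t) q.2 := by
  rw [continuous_iff_continuousAt]
  rintro ⟨s, p⟩
  induction p using OnePoint.rec with
  | infty =>
    have h1 : ContinuousAt (fun q : unitInterval × P1 => f q.2) (s, OnePoint.infty) :=
      hf.continuous.continuousAt.comp continuousAt_snd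
    refine h1.congr ?_
    filter_upwards [continuousAt_snd.eventually hF.eventually_extend_infty] with q hq
    exact (hq _).symm
  | coe w =>
    have hst : (s : ℝ) • t ∈ Metric.ball (0 : ℂ) r := by
      rw [mem_ball_zero_iff] at ht ⊢
      rw [norm_smul, Real.norm_of_nonneg s.2.1]
      exact (mul_le_of_le_one_left (norm_nonneg _) s.2.2).trans_lt ht
    have hz : ContinuousAt chartZero (w : P1) := (contMDiffAt_chartZero w).continuousAt
    have h1 : ContinuousAt (fun q : unitInterval × P1 => ((q.1 : ℝ) • t, chartZero q.2))
        (s, (w : P1)) := by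
      refine ContinuousAt.prodMk (by fun_prop) ?_
      exact ContinuousAt.comp (f := Prod.snd) (x := (s, (w : P1))) hz continuousAt_snd
    have h2 : ContinuousAt F ((s : ℝ) • t, chartZero (w : P1)) := by
      rw [chartZero_coe]
      exact (hF.smooth _ hst).continuousAt
    refine (ContinuousAt.comp (f := fun q : unitInterval × P1 => ((q.1 : ℝ) • t, chartZero q.2))
      (x := (s, (w : P1))) h2 h1).congr ?_
    have hr : {q : unitInterval × P1 | q.2 ∈ Set.range ((↑) : ℂ → P1)} ∈ 𝓝 (s, (w : P1)) :=
      (OnePoint.isOpenEmbedding_coe.isOpen_range.preimage continuous_snd).mem_nhds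
        (Set.mem_range_self w)
    filter_upwards [hr] with q hq
    obtain ⟨s', p'⟩ := q
    obtain ⟨y, rfl⟩ := hq
    simp [extend_coe]

end Extension

/-! ### Energy along a variation and invariance of the Kähler part -/

section Energy

variable {n : ℕ} {M : Type*} [TopologicalSpace M] [ChartedSpace (Cn n) M]
  [IsManifold 𝓘(ℂ, Cn n) ω M] (h : KahlerMetric n M) {F : ℂ × ℂ → M} {r : ℝ} {K : Set ℂ}
  {X : ℂ → Cn n}

/-- The family itself, run along the segment from `0` to `t`, is a homotopy between `f` and the
competitor. -/
theorem IsVariation.energy_le {f : C^∞⟮𝓘(ℝ, ℂ), P1; 𝓘(ℝ, Cn n), M⟯} (hmin : IsEnergyMinimizing h f)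
    (hF : IsVariation (fun w : ℂ => f w) F r K X) {t : ℂ} (ht : t ∈ Metric.ball (0 : ℂ) r) :
    energy h f ≤ energy h (extend f F t) := by
  refine hmin ⟨extend f F t, hF.contMDiff_extend f.contMDiff ht⟩ ⟨⟨⟨fun q =>
    extend f F ((q.1 : ℝ) • t) q.2, hF.continuous_extend f.contMDiff ht⟩, fun p => ?_, fun p => ?_⟩⟩
  · change extend f F (((0 : unitInterval) : ℝ) • t) p = f p
    rw [Set.Icc.coe_zero, zero_smul, hF.extend_zero]
  · change extend f F (((1 : unitInterval) : ℝ) • t) p = extend f F t p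
    rw [Set.Icc.coe_one, one_smul]

section Slices

variable {g : ℂ → M} (hF : IsVariation g F r K X)
include hF

theorem IsVariation.eventuallyEq_off (t : ℂ) {w : ℂ} (hw : w ∉ K) :
    (fun y => F (t, y)) =ᶠ[𝓝 w] g := by
  filter_upwards [hF.isCompact.isClosed.isOpen_compl.mem_nhds hw] with y hy
  exact hF.off t y hy

theorem IsVariation.famW_off (t : ℂ) {w : ℂ} (hw : w ∉ K) : famW h F (t, w) = densW h g w :=
  densW_congr h (hF.eventuallyEq_off t hw)

theorem IsVariation.famBar_off (t : ℂ) {w : ℂ} (hw : w ∉ K) : famBar h F (t, w) = densBar h g w :=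
  densBar_congr h (hF.eventuallyEq_off t hw)

theorem IsVariation.contDiff_velW {t : ℂ} (ht : t ∈ Metric.ball (0 : ℂ) r) (ξ : ℂ) :
    ContDiff ℝ ∞ fun y => velW h F ξ (t, y) :=
  contDiff_iff_contDiffAt.2 fun _ =>
    contDiffAt_slice_right (contDiffAt_velW h (hF.smoothNear ht) ξ)

theorem IsVariation.contDiff_velBar {t : ℂ} (ht : t ∈ Metric.ball (0 : ℂ) r) (ξ : ℂ) :
    ContDiff ℝ ∞ fun y => velBar h F ξ (t, y) :=
  contDiff_iff_contDiffAt.2 fun _ =>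
    contDiffAt_slice_right (contDiffAt_velBar h (hF.smoothNear ht) ξ)

theorem IsVariation.velocity_off {t : ℂ} (ht : t ∈ Metric.ball (0 : ℂ) r) {w : ℂ} (hw : w ∉ K)
    (ξ : ℂ) : velocity (n := n) F ξ (t, w) = 0 :=
  velocity_eq_zero (hF.smoothNear ht)
    (Eventually.of_forall fun s => by rw [hF.off s w hw, hF.off t w hw]) ξ

theorem IsVariation.velW_off {t : ℂ} (ht : t ∈ Metric.ball (0 : ℂ) r) {w : ℂ} (hw : w ∉ K)
    (ξ : ℂ) : velW h F ξ (t, w) = 0 := by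
  rw [velW, hF.velocity_off ht hw, pairing_zero_right]

theorem IsVariation.velBar_off {t : ℂ} (ht : t ∈ Metric.ball (0 : ℂ) r) {w : ℂ} (hw : w ∉ K)
    (ξ : ℂ) : velBar h F ξ (t, w) = 0 := by
  rw [velBar, hF.velocity_off ht hw, pairing_zero_right]

theorem IsVariation.contDiffAt_famW {x : ℂ × ℂ} (hx : x.1 ∈ Metric.ball (0 : ℂ) r) :
    ContDiffAt ℝ ∞ (famW h F) x :=
  KahlerGeometry.contDiffAt_famW h (hF.smoothNear hx)

theorem IsVariation.contDiffAt_famBar {x : ℂ × ℂ} (hx : x.1 ∈ Metric.ball (0 : ℂ) r) :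
    ContDiffAt ℝ ∞ (famBar h F) x :=
  KahlerGeometry.contDiffAt_famBar h (hF.smoothNear hx)

theorem IsVariation.integrableOn_of_contDiffAt {Φ : ℂ × ℂ → ℝ}
    (hΦ : ∀ x : ℂ × ℂ, x.1 ∈ Metric.ball (0 : ℂ) r → ContDiffAt ℝ ∞ Φ x) {t : ℂ}
    (ht : t ∈ Metric.ball (0 : ℂ) r) : IntegrableOn (fun w => Φ (t, w)) K :=
  (continuous_iff_continuousAt.2 fun w =>
    (contDiffAt_slice_right (hΦ (t, w) ht)).continuousAt).continuousOn.integrableOn_compact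
      hF.isCompact

/-- The derivative along the segment from `0` to `t` is the integral of a divergence of functions
vanishing off `K`, because the velocity vanishes there; so the difference is constant in the
parameter. -/
theorem IsVariation.setIntegral_famW_sub_famBar {t : ℂ} (ht : t ∈ Metric.ball (0 : ℂ) r) :
    ∫ w in K, (famW h F (t, w) - famBar h F (t, w)) =
      ∫ w in K, (famW h F (0, w) - famBar h F (0, w)) := by
  have hmem : ∀ s ∈ Set.Icc (0 : ℝ) 1, (0 : ℂ) + s • t ∈ Metric.ball (0 : ℂ) r := by
    intro s hs
    rw [mem_ball_zero_iff] at ht ⊢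
    rw [zero_add, norm_smul, Real.norm_of_nonneg hs.1]
    exact (mul_le_of_le_one_left (norm_nonneg _) hs.2).trans_lt ht
  have hd : ∀ s ∈ Set.Icc (0 : ℝ) 1, HasDerivAt (fun s : ℝ => ∫ w in K,
      (famW h F (0 + s • t, w) - famBar h F (0 + s • t, w))) 0 s := by
    intro s hs
    have h1 := hasDerivAt_setIntegral_dir (Φ := fun x => famW h F x - famBar h F x)
      (fun x hx => (hF.contDiffAt_famW h hx).sub (hF.contDiffAt_famBar h hx)) hF.isCompact 0 t s
      (hmem s hs)
    convert h1 using 1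
    have h2 : ∀ w, fderiv ℝ (fun x => famW h F x - famBar h F x) (0 + s • t, w) (t, 0) =
        2 * ((wirtBar (fun y => velW h F t (0 + s • t, y)) w).re
          - (wirt (fun y => velBar h F t (0 + s • t, y)) w).re) := by
      intro w
      rw [← fderiv_famW_sub_famBar h (hF.smoothNear (hmem s hs)),
        fderiv_fun_sub ((hF.contDiffAt_famW h (hmem s hs)).differentiableAt (by simp))
          ((hF.contDiffAt_famBar h (hmem s hs)).differentiableAt (by simp))]
      rfl
    have hv := hF.contDiff_velW h (hmem s hs) t
    have hb := hF.contDiff_velBar h (hmem s hs) t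
    have i1 : IntegrableOn (fun w => (wirtBar (fun y => velW h F t (0 + s • t, y)) w).re) K :=
      (continuous_re.comp (contDiff_iff_contDiffAt.2 fun w =>
        contDiffAt_wirtBar hv.contDiffAt).continuous).continuousOn.integrableOn_compact hF.isCompact
    have i2 : IntegrableOn (fun w => (wirt (fun y => velBar h F t (0 + s • t, y)) w).re) K :=
      (continuous_re.comp (contDiff_iff_contDiffAt.2 fun w =>
        contDiffAt_wirt hb.contDiffAt).continuous).continuousOn.integrableOn_compact hF.isCompact
    simp only [h2]
    rw [integral_const_mul, integral_sub i1 i2,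
      setIntegral_re_wirtBar_eq_zero hF.isCompact hv fun w hw => hF.velW_off h (hmem s hs) hw t,
      setIntegral_re_wirt_eq_zero hF.isCompact hb fun w hw => hF.velBar_off h (hmem s hs) hw t]
    simp
  have hconst := constant_of_has_deriv_right_zero (a := (0 : ℝ)) (b := 1)
    (fun s hs => (hd s hs).continuousAt.continuousWithinAt)
    (fun s hs => (hd s ⟨hs.1, hs.2.le⟩).hasDerivWithinAt) 1 (by simp)
  simpa using hconst

end Slices

/-- Along a variation of an energy minimizing map the `∂/∂w̄` part of the energy does not
decrease. -/
theorem IsVariation.setIntegral_famBar_le {f : C^∞⟮𝓘(ℝ, ℂ), P1; 𝓘(ℝ, Cn n), M⟯}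
    (hmin : IsEnergyMinimizing h f) (hF : IsVariation (fun w : ℂ => f w) F r K X) {t : ℂ}
    (ht : t ∈ Metric.ball (0 : ℂ) r) :
    ∫ w in K, famBar h F (0, w) ≤ ∫ w in K, famBar h F (t, w) := by
  have h0 : (0 : ℂ) ∈ Metric.ball (0 : ℂ) r := Metric.mem_ball_self hF.pos
  -- Only the contribution of `K` depends on the parameter.
  have hE : ∀ s ∈ Metric.ball (0 : ℂ) r, energy h (extend f F s) =
      2 * (∫ w in K, famW h F (s, w)) + 2 * (∫ w in K, famBar h F (s, w))
        + ∫ w in Kᶜ, 2 * (densW h (fun w : ℂ => f w) w + densBar h (fun w : ℂ => f w) w) := by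
    intro s hs
    have hs' := hF.contMDiff_extend f.contMDiff hs
    have hi : Integrable fun w : ℂ => 2 * (densW h (fun u : ℂ => extend f F s u) w
        + densBar h (fun u : ℂ => extend f F s u) w) :=
      ((integrable_densW h hs').add (integrable_densBar h hs')).const_mul 2
    rw [energy_eq, ← integral_add_compl hF.isCompact.measurableSet hi]
    congr 1
    · rw [← mul_add, ← integral_add (hF.integrableOn_of_contDiffAt
        (fun x hx => hF.contDiffAt_famW h hx) hs) (hF.integrableOn_of_contDiffAt
        (fun x hx => hF.contDiffAt_famBar h hx) hs), ← integral_const_mul]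
      rfl
    · refine setIntegral_congr_fun hF.isCompact.measurableSet.compl fun w hw => ?_
      have e1 := hF.famW_off h s hw
      have e2 := hF.famBar_off h s hw
      simp only [famW, famBar] at e1 e2
      simp only [extend_coe, e1, e2]
  have e0 : energy h f = energy h (extend f F 0) := by
    congr 1
    funext p
    exact (hF.extend_zero p).symm
  have hle := hF.energy_le h hmin ht
  rw [e0, hE 0 h0, hE t ht] at hle
  -- By invariance of the difference, the change of energy is four times the change of the `∂̄`
  -- part.
  have hT := hF.setIntegral_famW_sub_famBar h ht
  rw [integral_sub (hF.integrableOn_of_contDiffAt (fun x hx => hF.contDiffAt_famW h hx) ht)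
      (hF.integrableOn_of_contDiffAt (fun x hx => hF.contDiffAt_famBar h hx) ht),
    integral_sub (hF.integrableOn_of_contDiffAt (fun x hx => hF.contDiffAt_famW h hx) h0)
      (hF.integrableOn_of_contDiffAt (fun x hx => hF.contDiffAt_famBar h hx) h0)] at hT
  linarith

end Energy

/-! ### The Euler–Lagrange equation and the second variation -/

section WirtBar

variable {E : Type*} [NormedAddCommGroup E] [NormedSpace ℂ E] {Z : ℂ → E} {w : ℂ}

theorem wirtBar_eq_zero_iff : wirtBar Z w = 0 ↔ fderiv ℝ Z w I = I • fderiv ℝ Z w 1 := by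
  have hI : I * I = -1 := Complex.I_mul_I
  rw [wirtBar, smul_eq_zero_iff_right (by norm_num)]
  constructor
  · intro h
    have h2 := congrArg (fun v => I • v) h
    simp only [smul_add, smul_smul, hI, smul_zero, neg_smul, one_smul] at h2
    exact (sub_eq_zero.1 (by rwa [sub_eq_add_neg])).symm
  · intro h
    rw [h, smul_smul, hI, neg_smul, one_smul, add_neg_cancel]

theorem differentiableAt_iff_wirtBar (hZ : DifferentiableAt ℝ Z w) :
    DifferentiableAt ℂ Z w ↔ wirtBar Z w = 0 := by
  rw [differentiableAt_complex_iff_differentiableAt_real, wirtBar_eq_zero_iff]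
  exact and_iff_right hZ

end WirtBar

/-! ### The tension field in coordinates -/

section Tension

variable {n : ℕ} {H : Fin n → Fin n → Cn n → ℂ} {Ω : Set (Cn n)}

theorem contDiffAt_hP {V : Type*} [NormedAddCommGroup V] [NormedSpace ℝ V] {Z a u v : V → Cn n} {x : V}
    (hH : ∀ α β, ContDiffAt ℝ ∞ (H α β) (Z x)) (hZ : ContDiffAt ℝ ∞ Z x) (ha : ContDiffAt ℝ ∞ a x)
    (hu : ContDiffAt ℝ ∞ u x) (hv : ContDiffAt ℝ ∞ v x) :
    ContDiffAt ℝ ∞ (fun x => hP H (Z x) (a x) (u x) (v x)) x := by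
  unfold hP
  refine ContDiffAt.sum fun γ _ => ContDiffAt.sum fun α _ => ContDiffAt.sum fun β _ => ?_
  exact ((((contDiffAt_dz (hH α β) γ).comp x hZ).mul (contDiffAt_coord ha γ)).mul
    (contDiffAt_coord hu α)).mul (contDiffAt_conj (contDiffAt_coord hv β))

variable (H) in
/-- The tension as a vector. -/
noncomputable def tensionVec (Z : ℂ → Cn n) (w : ℂ) : Cn n :=
  WithLp.toLp 2 fun β => tension H Z w (coordVec β)

theorem tension_eq_sum (Z : ℂ → Cn n) (w : ℂ) (b : Cn n) :
    tension H Z w b = ∑ β, conj (b β) * tensionVec H Z w β := by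
  have h1 : ∀ z u, hf H z u b = ∑ β, conj (b β) * hf H z u (coordVec β) := by
    intro z u
    simp only [hf_coordVec, Finset.mul_sum]
    rw [hf, Finset.sum_comm]
    exact Finset.sum_congr rfl fun β _ => Finset.sum_congr rfl fun α _ => by ring
  have h2 : ∀ z a u, hP H z a u b = ∑ β, conj (b β) * hP H z a u (coordVec β) := by
    intro z a u
    simp only [hP_coordVec, Finset.mul_sum]
    rw [hP, Finset.sum_comm' (t' := Finset.univ) (s' := fun _ => Finset.univ) (by simp)]
    rw [Finset.sum_congr rfl fun α _ => Finset.sum_comm]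
    rw [Finset.sum_comm]
    refine Finset.sum_congr rfl fun β _ => ?_
    rw [Finset.sum_comm]
    exact Finset.sum_congr rfl fun γ _ => Finset.sum_congr rfl fun α _ => by ring
  simp only [tensionVec, tension]
  rw [h1, h2, ← Finset.sum_add_distrib]
  exact Finset.sum_congr rfl fun β _ => by ring

/-- The tension functional tested on its own component vector yields a Euclidean norm. No index is
raised with the metric, as only vanishing is at stake. -/
theorem tension_smul_tensionVec (Z : ℂ → Cn n) (w : ℂ) (c : ℝ) :
    (tension H Z w ((c : ℂ) • tensionVec H Z w)).re = c * ‖tensionVec H Z w‖ ^ 2 := by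
  rw [tension_eq_sum, EuclideanSpace.norm_sq_eq, Finset.mul_sum, re_sum]
  refine Finset.sum_congr rfl fun β _ => ?_
  rw [PiLp.smul_apply, smul_eq_mul, map_mul, conj_ofReal, mul_assoc, ← normSq_eq_conj_mul_self,
    normSq_eq_norm_sq, ← ofReal_mul, ofReal_re]

theorem LocalKahler.contDiffAt_tensionVec (hK : LocalKahler H Ω) {Z : ℂ → Cn n} {w : ℂ}
    (hZ : ContDiffAt ℝ ∞ Z w) (hz : Z w ∈ Ω) : ContDiffAt ℝ ∞ (tensionVec H Z) w := by
  rw [contDiffAt_piLp]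
  intro β
  have hH := fun α β => hK.contDiffAt hz α β
  have h1 := contDiffAt_wirt hZ
  have h2 := contDiffAt_wirtBar hZ
  exact (contDiffAt_hf hH hZ (contDiffAt_wirt h2) contDiffAt_const).add
    (contDiffAt_hP hH hZ h1 h2 contDiffAt_const)

end Tension

/-! ### Consequences of the first and second variation for minimizers -/

section Variation

variable {n : ℕ} {M : Type*} [TopologicalSpace M] [ChartedSpace (Cn n) M]
  [IsManifold 𝓘(ℂ, Cn n) ω M] (h : KahlerMetric n M) {F : ℂ × ℂ → M} {r : ℝ} {K : Set ℂ}
  {X : ℂ → Cn n} {g : ℂ → M} {e : OpenPartialHomeomorph M (Cn n)}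

theorem IsVariation.contDiffAt_chart (hF : IsVariation g F r K X)
    (he : e ∈ IsManifold.maximalAtlas 𝓘(ℂ, Cn n) ω M) {x : ℂ × ℂ}
    (hx : x.1 ∈ Metric.ball (0 : ℂ) r) (hs : F x ∈ e.source) :
    ContDiffAt ℝ ∞ (fun y => e (F y)) x :=
  ContMDiffAt.contDiffAt_chart he (hF.smooth x hx) hs

theorem IsVariation.wirtBar_eq_zero (hF : IsVariation g F r K X)
    (he : e ∈ IsManifold.maximalAtlas 𝓘(ℂ, Cn n) ω M) {x : ℂ × ℂ}
    (hx : x.1 ∈ Metric.ball (0 : ℂ) r) (hs : F x ∈ e.source) :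
    wirtBar (fun t => e (F (t, x.2))) x.1 = 0 := by
  have h1 : MDifferentiableAt 𝓘(ℂ, ℂ) 𝓘(ℂ, Cn n) (fun t => e (F (t, x.2))) x.1 :=
    MDifferentiableAt.comp (f := fun t => F (t, x.2)) x.1
      ((contMDiffAt_of_mem_maximalAtlas he hs).mdifferentiableAt (by simp)) (hF.hol x.1 hx x.2)
  have h2 := h1.differentiableAt
  exact (differentiableAt_iff_wirtBar (h2.restrictScalars ℝ)).1 h2

theorem IsVariation.wirt_eq (hF : IsVariation g F r K X)
    (he : e ∈ IsManifold.maximalAtlas 𝓘(ℂ, Cn n) ω M) {w : ℂ} (hs : g w ∈ e.source) {Y : Cn n}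
    (hY : X w = frame e (e (g w)) Y) : wirt (fun t => e (F (t, w))) 0 = Y := by
  have h0 : (0 : ℂ) ∈ Metric.ball (0 : ℂ) r := Metric.mem_ball_self hF.pos
  have hs' : F (0, w) ∈ e.source := by rwa [hF.zero]
  have h1 := hF.vel w
  rw [mWirt_eq he (contMDiffAt_slice_left (hF.smooth (0, w) h0)) hs', hY, hF.zero] at h1
  exact frame_injective he (e.map_source hs) h1

/-- By holomorphy in `t` the real derivative in the direction `1` is the complex derivative. -/
theorem IsVariation.fderiv_eq (hF : IsVariation g F r K X)
    (he : e ∈ IsManifold.maximalAtlas 𝓘(ℂ, Cn n) ω M) {w : ℂ} (hs : g w ∈ e.source) {Y : Cn n}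
    (hY : X w = frame e (e (g w)) Y) :
    fderiv ℝ (fun y => e (F y)) (0, w) (1, 0) = Y := by
  have h0 : (0 : ℂ) ∈ Metric.ball (0 : ℂ) r := Metric.mem_ball_self hF.pos
  have hs' : F (0, w) ∈ e.source := by rwa [hF.zero]
  rw [← fderiv_slice_left (F := fun y => e (F y))
    ((hF.contDiffAt_chart he (x := (0, w)) h0 hs').differentiableAt (by simp)),
    fderiv_apply_eq_wirt, hF.wirt_eq he hs hY, hF.wirtBar_eq_zero he (x := (0, w)) h0 hs']
  simp

section Minimum

variable (hF : IsVariation g F r K X)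
  (hmin : ∀ t ∈ Metric.ball (0 : ℂ) r, ∫ w in K, famBar h F (0, w) ≤ ∫ w in K, famBar h F (t, w))
include hF hmin

omit hmin [IsManifold 𝓘(ℂ, Cn n) ω M] in
theorem IsVariation.eventually_line (ξ : ℂ) :
    ∀ᶠ s : ℝ in 𝓝 0, (0 : ℂ) + s • ξ ∈ Metric.ball (0 : ℂ) r := by
  have hc : Continuous fun s : ℝ => (0 : ℂ) + s • ξ := by fun_prop
  exact hc.continuousAt.eventually (Metric.isOpen_ball.mem_nhds (by simpa using hF.pos))

theorem IsVariation.isLocalMin (ξ : ℂ) :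
    IsLocalMin (fun s : ℝ => ∫ w in K, famBar h F ((0 : ℂ) + s • ξ, w)) 0 := by
  filter_upwards [hF.eventually_line ξ] with s hs
  simpa using hmin _ hs

theorem IsVariation.setIntegral_fderiv_famBar (ξ : ℂ) :
    ∫ w in K, fderiv ℝ (famBar h F) (0, w) (ξ, 0) = 0 := by
  have h1 := (hF.isLocalMin h hmin ξ).hasDerivAt_eq_zero (hasDerivAt_setIntegral_dir
    (fun x hx => hF.contDiffAt_famBar h hx) hF.isCompact 0 ξ 0 (hF.eventually_line ξ).self_of_nhds)
  simpa using h1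

/-- Second derivative test for the integral along the real line spanned by `ξ`, after
differentiating twice under the integral sign. -/
theorem IsVariation.setIntegral_fderiv_fderiv_famBar (ξ : ℂ) :
    0 ≤ ∫ w in K, fderiv ℝ (fun x => fderiv ℝ (famBar h F) x (ξ, 0)) (0, w) (ξ, 0) := by
  have hd := fun s hs => hasDerivAt_setIntegral_dir
    (fun x hx => hF.contDiffAt_famBar h hx) hF.isCompact 0 ξ s hs
  have hd2 := hasDerivAt_setIntegral_dir
    (fun x hx => (hF.contDiffAt_famBar h (x := x) hx).contDiffAt_fderiv_apply (ξ, 0))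
    hF.isCompact 0 ξ 0 (hF.eventually_line ξ).self_of_nhds
  have h1 := deriv_deriv_nonneg_of_isLocalMin (hF.isLocalMin h hmin ξ)
    (hd 0 (hF.eventually_line ξ).self_of_nhds).continuousAt
  have h2 : deriv (fun s : ℝ => ∫ w in K, famBar h F ((0 : ℂ) + s • ξ, w)) =ᶠ[𝓝 0]
      fun s => ∫ w in K, fderiv ℝ (famBar h F) (0 + s • ξ, w) (ξ, 0) := by
    filter_upwards [hF.eventually_line ξ] with s hs
    exact (hd s hs).deriv
  rw [h2.deriv_eq, hd2.deriv] at h1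
  simpa using h1

end Minimum

/-- The property of a map that the `∂/∂w̄` part of the energy does not decrease along
variations. -/
def BarMinimizing (h : KahlerMetric n M) (g : ℂ → M) : Prop :=
  ∀ F r K X, IsVariation (n := n) g F r K X → ∀ t ∈ Metric.ball (0 : ℂ) r,
    ∫ w in K, famBar h F (0, w) ≤ ∫ w in K, famBar h F (t, w)

/-- Euler–Lagrange equation: with velocity `ρ T`, where `T` is the tension vector and `ρ` a bump
function, the first variation is a divergence minus `ρ |T|²`, up to the factor 2; hence `∫ ρ |T|² =
0` and `T` vanishes where `ρ = 1`. -/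
theorem BarMinimizing.tensionVec_eq_zero (hmin : BarMinimizing h g)
    (hg : ContMDiff 𝓘(ℝ, ℂ) 𝓘(ℝ, Cn n) ∞ g)
    (he : e ∈ IsManifold.maximalAtlas 𝓘(ℂ, Cn n) ω M) {w₀ : ℂ} (hw₀ : g w₀ ∈ e.source) :
    tensionVec (metricCoeff h.form e) (fun y => e (g y)) w₀ = 0 := by
  set T : ℂ → Cn n := tensionVec (metricCoeff h.form e) (fun y => e (g y)) with hT
  have hTs : ∀ w, g w ∈ e.source → ContDiffAt ℝ ∞ T w := fun w hw =>
    (h.localKahler he).contDiffAt_tensionVec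
      (ContMDiffAt.contDiffAt_chart he hg.contMDiffAt hw) (e.map_source hw)
  obtain ⟨ρ, hρs, hρc, hρsm, hρr, hρ1⟩ := exists_contDiff_tsupport_subset (n := ⊤)
    ((e.open_source.preimage hg.continuous).mem_nhds hw₀)
  set Y : ℂ → Cn n := fun w => (ρ w : ℂ) • T w with hYdef
  have hYρ : tsupport Y ⊆ tsupport ρ :=
    closure_mono fun w hw h0 => hw (by simp [hYdef, show ρ w = 0 by simpa using h0])
  have hYU : tsupport Y ⊆ g ⁻¹' e.source := hYρ.trans hρs
  have hY : ContDiff ℝ ∞ Y := by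
    refine (contMDiff_of_tsupport (I := 𝓘(ℝ, ℂ)) (I' := 𝓘(ℝ, Cn n))
      fun w hw => ContDiffAt.contMDiffAt ?_).contDiff
    exact (ofRealCLM.contDiff.contDiffAt.comp w hρsm.contDiffAt).smul (hTs w (hYU hw))
  have hYc : HasCompactSupport Y := HasCompactSupport.of_support_subset_isCompact hρc
    (subset_closure.trans hYρ)
  obtain ⟨F, r, hF⟩ := exists_variation_chart hg he hY hYc hYU
  have h0 : (0 : ℂ) ∈ Metric.ball (0 : ℂ) r := Metric.mem_ball_self hF.pos
  have hint := hF.setIntegral_fderiv_famBar h (hmin _ _ _ _ hF) 1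
  set ψ : ℂ → ℝ := fun w => ρ w * ‖T w‖ ^ 2 with hψ
  have hψc : Continuous ψ := by
    rw [continuous_iff_continuousAt]
    intro w
    by_cases hw : w ∈ tsupport ρ
    · exact hρsm.continuous.continuousAt.mul (((hTs w (hρs hw)).continuousAt.norm).pow 2)
    · refine (continuousAt_const (y := (0 : ℝ))).congr ?_
      filter_upwards [(isClosed_tsupport ρ).isOpen_compl.mem_nhds hw] with y hy
      simp [hψ, image_eq_zero_of_notMem_tsupport hy]
  have hψ0 : ∀ w, 0 ≤ ψ w := fun w =>
    mul_nonneg (hρr (Set.mem_range_self w)).1 (by positivity)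
  have hψK : ∀ w ∉ tsupport Y, ψ w = 0 := by
    intro w hw
    have h1 := image_eq_zero_of_notMem_tsupport hw
    rcases smul_eq_zero.1 h1 with h2 | h2
    · simp [hψ, ofReal_eq_zero.1 h2]
    · simp [hψ, h2]
  have hb := hF.contDiff_velBar h h0 1
  have hfd : ∀ w ∈ tsupport Y, fderiv ℝ (famBar h F) (0, w) (1, 0) =
      2 * ((wirt (fun y => velBar h F 1 (0, y)) w).re - ψ w) := by
    intro w hw
    have hs : F (0, w) ∈ e.source := by rw [hF.zero]; exact hYU hw
    rw [fderiv_famBar_eq h he (hF.smoothNear h0) hs, hF.fderiv_eq he (hYU hw) rfl]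
    have e1 : (fun y => e (F (0, y))) = fun y => e (g y) := by
      funext y; rw [hF.zero]
    rw [e1]
    congr 2
    exact tension_smul_tensionVec _ _ _
  have hint1 : IntegrableOn (fun w => (wirt (fun y => velBar h F 1 (0, y)) w).re) (tsupport Y) :=
    (continuous_re.comp (contDiff_iff_contDiffAt.2 fun w =>
      contDiffAt_wirt hb.contDiffAt).continuous).continuousOn.integrableOn_compact hYc
  rw [setIntegral_congr_fun hYc.measurableSet hfd, integral_const_mul, integral_sub hint1
    (hψc.continuousOn.integrableOn_compact hYc),
    setIntegral_re_wirt_eq_zero hYc hb fun w hw => hF.velBar_off h h0 hw 1] at hint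
  have hz := eqOn_zero_of_setIntegral_eq_zero hYc hψc hψ0 hψK (by linarith) w₀
  simpa [hψ, hρ1] using hz

theorem BarMinimizing.tension_eq_zero (hmin : BarMinimizing h g)
    (hg : ContMDiff 𝓘(ℝ, ℂ) 𝓘(ℝ, Cn n) ∞ g)
    (he : e ∈ IsManifold.maximalAtlas 𝓘(ℂ, Cn n) ω M) {w : ℂ} (hw : g w ∈ e.source) (b : Cn n) :
    tension (metricCoeff h.form e) (fun y => e (g y)) w b = 0 := by
  rw [tension_eq_sum, hmin.tensionVec_eq_zero h hg he hw]
  simp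

/-- The Hopf differential of a harmonic map is holomorphic. -/
theorem BarMinimizing.differentiable_hopf (hmin : BarMinimizing h g)
    (hg : ContMDiff 𝓘(ℝ, ℂ) 𝓘(ℝ, Cn n) ∞ g) :
    Differentiable ℂ fun w => pairing h (g w) (mWirt g w) (mWirtBar g w) := by
  intro w
  have he := IsManifold.chart_mem_maximalAtlas (I := 𝓘(ℂ, Cn n)) (n := ω) (g w)
  have hx := mem_chart_source (Cn n) (g w)
  rw [differentiableAt_iff_wirtBar ((contDiff_hopf h hg).differentiable (by simp) w),
    wirtBar_congr (pairing_eventuallyEq h hg.continuous.continuousAt hx (eventually_mWirt he hg hx)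
      (eventually_mWirtBar he hg hx))]
  exact (h.localKahler he).wirtBar_hopf (ContMDiffAt.contDiffAt_chart he hg.contMDiffAt hx)
    ((chartAt (Cn n) (g w)).map_source hx) (hmin.tension_eq_zero h hg he hx)

theorem fderiv_fderiv_re {V : Type*} [NormedAddCommGroup V] [NormedSpace ℝ V] {k : V → ℂ} {b : V → ℝ}
    {x : V} (hk : ContDiffAt ℝ ∞ k x) (hb : b =ᶠ[𝓝 x] fun y => (k y).re) (v : V) :
    fderiv ℝ (fun y => fderiv ℝ b y v) x v = (fderiv ℝ (fun y => fderiv ℝ k y v) x v).re := by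
  have h1 : (fun y => fderiv ℝ b y v) =ᶠ[𝓝 x] fun y => (fderiv ℝ k y v).re := by
    filter_upwards [hb.eventually_nhds, hk.eventually_differentiableAt] with y hy hd
    rw [EventuallyEq.fderiv_eq hy, re_fderiv hd]
  rw [h1.fderiv_eq, re_fderiv ((hk.contDiffAt_fderiv_apply v).differentiableAt (by simp))]

theorem fderiv_fderiv_slice {k : ℂ × ℂ → ℂ} {t w : ℂ} (hk : ContDiffAt ℝ ∞ k (t, w)) (ξ : ℂ) :
    fderiv ℝ (fun y => fderiv ℝ k y (ξ, 0)) (t, w) (ξ, 0) =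
      fderiv ℝ (fun s => fderiv ℝ (fun s => k (s, w)) s ξ) t ξ := by
  rw [← fderiv_slice_left ((hk.contDiffAt_fderiv_apply (ξ, 0)).differentiableAt (by simp))]
  have h1 : (fun s => fderiv ℝ k (s, w) (ξ, 0)) =ᶠ[𝓝 t] fun s => fderiv ℝ (fun s => k (s, w)) s ξ := by
    filter_upwards [((Continuous.prodMk_left w).tendsto t).eventually hk.eventually_differentiableAt]
      with s hs
    rw [fderiv_slice_left hs]
  rw [h1.fderiv_eq]

/-- The second variation of the density of the `∂/∂w̄` part. -/
theorem IsVariation.second_variation {φ : ℂ → ℂ} (hmin : BarMinimizing h g)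
    (hg : ContMDiff 𝓘(ℝ, ℂ) 𝓘(ℝ, Cn n) ∞ g) (hφ : ContDiff ℝ ∞ φ)
    (hF : IsVariation g F r K (fun w => φ w • mWirt (n := n) g w))
    (he : e ∈ IsManifold.maximalAtlas 𝓘(ℂ, Cn n) ω M) {w : ℂ} (hs : g w ∈ e.source) :
    fderiv ℝ (fun x => fderiv ℝ (famBar h F) x (1, 0)) (0, w) (1, 0)
      + fderiv ℝ (fun x => fderiv ℝ (famBar h F) x (I, 0)) (0, w) (I, 0) =
    4 * (‖wirtBar φ w‖ ^ 2 * densW h g w - ‖φ w‖ ^ 2 * (h.bisectional e (e (g w))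
      (wirt (fun y => e (g y)) w : Cn n) (wirtBar (fun y => e (g y)) w : Cn n)).re) := by
  have h0 : (0 : ℂ) ∈ Metric.ball (0 : ℂ) r := Metric.mem_ball_self hF.pos
  have hs' : F (0, w) ∈ e.source := by rwa [hF.zero]
  have hnear := hF.smoothNear (x := (0, w)) h0
  have hk := contDiffAt_hf_sndWirtBar h he hnear hs'
  have hb := famBar_eventuallyEq h he hnear hs'
  have hev : ∀ᶠ x : ℂ × ℂ in 𝓝 (0, w), x.1 ∈ Metric.ball (0 : ℂ) r ∧ F x ∈ e.source :=
    Eventually.and ((Metric.isOpen_ball.preimage continuous_fst).mem_nhds h0)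
      ((hF.smooth (0, w) h0).continuousAt.eventually (e.open_source.mem_nhds hs'))
  have hslice : (fun y => e (F (0, y))) = fun y => e (g y) := by
    funext y; rw [hF.zero]
  have hmain := (h.localKahler he).wirt_wirtBar_second (F := fun x => e (F x)) (w := w) (φ := φ)
    (hev.mono fun x hx => hF.contDiffAt_chart he hx.1 hx.2) (e.map_source hs')
    (hφ.differentiable (by simp) w) (hev.mono fun x hx => hF.wirtBar_eq_zero he hx.1 hx.2) ?_ ?_
  -- The two second derivatives add up to the Laplacian in `t`, which is `4 ∂_t ∂_t̄`; this is why
  -- variations in both directions `1` and `I` are used together.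
  · rw [fderiv_fderiv_re hk hb, fderiv_fderiv_re hk hb, fderiv_fderiv_slice hk,
      fderiv_fderiv_slice hk, ← add_re, laplacian_eq_wirt_wirtBar (contDiffAt_slice_left hk), hmain]
    simp only [sndWirt, sndWirtBar, hF.zero]
    rw [densW_eq h he hg.contMDiffAt hs, smul_eq_mul, show (4 : ℂ) = ((4 : ℝ) : ℂ) by norm_num,
      re_ofReal_mul, sub_re, mul_conj, mul_conj, re_ofReal_mul, re_ofReal_mul, normSq_eq_norm_sq,
      normSq_eq_norm_sq]
    rfl
  · filter_upwards [hg.continuous.continuousAt.eventually (e.open_source.mem_nhds hs)] with y hy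
    simp only [hslice]
    refine hF.wirt_eq he hy ?_
    rw [map_smul, mWirt_eq he hg.contMDiffAt hy]
  · intro b
    rw [hslice]
    exact hmin.tension_eq_zero h hg he hs b

end Variation

/-! ### Vanishing of one of the two partial differentials at every point -/

section InverseMatrix

variable {V : Type*} [NormedAddCommGroup V] [NormedSpace ℝ V] {ι : Type*} [Fintype ι] [DecidableEq ι]

theorem contDiffAt_det {A : V → Matrix ι ι ℂ} {x : V}
    (hA : ∀ i j, ContDiffAt ℝ ∞ (fun y => A y i j) x) : ContDiffAt ℝ ∞ (fun y => (A y).det) x := by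
  simp only [Matrix.det_apply']
  exact ContDiffAt.sum fun σ _ => contDiffAt_const.mul (contDiffAt_prod fun i _ => hA _ _)

/-- By Cramer's rule the inverse is a quotient of polynomials in the entries. -/
theorem contDiffAt_matrix_inv {A : V → Matrix ι ι ℂ} {x : V}
    (hA : ∀ i j, ContDiffAt ℝ ∞ (fun y => A y i j) x) (hx : IsUnit (A x)) (i j : ι) :
    ContDiffAt ℝ ∞ (fun y => (A y)⁻¹ i j) x := by
  have hdet : (A x).det ≠ 0 := ((Matrix.isUnit_iff_isUnit_det _).1 hx).ne_zero
  simp only [Matrix.inv_def, Ring.inverse_eq_inv', Matrix.smul_apply, smul_eq_mul,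
    Matrix.adjugate_apply]
  refine ((contDiffAt_det hA).inv hdet).mul (contDiffAt_det fun k l => ?_)
  by_cases hk : k = j
  · subst hk
    simp only [Matrix.updateRow_self]
    exact contDiffAt_const
  · simp only [Matrix.updateRow_ne hk]
    exact hA k l

variable {n : ℕ} {H : Fin n → Fin n → Cn n → ℂ} {Ω : Set (Cn n)}

theorem LocalKahler.contDiffAt_inv (hK : LocalKahler H Ω) {z : Cn n} (hz : z ∈ Ω) (τ σ : Fin n) :
    ContDiffAt ℝ ∞ (fun y => (Matrix.of fun α β => H α β y)⁻¹ τ σ) z :=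
  contDiffAt_matrix_inv (A := fun y => Matrix.of fun α β => H α β y)
    (fun α β => hK.contDiffAt hz α β) (hK.isUnit_matrix hz) τ σ

theorem LocalKahler.contDiffAt_localBisectional (hK : LocalKahler H Ω) {Z X Y : V → Cn n} {x : V}
    (hZ : ContDiffAt ℝ ∞ Z x) (hz : Z x ∈ Ω) (hX : ContDiffAt ℝ ∞ X x) (hY : ContDiffAt ℝ ∞ Y x) :
    ContDiffAt ℝ ∞ (fun y => localBisectional H (Z y) (X y) (Y y)) x := by
  unfold localBisectional
  have hH := fun α β => hK.contDiffAt hz α β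
  refine ContDiffAt.sum fun α _ => ContDiffAt.sum fun β _ => ContDiffAt.sum fun γ _ =>
    ContDiffAt.sum fun δ _ => ?_
  refine ((((ContDiffAt.add ?_ ?_).mul (contDiffAt_coord hX α)).mul
    (contDiffAt_conj (contDiffAt_coord hX β))).mul (contDiffAt_coord hY γ)).mul
    (contDiffAt_conj (contDiffAt_coord hY δ))
  · exact ((contDiffAt_dz (contDiffAt_dzbar (hH γ δ) β) α).comp x hZ).neg
  · exact ContDiffAt.sum fun σ _ => ContDiffAt.sum fun τ _ =>
      (((hK.contDiffAt_inv hz τ σ).comp x hZ).mul ((contDiffAt_dz (hH γ τ) α).comp x hZ)).mul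
        ((contDiffAt_dzbar (hH σ δ) β).comp x hZ)

end InverseMatrix

/-! ### Cut-off functions with small gradient -/

section Cutoff

theorem norm_wirtBar_le {E : Type*} [NormedAddCommGroup E] [NormedSpace ℂ E] (g : ℂ → E) (w : ℂ) :
    ‖wirtBar g w‖ ≤ ‖fderiv ℝ g w‖ := by
  have h1 : ‖fderiv ℝ g w 1‖ ≤ ‖fderiv ℝ g w‖ := by
    simpa using (fderiv ℝ g w).le_opNorm 1
  have h2 : ‖fderiv ℝ g w I‖ ≤ ‖fderiv ℝ g w‖ := by
    simpa using (fderiv ℝ g w).le_opNorm I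
  rw [wirtBar, norm_smul]
  have h3 := norm_add_le (fderiv ℝ g w 1) (I • fderiv ℝ g w I)
  rw [norm_smul, norm_I, one_mul] at h3
  have h4 : ‖(1 / 2 : ℂ)‖ = 1 / 2 := by norm_num
  rw [h4]
  linarith

/-- Cut-off functions on large discs with small gradient. -/
theorem exists_cutoff : ∃ C : ℝ, ∀ R : ℝ, 0 < R → ∃ φ : ℂ → ℂ, ContDiff ℝ ∞ φ ∧ HasCompactSupport φ ∧
    (∀ w, ‖w‖ ≤ R → φ w = 1) ∧ ∀ w, ‖wirtBar φ w‖ ≤ C / R := by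
  let χ : ContDiffBump (0 : ℂ) := ⟨1, 2, one_pos, one_lt_two⟩
  set χ' : ℂ → ℂ := fun w => (χ w : ℂ) with hχ'
  have hsm : ContDiff ℝ ∞ χ' := ofRealCLM.contDiff.comp χ.contDiff
  have hc : HasCompactSupport χ' := χ.hasCompactSupport.comp_left (g := ofReal) rfl
  obtain ⟨C, hC⟩ := (hsm.continuous_fderiv (by simp)).bounded_above_of_compact_support
    (hc.fderiv (𝕜 := ℝ))
  -- A fixed bump function, equal to `1` on the unit disc, is rescaled by `R`; `C` bounds its
  -- gradient.
  refine ⟨C, fun R hR => ⟨fun w => χ' (w * (R : ℂ)⁻¹), ?_, ?_, ?_, ?_⟩⟩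
  · exact hsm.comp (contDiff_id.mul contDiff_const)
  · have hR0 : (R : ℂ)⁻¹ ≠ 0 := inv_ne_zero (ofReal_ne_zero.2 hR.ne')
    exact hc.comp_homeomorph (Homeomorph.mulRight₀ _ hR0)
  · intro w hw
    have : χ (w * (R : ℂ)⁻¹) = 1 := by
      refine χ.one_of_mem_closedBall ?_
      rw [mem_closedBall_zero_iff, norm_mul, norm_inv, norm_real, Real.norm_of_nonneg hR.le]
      exact mul_inv_le_one_of_le₀ hw hR.le
    simp [hχ', this]
  · intro w
    have hd : HasDerivAt (fun w : ℂ => w * (R : ℂ)⁻¹) ((R : ℂ)⁻¹) w := by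
      simpa using (hasDerivAt_id w).mul_const ((R : ℂ)⁻¹)
    rw [wirtBar_comp_holomorphic (Z := χ') (hsm.differentiable (by simp) _) hd, norm_smul,
      RCLike.norm_conj, norm_inv, norm_real, Real.norm_of_nonneg hR.le, div_eq_inv_mul]
    gcongr
    exact (norm_wirtBar_le _ _).trans (hC _)

end Cutoff

/-! ### Stability and pointwise vanishing of one partial differential -/

section Dichotomy

variable {n : ℕ} {M : Type*} [TopologicalSpace M] [ChartedSpace (Cn n) M]
  [IsManifold 𝓘(ℂ, Cn n) ω M] {h : KahlerMetric n M} {g : ℂ → M}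
  {e : OpenPartialHomeomorph M (Cn n)}

/-- The bisectional curvature of the two partial differentials of a map. -/
noncomputable def curvAlong (h : KahlerMetric n M) (g : ℂ → M) (e : OpenPartialHomeomorph M (Cn n))
    (w : ℂ) : ℝ :=
  (h.bisectional e (e (g w)) (wirt (fun y => e (g y)) w : Cn n)
    (wirtBar (fun y => e (g y)) w : Cn n)).re

theorem continuousAt_curvAlong (hg : ContMDiff 𝓘(ℝ, ℂ) 𝓘(ℝ, Cn n) ∞ g)
    (he : e ∈ IsManifold.maximalAtlas 𝓘(ℂ, Cn n) ω M) {w : ℂ} (hw : g w ∈ e.source) :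
    ContinuousAt (curvAlong h g e) w := by
  have hZ := ContMDiffAt.contDiffAt_chart he hg.contMDiffAt hw
  exact continuous_re.continuousAt.comp
    ((h.localKahler he).contDiffAt_localBisectional hZ (e.map_source hw) (contDiffAt_wirt hZ)
      (contDiffAt_wirtBar hZ)).continuousAt

/-- Vanishing of the Hopf coefficient is the orthogonality of `f_w` and `f_w̄`, so the curvature
hypothesis applies to this pair. -/
theorem curvAlong_pos (hpos : h.PosOrthBisectional) (hg : ContMDiff 𝓘(ℝ, ℂ) 𝓘(ℝ, Cn n) ∞ g)
    (he : e ∈ IsManifold.maximalAtlas 𝓘(ℂ, Cn n) ω M) {w : ℂ} (hw : g w ∈ e.source)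
    (hopf : pairing h (g w) (mWirt g w) (mWirtBar g w) = 0)
    (h1 : mWirt (n := n) g w ≠ 0) (h2 : mWirtBar (n := n) g w ≠ 0) : 0 < curvAlong h g e w := by
  have e1 := mWirt_eq he hg.contMDiffAt hw
  have e2 := mWirtBar_eq he hg.contMDiffAt hw
  refine hpos e he _ (e.map_source hw) _ _ ?_ ?_ ?_
  · intro h0
    refine h1 ?_
    have h3 : wirt (fun y => e (g y)) w = 0 := by
      ext i
      exact congrFun h0 i
    rw [e1, h3, map_zero]
  · intro h0
    refine h2 ?_
    have h3 : wirtBar (fun y => e (g y)) w = 0 := by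
      ext i
      exact congrFun h0 i
    rw [e2, h3, map_zero]
  · rw [e1, e2, pairing_frame h hw] at hopf
    exact hopf

/-- If one of the vectors vanishes the curvature term is zero; otherwise it is positive by
orthogonality. -/
theorem curvAlong_nonneg (hpos : h.PosOrthBisectional) (hg : ContMDiff 𝓘(ℝ, ℂ) 𝓘(ℝ, Cn n) ∞ g)
    (he : e ∈ IsManifold.maximalAtlas 𝓘(ℂ, Cn n) ω M) {w : ℂ} (hw : g w ∈ e.source)
    (hopf : pairing h (g w) (mWirt g w) (mWirtBar g w) = 0) : 0 ≤ curvAlong h g e w := by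
  by_cases h1 : mWirt (n := n) g w = 0
  · rw [mWirt_eq he hg.contMDiffAt hw] at h1
    have h3 := frame_injective he (e.map_source hw) (h1.trans (map_zero _).symm)
    rw [curvAlong, h3]
    simp [KahlerMetric.bisectional]
  by_cases h2 : mWirtBar (n := n) g w = 0
  · rw [mWirtBar_eq he hg.contMDiffAt hw] at h2
    have h3 := frame_injective he (e.map_source hw) (h2.trans (map_zero _).symm)
    rw [curvAlong, h3]
    simp [KahlerMetric.bisectional]
  exact (curvAlong_pos hpos hg he hw hopf h1 h2).le

/-- The stability inequality, for a region on which the curvature is bounded below. -/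
theorem BarMinimizing.stability (hmin : BarMinimizing h g) (hpos : h.PosOrthBisectional)
    (hg : ContMDiff 𝓘(ℝ, ℂ) 𝓘(ℝ, Cn n) ∞ g)
    (hopf : ∀ w, pairing h (g w) (mWirt g w) (mWirtBar g w) = 0)
    (hint : Integrable (densW h g)) (he : e ∈ IsManifold.maximalAtlas 𝓘(ℂ, Cn n) ω M) {B : Set ℂ}
    (hB : MeasurableSet B) {c : ℝ} (hBe : ∀ w ∈ B, g w ∈ e.source ∧ c ≤ curvAlong h g e w)
    {φ : ℂ → ℂ} (hφ : ContDiff ℝ ∞ φ) (hφc : HasCompactSupport φ) (hφB : ∀ w ∈ B, φ w = 1) {ε : ℝ}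
    (hε : ∀ w, ‖wirtBar φ w‖ ≤ ε) :
    c * volume.real B ≤ ε ^ 2 * ∫ w, densW h g w := by
  obtain ⟨F, r, hF⟩ := exists_variation_smul hg hφ hφc
  have h0 : (0 : ℂ) ∈ Metric.ball (0 : ℂ) r := Metric.mem_ball_self hF.pos
  set K := tsupport φ with hKdef
  have hK : IsCompact K := hφc
  have hBK : B ⊆ K := fun w hw => subset_tsupport _ (by simp [hφB w hw])
  have hi : ∀ ξ : ℂ, IntegrableOn (fun w =>
      fderiv ℝ (fun x => fderiv ℝ (famBar h F) x (ξ, 0)) (0, w) (ξ, 0)) K := fun ξ =>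
    hF.integrableOn_of_contDiffAt
      (Φ := fun x => fderiv ℝ (fun x => fderiv ℝ (famBar h F) x (ξ, 0)) x (ξ, 0))
      (fun x hx => ((hF.contDiffAt_famBar h hx).contDiffAt_fderiv_apply _).contDiffAt_fderiv_apply _)
      h0
  have hsum := add_nonneg (hF.setIntegral_fderiv_fderiv_famBar h (hmin _ _ _ _ hF) 1)
    (hF.setIntegral_fderiv_fderiv_famBar h (hmin _ _ _ _ hF) I)
  rw [← integral_add (hi 1) (hi I)] at hsum
  have hDi : IntegrableOn (fun w => ε ^ 2 * densW h g w) K := (hint.const_mul _).integrableOn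
  have hBi : IntegrableOn (B.indicator fun _ => c) K :=
    (continuousOn_const.integrableOn_compact hK).indicator hB
  -- On `B` the curvature is at least `c` and `φ = 1`; elsewhere it is discarded as nonnegative,
  -- computed in whatever chart is centred at the image point.
  have hle : ∀ w ∈ K, fderiv ℝ (fun x => fderiv ℝ (famBar h F) x (1, 0)) (0, w) (1, 0)
      + fderiv ℝ (fun x => fderiv ℝ (famBar h F) x (I, 0)) (0, w) (I, 0) ≤
      4 * (ε ^ 2 * densW h g w - B.indicator (fun _ => c) w) := by
    intro w _
    have hε2 : ‖wirtBar φ w‖ ^ 2 * densW h g w ≤ ε ^ 2 * densW h g w := by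
      have := densW_nonneg h g w
      gcongr
      exact hε w
    by_cases hw : w ∈ B
    · obtain ⟨hs, hcw⟩ := hBe w hw
      rw [hF.second_variation h hmin hg hφ he hs, Set.indicator_of_mem hw, hφB w hw, norm_one,
        one_pow, one_mul]
      gcongr
      exact hcw
    · have he' := IsManifold.chart_mem_maximalAtlas (I := 𝓘(ℂ, Cn n)) (n := ω) (g w)
      have hx := mem_chart_source (Cn n) (g w)
      rw [hF.second_variation h hmin hg hφ he' hx, Set.indicator_of_notMem hw]
      have h3 := curvAlong_nonneg hpos hg he' hx (hopf w)
      have h4 := mul_nonneg (sq_nonneg ‖φ w‖) h3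
      rw [curvAlong] at h4
      linarith
  have hmono := setIntegral_mono_on ((hi 1).add (hi I)) ((hDi.sub hBi).const_mul 4)
    hK.measurableSet hle
  have hfin := hsum.trans hmono
  simp only [Pi.sub_apply] at hfin
  rw [integral_const_mul, integral_sub hDi hBi, integral_const_mul,
    setIntegral_indicator hB, Set.inter_eq_self_of_subset_right hBK, setIntegral_const,
    smul_eq_mul] at hfin
  have hDle : ∫ w in K, densW h g w ≤ ∫ w, densW h g w :=
    setIntegral_le_integral hint (Eventually.of_forall fun w => densW_nonneg h g w)
  have := mul_le_mul_of_nonneg_left hDle (sq_nonneg ε)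
  linarith

/-- If both derivatives were nonzero at `w`, the curvature would exceed a positive constant on a
small disc. Letting the radius of the cut-off tend to infinity in the stability inequality
contradicts this, as the energy is finite. -/
theorem BarMinimizing.eq_zero_or (hmin : BarMinimizing h g) (hpos : h.PosOrthBisectional)
    (hg : ContMDiff 𝓘(ℝ, ℂ) 𝓘(ℝ, Cn n) ∞ g)
    (hopf : ∀ w, pairing h (g w) (mWirt g w) (mWirtBar g w) = 0)
    (hint : Integrable (densW h g)) (w : ℂ) :
    mWirt (n := n) g w = 0 ∨ mWirtBar (n := n) g w = 0 := by
  by_contra! hne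
  have he := IsManifold.chart_mem_maximalAtlas (I := 𝓘(ℂ, Cn n)) (n := ω) (g w)
  have hx := mem_chart_source (Cn n) (g w)
  set e := chartAt (Cn n) (g w)
  have hc := curvAlong_pos hpos hg he hx (hopf w) hne.1 hne.2
  set c := curvAlong h g e w / 2 with hcdef
  have hev : ∀ᶠ y in 𝓝 w, g y ∈ e.source ∧ c ≤ curvAlong h g e y :=
    (hg.continuous.continuousAt.eventually (e.open_source.mem_nhds hx)).and
      ((continuousAt_curvAlong hg he hx).eventually (Ici_mem_nhds (by linarith)))
  obtain ⟨δ, hδ, hball⟩ := Metric.eventually_nhds_iff_ball.1 hev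
  obtain ⟨C, hC⟩ := exists_cutoff
  have hvol : 0 < volume.real (Metric.ball w δ) :=
    ENNReal.toReal_pos (Metric.measure_ball_pos _ _ hδ).ne' measure_ball_lt_top.ne
  -- This size of `R` puts the small disc inside the region where the cut-off function is `1`.
  have key : ∀ R : ℝ, ‖w‖ + δ ≤ R →
      c * volume.real (Metric.ball w δ) ≤ (C / R) ^ 2 * ∫ w, densW h g w := by
    intro R hR
    have hR0 : 0 < R := (add_pos_of_nonneg_of_pos (norm_nonneg w) hδ).trans_le hR
    obtain ⟨φ, hφ, hφc, hφ1, hφε⟩ := hC R hR0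
    refine hmin.stability hpos hg hopf hint he Metric.isOpen_ball.measurableSet hball hφ hφc
      (fun y hy => hφ1 y ?_) hφε
    have := norm_sub_norm_le y w
    rw [Metric.mem_ball, dist_eq_norm] at hy
    linarith
  have hlim : Tendsto (fun R : ℝ => (C / R) ^ 2 * ∫ w, densW h g w) atTop (𝓝 0) := by
    have h1 : Tendsto (fun R : ℝ => C / R) atTop (𝓝 0) := tendsto_const_nhds.div_atTop tendsto_id
    simpa using (h1.pow 2).mul_const (∫ w, densW h g w)
  have hle := ge_of_tendsto hlim ((eventually_ge_atTop (‖w‖ + δ)).mono key)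
  have : 0 < c * volume.real (Metric.ball w δ) := by positivity
  linarith

end Dichotomy

/-! ### Unique continuation and the conclusion -/

section UniqueContinuation

variable {n : ℕ} {H : Fin n → Fin n → Cn n → ℂ} {Ω : Set (Cn n)}

/-- The elementary endomorphism `v ↦ v^γ ∂/∂z^σ`. -/
noncomputable def elemEnd (σ γ : Fin n) : Cn n →L[ℂ] Cn n :=
  (EuclideanSpace.proj γ : Cn n →L[ℂ] ℂ).smulRight (coordVec σ)

variable (H) in
/-- The coefficient of the linear equation satisfied by the `∂/∂w` derivative of a harmonic map. -/
noncomputable def harmonicCoeff (Z : ℂ → Cn n) (w : ℂ) : Cn n →L[ℂ] Cn n :=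
  ∑ σ, ∑ γ, (-∑ τ, ∑ α, (Matrix.of fun α β => H α β (Z w))⁻¹ τ σ * dz γ (H α τ) (Z w)
    * wirtBar Z w α) • elemEnd σ γ

theorem LocalKahler.contDiffAt_harmonicCoeff (hK : LocalKahler H Ω) {Z : ℂ → Cn n} {w : ℂ}
    (hZ : ContDiffAt ℝ ∞ Z w) (hz : Z w ∈ Ω) : ContDiffAt ℝ ∞ (harmonicCoeff H Z) w := by
  unfold harmonicCoeff
  refine ContDiffAt.sum fun σ _ => ContDiffAt.sum fun γ _ => ?_
  have hc : ContDiffAt ℝ ∞ (fun w => -∑ τ, ∑ α, (Matrix.of fun α β => H α β (Z w))⁻¹ τ σ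
      * dz γ (H α τ) (Z w) * wirtBar Z w α) w := by
    refine ContDiffAt.neg (ContDiffAt.sum fun τ _ => ContDiffAt.sum fun α _ => ?_)
    exact (((hK.contDiffAt_inv hz τ σ).comp w hZ).mul
      ((contDiffAt_dz (hK.contDiffAt hz α τ) γ).comp w hZ)).mul
      (contDiffAt_coord (contDiffAt_wirtBar hZ) α)
  exact hc.smul contDiffAt_const

/-- The harmonic map equation solved for `f_{ww̄}`. It is bilinear in `f_w` and `f_w̄`; treating
`f_w̄` as a known coefficient makes it a linear `∂̄`-equation for `f_w`. -/
theorem LocalKahler.wirtBar_wirt_eq (hK : LocalKahler H Ω) {Z : ℂ → Cn n} {w : ℂ}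
    (hZ : ContDiffAt ℝ ∞ Z w) (hz : Z w ∈ Ω) (hE : ∀ b, tension H Z w b = 0) :
    wirtBar (wirt Z) w = harmonicCoeff H Z w (wirt Z w) := by
  set A : Matrix (Fin n) (Fin n) ℂ := Matrix.of fun α β => H α β (Z w) with hA
  have hdet : IsUnit A.det := (Matrix.isUnit_iff_isUnit_det A).1 (hK.isUnit_matrix hz)
  set y : Fin n → ℂ := fun τ => -hP H (Z w) (wirt Z w) (wirtBar Z w) (coordVec τ) with hy
  have h1 : Matrix.vecMul (wirtBar (wirt Z) w : Cn n) A = y := by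
    funext τ
    have h2 := hE (coordVec τ)
    rw [tension, hf_coordVec, ← wirtBar_wirt_comm hZ] at h2
    rw [hy]
    simp only
    rw [← eq_neg_of_add_eq_zero_left h2]
    simp only [Matrix.vecMul, dotProduct]
    exact Finset.sum_congr rfl fun α _ => by rw [hA, Matrix.of_apply, mul_comm]
  have h3 : ((wirtBar (wirt Z) w : Cn n) : Fin n → ℂ) = Matrix.vecMul y A⁻¹ := by
    rw [← h1, Matrix.vecMul_vecMul, Matrix.mul_nonsing_inv _ hdet, Matrix.vecMul_one]
  ext σ
  rw [h3]
  simp only [harmonicCoeff, elemEnd, _root_.sum_apply, _root_.smul_apply,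
    ContinuousLinearMap.smulRight_apply, PiLp.proj_apply, WithLp.ofLp_sum,
    Finset.sum_apply, PiLp.smul_apply, coordVec, PiLp.single_apply, smul_eq_mul]
  rw [Finset.sum_eq_single σ (fun b _ hb => by simp [hb.symm]) (by simp)]
  simp only [if_true, mul_one, Matrix.vecMul, dotProduct, hy, hP_coordVec]
  simp only [neg_mul, Finset.sum_neg_distrib, neg_inj, Finset.sum_mul]
  rw [Finset.sum_comm]
  exact Finset.sum_congr rfl fun γ _ => Finset.sum_congr rfl fun τ _ =>
    Finset.sum_congr rfl fun α _ => by ring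

variable {M : Type*} [TopologicalSpace M] [ChartedSpace (Cn n) M]
  [IsManifold 𝓘(ℂ, Cn n) ω M] {h : KahlerMetric n M} {g : ℂ → M}

/-- If the `∂/∂w` derivative of a harmonic map vanishes on an open set, it vanishes
identically. -/
theorem BarMinimizing.mWirt_eq_zero (hmin : BarMinimizing h g)
    (hg : ContMDiff 𝓘(ℝ, ℂ) 𝓘(ℝ, Cn n) ∞ g) {w₀ : ℂ}
    (h0 : ∀ᶠ y in 𝓝 w₀, mWirt (n := n) g y = 0) (w : ℂ) : mWirt (n := n) g w = 0 := by
  set S : Set ℂ := {w | ∀ᶠ y in 𝓝 w, mWirt (n := n) g y = 0} with hS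
  have hopen : IsOpen S := isOpen_setOfPred_eventually_nhds
  have hclosed : IsClosed S := by
    rw [← closure_subset_iff_isClosed]
    intro w hw
    have he := IsManifold.chart_mem_maximalAtlas (I := 𝓘(ℂ, Cn n)) (n := ω) (g w)
    have hx := mem_chart_source (Cn n) (g w)
    set e := chartAt (Cn n) (g w)
    obtain ⟨R, hR, hRe⟩ := Metric.nhds_basis_closedBall.mem_iff.1
      (hg.continuous.continuousAt.preimage_mem_nhds (e.open_source.mem_nhds hx))
    -- The centre `q`, near which the derivative vanishes, is within `R / 2` of `w`; the disc of
    -- radius `R / 2` about `q` then contains `w` and still maps into the chart.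
    obtain ⟨q, hqS, hq⟩ := Metric.mem_closure_iff.1 hw (R / 2) (by positivity)
    have hsub : Metric.closedBall q (R / 2) ⊆ g ⁻¹' e.source := by
      refine (Metric.closedBall_subset_closedBall' ?_).trans hRe
      rw [dist_comm]
      linarith
    have hZ : ∀ y, g y ∈ e.source → ContDiffAt ℝ ∞ (fun y => e (g y)) y := fun y hy =>
      ContMDiffAt.contDiffAt_chart he hg.contMDiffAt hy
    have hequiv : ∀ y, g y ∈ e.source →
        (mWirt (n := n) g y = 0 ↔ wirt (fun y => e (g y)) y = 0) := by
      intro y hy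
      rw [mWirt_eq he hg.contMDiffAt hy]
      exact map_eq_zero_iff _ (frame_injective he (e.map_source hy))
    have hzero : ∀ y ∈ Metric.ball q (R / 2), wirt (fun y => e (g y)) y = 0 := fun y hy =>
      eq_zero_of_wirtBar_eq (u := wirt fun y => e (g y))
        (A := harmonicCoeff (metricCoeff h.form e) fun y => e (g y))
        (fun y hy => contDiffAt_wirt (hZ y (hsub hy)))
        (fun y hy => (h.localKahler he).contDiffAt_harmonicCoeff (hZ y (hsub hy))
          (e.map_source (hsub hy)))
        (fun y hy => by
          filter_upwards [hg.continuous.continuousAt.eventually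
            (e.open_source.mem_nhds (hsub hy))] with x hx
          exact (h.localKahler he).wirtBar_wirt_eq (hZ x hx) (e.map_source hx)
            (hmin.tension_eq_zero h hg he hx))
        (by
          have hqs : g q ∈ e.source := hsub (Metric.mem_closedBall_self (by positivity))
          filter_upwards [hqS, hg.continuous.continuousAt.eventually
            (e.open_source.mem_nhds hqs)] with x h1 h2
          exact (hequiv x h2).1 h1) hy
    change ∀ᶠ y in 𝓝 w, mWirt (n := n) g y = 0
    filter_upwards [Metric.isOpen_ball.mem_nhds (show w ∈ Metric.ball q (R / 2) from hq)] with y hy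
    exact (hequiv y (hsub (Metric.ball_subset_closedBall hy))).2 (hzero y hy)
  have huniv : S = Set.univ := IsClopen.eq_univ ⟨hclosed, hopen⟩ ⟨w₀, h0⟩
  have hwS : w ∈ S := huniv ▸ Set.mem_univ w
  exact hwS.self_of_nhds

/-- `f_w̄ ≠ 0` is an open condition, so one such point produces an open set on which the pointwise
alternative forces `f_w = 0`; unique continuation does the rest. -/
theorem BarMinimizing.forall_eq_zero_or (hmin : BarMinimizing h g) (hpos : h.PosOrthBisectional)
    (hg : ContMDiff 𝓘(ℝ, ℂ) 𝓘(ℝ, Cn n) ∞ g)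
    (hopf : ∀ w, pairing h (g w) (mWirt g w) (mWirtBar g w) = 0)
    (hint : Integrable (densW h g)) :
    (∀ w, mWirt (n := n) g w = 0) ∨ ∀ w, mWirtBar (n := n) g w = 0 := by
  refine or_iff_not_imp_right.2 fun hne => ?_
  obtain ⟨w₀, hw₀⟩ := not_forall.1 hne
  have hdens : densBar h g w₀ ≠ 0 := fun h0 => hw₀ (eq_zero_of_pairing_self h h0)
  refine hmin.mWirt_eq_zero hg (w₀ := w₀) ?_
  filter_upwards [(continuous_densBar h hg).continuousAt.eventually_ne hdens] with y hy
  refine (hmin.eq_zero_or hpos hg hopf hint y).resolve_right fun h0 => hy ?_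
  rw [densBar_eq_pairing, h0, pairing_zero_right, zero_re]

end UniqueContinuation

/-! ### From vanishing derivatives on the plane to the whole sphere -/

section Conclusion

variable {n : ℕ} {M : Type*} [TopologicalSpace M] [ChartedSpace (Cn n) M]
  [IsManifold 𝓘(ℂ, Cn n) ω M] (h : KahlerMetric n M)

/-- Cauchy–Riemann equations in a chart. -/
theorem mdifferentiableAt_of_mWirtBar {g : ℂ → M} (hg : ContMDiff 𝓘(ℝ, ℂ) 𝓘(ℝ, Cn n) ∞ g) {w : ℂ}
    (h0 : mWirtBar (n := n) g w = 0) : MDifferentiableAt 𝓘(ℂ, ℂ) 𝓘(ℂ, Cn n) g w := by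
  have he := IsManifold.chart_mem_maximalAtlas (I := 𝓘(ℂ, Cn n)) (n := ω) (g w)
  have hx := mem_chart_source (Cn n) (g w)
  set e := chartAt (Cn n) (g w)
  have hZ := ContMDiffAt.contDiffAt_chart he hg.contMDiffAt hx
  rw [mWirtBar_eq he hg.contMDiffAt hx, map_eq_zero_iff _ (frame_injective he (e.map_source hx)),
    ← differentiableAt_iff_wirtBar (hZ.differentiableAt (by simp))] at h0
  have h1 : MDifferentiableAt 𝓘(ℂ, ℂ) 𝓘(ℂ, Cn n) (fun y => e.symm (e (g y))) w :=
    MDifferentiableAt.comp (g := e.symm) (f := fun y => e (g y)) w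
      ((contMDiffAt_symm_of_mem_maximalAtlas he (e.map_source hx)).mdifferentiableAt (by simp))
      h0.mdifferentiableAt
  refine h1.congr_of_eventuallyEq ?_
  filter_upwards [hg.continuous.continuousAt.eventually (e.open_source.mem_nhds hx)] with y hy
  exact (e.left_inv hy).symm

/-- The relation gives vanishing away from `0`; the value at `0`, which stands for the point at
infinity, follows by continuity. -/
theorem eq_zero_of_inversion {D D' : ℂ → ℝ} (hD' : Continuous D')
    (hDD : ∀ w, w ≠ 0 → D w = (‖w‖ ^ 4)⁻¹ * D' w⁻¹) (h0 : ∀ w, D w = 0) (w : ℂ) : D' w = 0 := by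
  have h1 : ∀ w ∈ ({0}ᶜ : Set ℂ), D' w = 0 := by
    intro w hw
    have hw : w ≠ 0 := hw
    have h2 := hDD w⁻¹ (inv_ne_zero hw)
    rw [h0, inv_inv] at h2
    have h3 : (‖w⁻¹‖ ^ 4)⁻¹ ≠ 0 :=
      inv_ne_zero (pow_ne_zero _ (norm_ne_zero_iff.2 (inv_ne_zero hw)))
    exact (mul_eq_zero.1 h2.symm).resolve_left h3
  have h2 : D' = fun _ => 0 :=
    hD'.ext_on (dense_compl_singleton (0 : ℂ)) continuous_const h1
  rw [h2]

variable {f : P1 → M} (hf : ContMDiff 𝓘(ℝ, ℂ) 𝓘(ℝ, Cn n) ∞ f)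
include hf

include h in
theorem mWirtBar_affine_inv_eq_zero (h0 : ∀ w, mWirtBar (n := n) (fun w : ℂ => f w) w = 0) (w : ℂ) :
    mWirtBar (n := n) (fun w : ℂ => f (invFun w)) w = 0 := by
  refine eq_zero_of_pairing_self h (x := f (invFun w)) ?_
  refine eq_zero_of_inversion (continuous_densBar h (contMDiff_affine_inv hf))
    (fun _ hw => densBar_affine h hf hw) (fun w => ?_) w
  rw [densBar_eq_pairing, h0, pairing_zero_right, zero_re]

include h in
theorem mWirt_affine_inv_eq_zero (h0 : ∀ w, mWirt (n := n) (fun w : ℂ => f w) w = 0) (w : ℂ) :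
    mWirt (n := n) (fun w : ℂ => f (invFun w)) w = 0 := by
  refine eq_zero_of_pairing_self h (x := f (invFun w)) ?_
  refine eq_zero_of_inversion (continuous_densW h (contMDiff_affine_inv hf))
    (fun _ hw => densW_affine h hf hw) (fun w => ?_) w
  rw [densW_eq_pairing, h0, pairing_zero_right, zero_re]

include h in
theorem isHolomorphic_of_mWirtBar (h0 : ∀ w, mWirtBar (n := n) (fun w : ℂ => f w) w = 0) :
    IsHolomorphic n f := by
  intro p
  induction p using OnePoint.rec with
  | infty =>
    have hz : chartInfty OnePoint.infty = 0 := by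
      rw [chartInfty_apply, invFun_infty, chartZero_coe]
    have hs : (OnePoint.infty : P1) ∈ chartInfty.source :=
      (mem_chartInfty_source _).2 ⟨0, by rw [invFun_infty]⟩
    have h1 : MDifferentiableAt 𝓘(ℂ, ℂ) 𝓘(ℂ, Cn n) (fun w : ℂ => f (invFun w))
        (chartInfty OnePoint.infty) :=
      mdifferentiableAt_of_mWirtBar (contMDiff_affine_inv hf)
        (mWirtBar_affine_inv_eq_zero h hf h0 _)
    have h2 := MDifferentiableAt.comp (g := fun w : ℂ => f (invFun w)) OnePoint.infty h1
      ((contMDiffAt_of_mem_maximalAtlas chartInfty_mem_maximalAtlas hs).mdifferentiableAt (by simp))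
    refine h2.congr_of_eventuallyEq ?_
    filter_upwards [chartInfty.open_source.mem_nhds hs] with q hq
    exact congrArg f (chartInfty.left_inv hq).symm
  | coe w =>
    have hs : (w : P1) ∈ chartZero.source := by simp
    have h1 : MDifferentiableAt 𝓘(ℂ, ℂ) 𝓘(ℂ, Cn n) (fun w : ℂ => f w) (chartZero (w : P1)) :=
      mdifferentiableAt_of_mWirtBar (contMDiff_affine hf) (h0 _)
    have h2 := MDifferentiableAt.comp (g := fun w : ℂ => f w) (w : P1) h1
      ((contMDiffAt_of_mem_maximalAtlas chartZero_mem_maximalAtlas hs).mdifferentiableAt (by simp))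
    refine h2.congr_of_eventuallyEq ?_
    filter_upwards [chartZero.open_source.mem_nhds hs] with q hq
    exact congrArg f (chartZero.left_inv hq).symm

omit [IsManifold 𝓘(ℂ, Cn n) ω M] in
theorem realDeriv_eq (p : P1) (v : ℂ) : (realDeriv n f p v : Cn n) =
    fderiv ℝ (fun y => chartAt (Cn n) (f p) (f ((chartAt ℂ p).symm y))) (chartAt ℂ p p) v := by
  change (mfderiv 𝓘(ℝ, ℂ) 𝓘(ℝ, Cn n) f p v : Cn n) = _
  rw [((hf p).mdifferentiableAt (by simp)).mfderiv]
  simp only [writtenInExtChartAt, extChartAt, mfld_simps, Function.comp_def]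
  rw [fderivWithin_univ]
  rfl

/-- With `∂/∂w` part zero the differential is `v ↦ v̄ f_w̄`, which is conjugate linear. The map `g`
stands for either of the two affine expressions of `f`. -/
theorem realDeriv_conj {p : P1} {g : ℂ → M} (hg : ContMDiff 𝓘(ℝ, ℂ) 𝓘(ℝ, Cn n) ∞ g) {w : ℂ}
    (hgw : g w = f p) (hpg : ∀ y, f ((chartAt ℂ p).symm y) = g y) (hpw : chartAt ℂ p p = w)
    (h0 : mWirt (n := n) g w = 0) (v : ℂ) :
    (realDeriv n f p (I * v : ℂ) : Cn n) = -(I • (realDeriv n f p v : Cn n) : Cn n) := by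
  have he := IsManifold.chart_mem_maximalAtlas (I := 𝓘(ℂ, Cn n)) (n := ω) (f p)
  have hx : g w ∈ (chartAt (Cn n) (f p)).source := by rw [hgw]; exact mem_chart_source _ _
  rw [mWirt_eq he hg.contMDiffAt hx,
    map_eq_zero_iff _ (frame_injective he ((chartAt (Cn n) (f p)).map_source hx))] at h0
  have h1 := realDeriv_eq hf p v
  have h2 := realDeriv_eq hf p (I * v)
  simp only [hpg, hpw, fderiv_apply_eq_wirt, h0, smul_zero, zero_add] at h1 h2
  rw [h2, h1]
  have h3 : ∀ b : Cn n, conj (I * v) • b = -(I • (conj v • b)) := fun b => by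
    rw [map_mul, conj_I, smul_smul, ← neg_smul, neg_mul]
  exact h3 _

include h in
theorem isConjHolomorphic_of_mWirt (h0 : ∀ w, mWirt (n := n) (fun w : ℂ => f w) w = 0) :
    IsConjHolomorphic n f := by
  refine ⟨hf.mdifferentiable (by simp), fun p v => ?_⟩
  induction p using OnePoint.rec with
  | infty =>
    refine realDeriv_conj hf (contMDiff_affine_inv hf) (w := 0) (by simp) (fun _ => rfl) ?_
      (mWirt_affine_inv_eq_zero h hf h0 _) v
    change chartInfty OnePoint.infty = 0
    rw [chartInfty_apply, invFun_infty, chartZero_coe]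
  | coe w =>
    exact realDeriv_conj hf (contMDiff_affine hf) (w := w) rfl (fun _ => rfl) (chartZero_coe w)
      (h0 _) v

end Conclusion

end KahlerGeometry

open KahlerGeometry RiemannSphere

theorem theorem1p2 {n : ℕ} (hn : 2 ≤ n) {M : Type*} [TopologicalSpace M] [T2Space M]
    [CompactSpace M] [ChartedSpace (Cn n) M] [IsManifold 𝓘(ℂ, Cn n) ω M]
    (h : KahlerMetric n M) (hpos : h.PosOrthBisectional)
    (f : C^∞⟮𝓘(ℝ, ℂ), P1; 𝓘(ℝ, Cn n), M⟯) (hf : IsEnergyMinimizing h f) :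
    IsHolomorphic n f ∨ IsConjHolomorphic n f := by
  have hs : ContMDiff 𝓘(ℝ, ℂ) 𝓘(ℝ, Cn n) ∞ f := f.contMDiff
  have hg := contMDiff_affine hs
  have hmin : BarMinimizing h fun w : ℂ => f w := fun F r K X hF t ht =>
    hF.setIntegral_famBar_le h hf ht
  have hopf : ∀ w : ℂ, pairing h (f w) (mWirt (fun w : ℂ => f w) w)
      (mWirtBar (fun w : ℂ => f w) w) = 0 := fun w =>
    -- Liouville's theorem for an entire function tending to `0` at infinity.
    (hmin.differentiable_hopf h hg).apply_eq_of_tendsto_cocompact w (tendsto_hopf h hs)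
  rcases hmin.forall_eq_zero_or hpos hg hopf (integrable_densW h hs) with h0 | h0
  · exact Or.inr (isConjHolomorphic_of_mWirt h hs h0)
  · exact Or.inl (isHolomorphic_of_mWirtBar h hs h0)
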